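/- Let $p_1<p_2<\cdots$ be the primes, and for $N\ge1$ let $\Omega_N$ be the set of positive integers with no prime divisor larger than $p_N$. Let $C_N=\sum_{n\in\Omega_N}\frac1n<\infty$ and let $P_N$ be the probability measure on $\Omega_N$ with $P_N(\{n\})=\frac1{C_N}\frac1n$. For $k\ge2$ let $S_k$ be the set of $k$-free positive integers (those divisible by $p^k$ for no prime $p$), and let $P_N^{(k)}=P_N(\,\cdot\,|S_k)$. For $A,B\subset\mathbb{N}=\{1,2,\ldots\}$ put $$D_{\text{log-indep}}(A)=\lim_{N\to\infty}P_N(A\cap\Omega_N),\qquad D_{\text{log-indep}}(A|B)=\frac{D_{\text{log-indep}}(A\cap B)}{D_{\text{log-indep}}(B)},\qquad D_{\text{nat}}(A)=\lim_{N\to\infty}\frac{|A\cap\{1,\ldots,N\}|}{N},$$ whenever the limits exist (and the denominator $D_{\text{log-indep}}(B)$ is nonzero). Let $\rho$ be the Dickman function: the unique continuous function on $(0,\infty)$ with $\rho(x)=1$ for $0<x\le1$ and $x\rho'(x)+\rho(x-1)=0$ for $x>1$. Let $\gamma$ be Euler's constant. Let $p^+(n)$ be the largest prime divisor of $n$, with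 $p^+(1)=1$ and $\frac{\log n}{\log p^+(n)}=0$ at $n=1$. **Theorem.** The function $\rho$ is integrable on $(0,\infty)$, and $e^{-\gamma}\rho(x)$, $x>0$, is a probability density; the distribution with this density is called the Dickman distribution. Moreover: 1. If $D$ is a random variable with the Dickman distribution, then under $P_N$, and for every $k\ge2$ under $P_N^{(k)}$, the random variable $\frac{\log n}{\log p^+(n)}$ converges weakly to $D+1$ as $N\to\infty$. 2. For all $s\ge1$, $$D_{\text{log-indep}}\big(\{n: p^+(n)\le n^{1/s}\}\big)=D_{\text{log-indep}}\big(\{n:\tfrac{\log n}{\log p^+(n)}\ge s\}\big)=e^{-\gamma}\int_{s-1}^\infty\rho(x)\,dx .$$ 3. For all $s\ge1$ and $k\ge2$, $$D_{\text{log-indep}}\big(\{n: p^+(n)\le n^{1/s}\}\,|\,S_k\big)=D_{\text{log-indep}}\big(\{n:\tfrac{\log n}{\log p^+(n)}\ge s\}\,|\,S_k\big)=e^{-\gamma}\int_{s-1}^\infty\rho(x)\,dx .$$ 4. For all $s\ge1$, $D_{\text{nat}}\big(\{n: p^+(n)\le n^{1/s}\}\big)=\rho(s)$, and for all $s>1$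 this differs from the density in 2: $e^{-\gamma}\int_{s-1}^\infty\rho(x)\,dx\ne\rho(s)$. (In 2, 3 and 4 the existence of all the limits is part of the claim.) -/

import Mathlib

open MeasureTheory ProbabilityTheory Filter Topology
open scoped ENNReal

noncomputable section

namespace DickmanPN

/-! ## The Dickman function and the Dickman distribution -/

/-- Picard iterates of the integrated form `ρ(x) = 1 - ∫_1^x ρ(t-1)/t dt` (`x > 1`) of the
differential-delay equation `x ρ'(x) + ρ(x-1) = 0`, starting from the constant `1`. The `n`-th
iterate is already exact on `x ≤ n + 1`. -/
def rhoIter : ℕ → ℝ → ℝ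
  | 0, _ => 1
  | n + 1, x => 1 - ∫ t in (1 : ℝ)..(max 1 x), rhoIter n (t - 1) / t

/-- The Dickman function. It is continuous, equal to `1` on `(0,1]`, and satisfies
`x ρ'(x) + ρ(x-1) = 0` for `x > 1`: see `rho_spec`, and `rho_unique` for uniqueness on `(0,∞)`.
(Only its values on `(0,∞)` matter.) -/
def rho (x : ℝ) : ℝ := rhoIter ⌈x⌉₊ x

/-- The defining properties of the Dickman function, as a function on `(0,∞)`. -/
structure IsDickmanFunction (r : ℝ → ℝ) : Prop where
  continuousOn : ContinuousOn r (Set.Ioi 0)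
  eq_one : ∀ x ∈ Set.Ioc (0 : ℝ) 1, r x = 1
  differentiableAt : ∀ x, 1 < x → DifferentiableAt ℝ r x
  delay_eq : ∀ x, 1 < x → x * deriv r x + r (x - 1) = 0

lemma rhoIter_succ_eq (n : ℕ) (x : ℝ) :
    rhoIter (n + 1) x = 1 - ∫ t in (1 : ℝ)..(max 1 x), rhoIter n (t - 1) / max 1 t := by
  rw [rhoIter]
  congr 1
  refine intervalIntegral.integral_congr fun t ht => ?_
  rw [Set.uIcc_of_le (le_max_left _ _)] at ht
  simp only [max_eq_right ht.1]

lemma continuous_integrand {f : ℝ → ℝ} (hf : Continuous f) :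
    Continuous fun t : ℝ => f (t - 1) / max 1 t :=
  (hf.comp (continuous_id.sub continuous_const)).div (continuous_const.max continuous_id)
    fun t => (lt_of_lt_of_le one_pos (le_max_left 1 t)).ne'

lemma continuous_rhoIter (n : ℕ) : Continuous (rhoIter n) := by
  induction n with
  | zero => exact continuous_const
  | succ n ih =>
    have h : rhoIter (n + 1) = fun x =>
        1 - ∫ t in (1 : ℝ)..(max 1 x), rhoIter n (t - 1) / max 1 t :=
      funext (rhoIter_succ_eq n)
    rw [h]
    have hc := intervalIntegral.continuous_primitive (μ := volume)
      (fun a b => (continuous_integrand ih).intervalIntegrable a b) 1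
    exact continuous_const.sub (hc.comp (continuous_const.max continuous_id))

lemma rhoIter_succ (n : ℕ) : ∀ x : ℝ, x ≤ n + 1 → rhoIter (n + 1) x = rhoIter n x := by
  induction n with
  | zero =>
    intro x hx
    have : max 1 x = 1 := max_eq_left (by simpa using hx)
    simp [rhoIter, this]
  | succ n ih =>
    intro x hx
    rw [rhoIter, rhoIter]
    congr 1
    refine intervalIntegral.integral_congr fun t ht => ?_
    rw [Set.uIcc_of_le (le_max_left _ _)] at ht
    have h2 : t ≤ n + 2 := ht.2.trans (max_le (by linarith [n.cast_nonneg (α := ℝ)])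
      (by push_cast at hx; linarith))
    simp only [ih (t - 1) (by linarith)]

lemma rho_eq {n : ℕ} {x : ℝ} (h : x ≤ n) : rho x = rhoIter n x := by
  have key : ∀ m : ℕ, x ≤ m → ∀ d, rhoIter (m + d) x = rhoIter m x := by
    intro m hm d
    induction d with
    | zero => rfl
    | succ d ih =>
      rw [← add_assoc, rhoIter_succ _ _ (by push_cast; linarith [d.cast_nonneg (α := ℝ)]), ih]
  obtain ⟨d, rfl⟩ := Nat.exists_eq_add_of_le (Nat.ceil_le.2 h)
  exact (key _ (Nat.le_ceil x) d).symm

lemma rho_eventuallyEq {n : ℕ} {x : ℝ} (h : x < n) : rho =ᶠ[𝓝 x] rhoIter n := by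
  filter_upwards [Iio_mem_nhds h] with y hy using rho_eq (le_of_lt hy)

lemma continuous_rho : Continuous rho := by
  refine continuous_iff_continuousAt.2 fun x => ?_
  obtain ⟨n, hn⟩ := exists_nat_gt x
  exact (continuous_rhoIter n).continuousAt.congr (rho_eventuallyEq hn).symm

lemma hasDerivAt_rho {x : ℝ} (hx : 1 < x) : HasDerivAt rho (-(rho (x - 1) / x)) x := by
  obtain ⟨n, hn⟩ := exists_nat_gt x
  have h1 : HasDerivAt
      (fun y => 1 - ∫ t in (1 : ℝ)..y, rhoIter n (t - 1) / max 1 t)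
      (-(rhoIter n (x - 1) / max 1 x)) x := by
    have hc := continuous_integrand (continuous_rhoIter n)
    simpa using (intervalIntegral.integral_hasDerivAt_right (hc.intervalIntegrable 1 x)
      (hc.stronglyMeasurableAtFilter volume (𝓝 x)) hc.continuousAt).const_sub 1
  rw [rho_eq (n := n) (x := x - 1) (by linarith)]
  rw [max_eq_right hx.le] at h1
  refine h1.congr_of_eventuallyEq ?_
  filter_upwards [rho_eventuallyEq (n := n + 1) (x := x) (by push_cast; linarith),
    Ioi_mem_nhds hx] with y hy hy1
  rw [hy, rhoIter_succ_eq, max_eq_right (le_of_lt hy1)]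

/-- `rho` is the Dickman function. -/
theorem rho_spec : IsDickmanFunction rho where
  continuousOn := continuous_rho.continuousOn
  eq_one x hx := by
    rw [rho_eq (n := 1) (by simpa using hx.2)]
    simp [rhoIter, max_eq_left hx.2]
  differentiableAt x hx := (hasDerivAt_rho hx).differentiableAt
  delay_eq x hx := by
    rw [(hasDerivAt_rho hx).deriv]
    field_simp
    ring

/-- The Dickman function is unique on `(0,∞)`. -/
theorem rho_unique {r : ℝ → ℝ} (hr : IsDickmanFunction r) : Set.EqOn r rho (Set.Ioi 0) := by
  have key : ∀ n : ℕ, ∀ x : ℝ, 0 < x → x ≤ n + 1 → r x = rho x := by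
    intro n
    induction n with
    | zero =>
      intro x h0 h1
      have hx : x ∈ Set.Ioc (0 : ℝ) 1 := ⟨h0, by simpa using h1⟩
      rw [hr.eq_one x hx, rho_spec.eq_one x hx]
    | succ n ih =>
      intro x h0 h1
      push_cast at h1
      rcases le_or_gt x 1 with hx | hx
      · rw [hr.eq_one x ⟨h0, hx⟩, rho_spec.eq_one x ⟨h0, hx⟩]
      have hsub : Set.Icc 1 x ⊆ Set.Ioi 0 := fun y hy => lt_of_lt_of_le one_pos hy.1
      have hd : ∀ y ∈ Set.Ico 1 x, 1 < y → HasDerivAt (fun z => r z - rho z) 0 y := by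
        intro y hy h1y
        have e1 := hr.delay_eq y h1y
        have e2 := rho_spec.delay_eq y h1y
        rw [ih (y - 1) (by linarith) (by linarith [hy.2])] at e1
        have hy0 : y ≠ 0 := by positivity
        have e3 : deriv r y = deriv rho y := mul_left_cancel₀ hy0 (by linarith)
        have e4 := (hr.differentiableAt y h1y).hasDerivAt.sub
          (rho_spec.differentiableAt y h1y).hasDerivAt
        rw [e3, sub_self] at e4
        exact e4
      obtain ⟨c, hc, hc'⟩ := exists_hasDerivAt_eq_slope (fun z => r z - rho z) (fun _ => 0) hx
        ((hr.continuousOn.sub rho_spec.continuousOn).mono hsub)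
        (fun y hy => hd y ⟨hy.1.le, hy.2⟩ hy.1)
      have h11 : r 1 - rho 1 = 0 := by
        rw [hr.eq_one 1 ⟨one_pos, le_rfl⟩, rho_spec.eq_one 1 ⟨one_pos, le_rfl⟩, sub_self]
      rw [eq_comm, div_eq_zero_iff, h11] at hc'
      rcases hc' with h | h <;> linarith
  intro x hx
  exact key ⌈x⌉₊ x hx ((Nat.le_ceil x).trans (by linarith))

/-- The Dickman distribution: the measure on `ℝ` with density `e^{-γ} ρ(x)` on `(0,∞)`. -/
def dickmanLaw : Measure ℝ :=
  (volume.restrict (Set.Ioi 0)).withDensity fun x =>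
    ENNReal.ofReal (Real.exp (-Real.eulerMascheroniConstant) * rho x)

/-! ## The measures `P_N` and `P_N^{(k)}` -/

/-- `Ω_N`: the positive integers with no prime divisor larger than the `N`-th prime `p_N`.
As `Nat.nth Nat.Prime` is indexed from `0`, `p_j = Nat.nth Nat.Prime (j - 1)`, and the primes
`p_j` with `j > N` are the `Nat.nth Nat.Prime j` with `j ≥ N`. -/
def Omega (N : ℕ) : Set ℕ := {n | 0 < n ∧ ∀ j, N ≤ j → ¬ Nat.nth Nat.Prime j ∣ n}

/-- `C_N = ∑_{n ∈ Ω_N} 1/n`. -/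
def C (N : ℕ) : ℝ≥0∞ := ∑' n : Omega N, ((n : ℕ) : ℝ≥0∞)⁻¹

/-- `P_N`, as a measure on `ℕ` carried by `Ω_N`: mass `1/(C_N n)` at each `n ∈ Ω_N`. -/
def P (N : ℕ) : Measure ℕ :=
  Measure.sum fun n : Omega N => ((C N)⁻¹ * ((n : ℕ) : ℝ≥0∞)⁻¹) • Measure.dirac (n : ℕ)

/-- `S_k`: the `k`-free positive integers. -/
def S (k : ℕ) : Set ℕ := {n | 0 < n ∧ ∀ p, p.Prime → ¬ p ^ k ∣ n}

/-- `P_N^{(k)} = P_N( · | S_k)`. -/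
def Pk (k N : ℕ) : Measure ℕ := ProbabilityTheory.cond (P N) (S k)

lemma one_mem_Omega (N : ℕ) : 1 ∈ Omega N :=
  ⟨one_pos, fun j _ h => (Nat.prime_nth_prime j).one_lt.ne' (Nat.dvd_one.1 h)⟩

lemma Omega_subset (N : ℕ) : Omega N ⊆ Nat.smoothNumbers (Nat.nth Nat.Prime N) := by
  rintro n ⟨-, h⟩
  refine Nat.mem_smoothNumbers'.2 fun p hp hpn => ?_
  by_contra! hle
  have hp' : Nat.nth Nat.Prime (Nat.count Nat.Prime p) = p := Nat.nth_count hp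
  refine h (Nat.count Nat.Prime p) ?_ (hp'.symm ▸ hpn)
  rw [← hp'] at hle
  exact (Nat.nth_le_nth Nat.infinite_setOfPred_prime).1 hle

lemma C_ne_zero (N : ℕ) : C N ≠ 0 := by
  intro h
  have := ENNReal.tsum_eq_zero.1 h ⟨1, one_mem_Omega N⟩
  simp at this

/-- The monoid homomorphism `n ↦ 1/n`. -/
def invHom : ℕ →* ℝ where
  toFun n := (n : ℝ)⁻¹
  map_one' := by simp
  map_mul' a b := by push_cast; rw [mul_inv]

lemma C_ne_top (N : ℕ) : C N ≠ ∞ := by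
  have hs := (EulerProduct.summable_and_hasSum_smoothNumbers_prod_primesBelow_geometric
    (f := invHom) (fun {p} hp => by
      have : (1 : ℝ) < p := by exact_mod_cast hp.one_lt
      simpa [invHom] using inv_lt_one_of_one_lt₀ this) (Nat.nth Nat.Prime N)).1
  have hs' := hs.comp_injective (Set.inclusion_injective (Omega_subset N))
  have := hs'.tsum_ofReal_ne_top
  rw [C]
  convert this using 4 with n
  have hn : (0 : ℝ) < ((n : ℕ) : ℝ) := by exact_mod_cast n.2.1
  simp only [Function.comp_apply, invHom, MonoidHom.coe_mk, OneHom.coe_mk,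
    norm_inv, Real.norm_natCast]
  rw [ENNReal.ofReal_inv_of_pos hn, ENNReal.ofReal_natCast]

instance isProbabilityMeasure_P (N : ℕ) : IsProbabilityMeasure (P N) := by
  constructor
  rw [P, Measure.sum_apply _ MeasurableSet.univ]
  simp only [Measure.smul_apply, measure_univ, smul_eq_mul, mul_one]
  rw [ENNReal.tsum_mul_left]
  exact ENNReal.inv_mul_cancel (C_ne_zero N) (C_ne_top N)

theorem isProbabilityMeasure_Pk {k : ℕ} (hk : 2 ≤ k) (N : ℕ) :
    IsProbabilityMeasure (Pk k N) := by
  refine cond_isProbabilityMeasure fun h => ?_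
  rw [P, Measure.sum_apply _ (MeasurableSet.of_discrete)] at h
  have h1 := ENNReal.tsum_eq_zero.1 h ⟨1, one_mem_Omega N⟩
  have hmem : 1 ∈ S k := ⟨one_pos, fun p hp hd =>
    (Nat.one_lt_pow (by omega) hp.one_lt).ne' (Nat.dvd_one.1 hd)⟩
  simp [hmem, C_ne_top] at h1

/-! ## Densities -/

/-- `D_{log-indep}(A)` exists and equals `d`. -/
def HasLogIndepDensity (A : Set ℕ) (d : ℝ) : Prop :=
  Tendsto (fun N => (P N).real (A ∩ Omega N)) atTop (𝓝 d)

/-- `D_{log-indep}(A | B) = D_{log-indep}(A ∩ B) / D_{log-indep}(B)` exists and equals `d`. -/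
def HasCondLogIndepDensity (A B : Set ℕ) (d : ℝ) : Prop :=
  ∃ a b, HasLogIndepDensity (A ∩ B) a ∧ HasLogIndepDensity B b ∧ b ≠ 0 ∧ d = a / b

/-- `D_{nat}(A) = lim |A ∩ {1, …, N}| / N` exists and equals `d`. -/
def HasNatDensity (A : Set ℕ) (d : ℝ) : Prop :=
  Tendsto (fun N : ℕ => ((A ∩ Set.Icc 1 N).ncard : ℝ) / N) atTop (𝓝 d)

/-! ## The largest prime divisor -/

/-- `p⁺(n)`, the largest prime divisor of `n ≥ 2`, with the convention `p⁺(1) = 1`. -/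
def pPlus (n : ℕ) : ℕ := max 1 (n.primeFactors.sup id)

/-- `log n / log p⁺(n)`. At `n = 1` this is `0 / 0 = 0`, the usual convention. -/
def logRatio (n : ℕ) : ℝ := Real.log n / Real.log (pPlus n)

/-- The set of `n^{1/s}`-smooth numbers `{n ≥ 1 : p⁺(n) ≤ n^{1/s}}`. -/
def smoothSet (s : ℝ) : Set ℕ := {n | 0 < n ∧ (pPlus n : ℝ) ≤ (n : ℝ) ^ (1 / s)}

/-- The set `{n ≥ 1 : log n / log p⁺(n) ≥ s}`. -/
def logRatioSet (s : ℝ) : Set ℕ := {n | 0 < n ∧ s ≤ logRatio n}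

end DickmanPN

end

open MeasureTheory ProbabilityTheory Filter Topology
open scoped ENNReal

noncomputable section

namespace DickmanPN

/-! ## The Dickman function -/

/-! Write an integer `n > 1` with largest prime divisor `q j` as `q j * m` with `m ∈ Omega (j + 1)`.
Under `P N`, conditionally on this prime, `m` has law `P (j + 1)`, and `log n / log p⁺(n) = 1 + log
m / log (q j)`. Thus `P N` is, apart from `n = 1`, a mixture over `j < N` with weights `(C_{j+1} -
C_j) / C_N` (`mass_eq_sum`). Since `C_N → ∞`, a weighted Cesàro argument
(`tendsto_sum_increments_div`) reduces everything to one limit law: `log m / log (q j)` under `P (j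
+ 1)` tends to the Dickman distribution (`tendsto_mass_log_ge`). This explains the shift by `1`.

The limit law comes from Dickman's theorem `Ψ(y^u, y) / y^u → ρ(u)` (`tendsto_smoothCount`). Partial
summation turns it into `∑ 1/m ~ log y ∫_0^x ρ` over `y`-smooth `m ≤ y^x`. A first-moment bound
(`exists_mass_tail_le`) gives tightness, so one may let `x → ∞`; with `∫_0^∞ ρ = e^γ` this yields
`C_N ~ e^γ log p_N` and the normalization. Dickman's theorem itself is an induction on the range of
`u`: Buchstab's identity expresses `Ψ(x, y)` through the `Ψ(x/p, p)`, and Mertens' second theorem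
turns the resulting sum over primes into the integral in the delay equation.

The mass `e^γ` is found from the Laplace transform of `ρ`. The delay equation makes its product with
`exp(Ein(s))` constant; this constant is the mass at `s = 0`, while `s` times the transform tends to
`1` and `Ein(n) - log n → γ`.

For the `k`-free integers, `n = a b^k` with `a` `k`-free is a unique factorization, and `∑ b^{-k}`
converges. A bounded `b` does not change `log n / log p_N` in the limit, so being `k`-free is
asymptotically independent of the size of `m` (`tendsto_powSum_mul_mass_kfree`). Passing from `m` to
`q j * m` only disturbs multiples of `q j`, a proportion `1 / q j`.

The natural density follows from Dickman's theorem and continuity of `ρ`. The two densities differ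
because their difference vanishes at `s = 1` and at infinity and has a derivative that changes sign
exactly once, at `s = e^γ` (`rho_lt_dickmanTail`). -/

lemma rho_of_le_one {x : ℝ} (hx : x ≤ 1) : rho x = 1 := by
  rw [rho_eq (n := 1) (by simpa using hx)]
  simp [rhoIter, max_eq_left hx]

lemma intervalIntegrable_rho (a b : ℝ) : IntervalIntegrable rho volume a b :=
  continuous_rho.intervalIntegrable a b

lemma hasDerivAt_primitive_rho (x : ℝ) :
    HasDerivAt (fun y => ∫ t in (0 : ℝ)..y, rho t) (rho x) x :=
  intervalIntegral.integral_hasDerivAt_right (intervalIntegrable_rho 0 x)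
    (continuous_rho.stronglyMeasurableAtFilter volume (𝓝 x)) continuous_rho.continuousAt

/-- The integral form of the delay equation. -/
lemma mul_rho_eq_integral {x : ℝ} (hx : 1 ≤ x) : x * rho x = ∫ t in (x - 1)..x, rho t := by
  have hsub : ∀ y, ∫ t in (y - 1)..y, rho t
      = (∫ t in (0 : ℝ)..y, rho t) - ∫ t in (0 : ℝ)..(y - 1), rho t := fun y =>
    (intervalIntegral.integral_interval_sub_left (intervalIntegrable_rho _ _)
      (intervalIntegrable_rho _ _)).symm
  set f : ℝ → ℝ := fun y => y * rho y -
    ((∫ t in (0 : ℝ)..y, rho t) - ∫ t in (0 : ℝ)..(y - 1), rho t) with hf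
  have hcp : Continuous fun y => ∫ t in (0 : ℝ)..y, rho t :=
    continuous_iff_continuousAt.2 fun y => (hasDerivAt_primitive_rho y).continuousAt
  have hfc : Continuous f := by
    have := continuous_rho
    fun_prop
  have hd : ∀ y, 1 < y → HasDerivAt f 0 y := by
    intro y hy
    have h1 := (hasDerivAt_id' y).fun_mul (hasDerivAt_rho hy)
    have h2 := hasDerivAt_primitive_rho y
    have h3 := (hasDerivAt_primitive_rho (y - 1)).comp y ((hasDerivAt_id' y).sub_const 1)
    refine (h1.fun_sub (h2.fun_sub h3)).congr_deriv ?_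
    have : y ≠ 0 := by positivity
    field_simp
    ring
  have h1 : f 1 = 0 := by
    have : ∫ t in (0 : ℝ)..1, rho t = ∫ t in (0 : ℝ)..1, (1 : ℝ) :=
      intervalIntegral.integral_congr fun t ht => by
        rw [Set.uIcc_of_le zero_le_one] at ht
        exact rho_of_le_one ht.2
    simp only [hf, this, rho_of_le_one le_rfl]
    simp
  rw [hsub]
  rcases hx.eq_or_lt with rfl | hx
  · simpa [hf, sub_eq_zero] using h1
  obtain ⟨c, hc, hc'⟩ := exists_hasDerivAt_eq_slope f (fun _ => 0) hx hfc.continuousOn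
    (fun y hy => hd y hy.1)
  rw [eq_comm, div_eq_zero_iff, h1] at hc'
  rcases hc' with h | h
  · simp only [hf] at h
    linarith
  · linarith

/-- At a first point `z` where `ρ` fails to be positive, `z ρ(z)` would equal the integral of `ρ`
over `[z - 1, z]`, which is positive. -/
lemma rho_pos (x : ℝ) : 0 < rho x := by
  by_contra! hx
  set Z := {y : ℝ | rho y ≤ 0} with hZ
  have hlb : ∀ y ∈ Z, 1 ≤ y := fun y hy => by
    by_contra! h
    have : rho y ≤ 0 := hy
    rw [rho_of_le_one h.le] at this
    linarith
  have hclosed : IsClosed Z := isClosed_le continuous_rho continuous_const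
  have hmem : sInf Z ∈ Z := hclosed.csInf_mem ⟨x, hx⟩ ⟨1, hlb⟩
  set z := sInf Z with hz
  have h1 := hlb z hmem
  have hlt : ∀ y < z, 0 < rho y := fun y hy => by
    by_contra! h
    exact absurd (csInf_le ⟨1, hlb⟩ h) (not_le.2 hy)
  have h2 : 0 < ∫ t in (z - 1)..z, rho t :=
    intervalIntegral.intervalIntegral_pos_of_pos_on (intervalIntegrable_rho _ _)
      (fun y hy => hlt y hy.2) (by linarith)
  rw [← mul_rho_eq_integral h1] at h2
  have h3 : rho z ≤ 0 := hmem
  nlinarith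

lemma antitone_rho : Antitone rho := by
  have h1 : AntitoneOn rho (Set.Ici 1) := by
    refine antitoneOn_of_deriv_nonpos (convex_Ici 1) continuous_rho.continuousOn
      (fun x hx => ?_) fun x hx => ?_
    · rw [interior_Ici] at hx
      exact (hasDerivAt_rho hx).differentiableAt.differentiableWithinAt
    · rw [interior_Ici] at hx
      have h0 : (0 : ℝ) < x := zero_lt_one.trans hx
      rw [(hasDerivAt_rho hx).deriv]
      have := rho_pos (x - 1)
      have : 0 < rho (x - 1) / x := by positivity
      linarith
  intro x y hxy
  rcases le_total y 1 with hy | hy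
  · rw [rho_of_le_one hy, rho_of_le_one (hxy.trans hy)]
  rcases le_total x 1 with hx | hx
  · rw [rho_of_le_one hx, ← rho_of_le_one le_rfl]
    exact h1 Set.self_mem_Ici hy hy
  · exact h1 hx hy hxy

lemma rho_le_one (x : ℝ) : rho x ≤ 1 := by
  rcases le_total x 1 with h | h
  · exact (rho_of_le_one h).le
  · exact (antitone_rho h).trans (rho_of_le_one le_rfl).le

lemma mul_rho_le {x : ℝ} (hx : 1 ≤ x) : x * rho x ≤ rho (x - 1) := by
  rw [mul_rho_eq_integral hx]
  have : ∫ t in (x - 1)..x, rho t ≤ ∫ t in (x - 1)..x, rho (x - 1) :=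
    intervalIntegral.integral_mono_on (by linarith) (intervalIntegrable_rho _ _) (by simp)
      fun t ht => antitone_rho ht.1
  simpa using this

/-- Induction over unit steps with `x ρ(x) ≤ ρ(x - 1)`: one step costs a factor `e` on the
exponential side, and dividing by `x ≥ 3 > e` pays for it. This is where the `3` comes from. -/
lemma rho_le_exp (x : ℝ) : rho x ≤ Real.exp (3 - x) := by
  have key : ∀ n : ℕ, ∀ x : ℝ, x ≤ n + 3 → rho x ≤ Real.exp (3 - x) := by
    intro n
    induction n with
    | zero =>
      intro x hx
      refine (rho_le_one x).trans (Real.one_le_exp ?_)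
      simp at hx
      linarith
    | succ n ih =>
      intro x hx
      push_cast at hx
      rcases le_total x 3 with h | h
      · exact (rho_le_one x).trans (Real.one_le_exp (by linarith))
      have h1 := (mul_rho_le (by linarith : 1 ≤ x)).trans (ih (x - 1) (by linarith))
      have h2 : Real.exp (3 - (x - 1)) = Real.exp (3 - x) * Real.exp 1 := by
        rw [← Real.exp_add]
        ring_nf
      rw [h2] at h1
      have h3 := Real.exp_one_lt_d9
      have h4 := Real.exp_pos (3 - x)
      have h5 := rho_pos x
      by_contra! h6
      nlinarith
  obtain ⟨n, hn⟩ := exists_nat_ge (x - 3)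
  exact key n x (by linarith)

/-- Exponential weights below the decay rate of `ρ` leave it integrable, even against
a factor `x`. -/
lemma integrableOn_mul_exp_half : IntegrableOn (fun x : ℝ => x * Real.exp (3 - x / 2))
    (Set.Ioi 0) := by
  have h := integrableOn_rpow_mul_exp_neg_mul_rpow (p := 1) (s := 1) (b := 1 / 2)
    (by norm_num) one_pos (by norm_num)
  refine IntegrableOn.congr_fun (h.const_mul (Real.exp 3)) (fun x _ => ?_) measurableSet_Ioi
  simp only [Real.rpow_one]
  rw [show 3 - x / 2 = 3 + -(1 / 2) * x by ring, Real.exp_add]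
  ring

lemma integrableOn_exp_half : IntegrableOn (fun x : ℝ => Real.exp (3 - x / 2))
    (Set.Ioi 0) := by
  have h := integrableOn_rpow_mul_exp_neg_mul_rpow (p := 1) (s := 0) (b := 1 / 2)
    (by norm_num) one_pos (by norm_num)
  refine IntegrableOn.congr_fun (h.const_mul (Real.exp 3)) (fun x _ => ?_) measurableSet_Ioi
  simp only [Real.rpow_one, Real.rpow_zero, one_mul]
  rw [show 3 - x / 2 = 3 + -(1 / 2) * x by ring, Real.exp_add]

/-- Allowing `s` down to `-1/2` provides a neighbourhood of `0`, so that the Laplace transform can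
be differentiated under the integral at `s = 0` too. -/
lemma exp_mul_rho_le {s x : ℝ} (hs : -(1 / 2) ≤ s) (hx : 0 ≤ x) :
    Real.exp (-(s * x)) * rho x ≤ Real.exp (3 - x / 2) := by
  calc Real.exp (-(s * x)) * rho x ≤ Real.exp (x / 2) * Real.exp (3 - x) := by
        gcongr
        · exact (rho_pos x).le
        · nlinarith
        · exact rho_le_exp x
    _ = Real.exp (3 - x / 2) := by
        rw [← Real.exp_add]
        ring_nf

lemma integrableOn_exp_mul_rho {s : ℝ} (hs : -(1 / 2) ≤ s) :
    IntegrableOn (fun x => Real.exp (-(s * x)) * rho x) (Set.Ioi 0) := by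
  have := continuous_rho
  refine integrableOn_exp_half.mono' (by fun_prop) ?_
  filter_upwards [ae_restrict_mem measurableSet_Ioi] with x hx
  rw [Real.norm_of_nonneg (mul_nonneg (Real.exp_pos _).le (rho_pos x).le)]
  exact exp_mul_rho_le hs (le_of_lt hx)

lemma integrableOn_mul_exp_mul_rho {s : ℝ} (hs : -(1 / 2) ≤ s) :
    IntegrableOn (fun x => x * (Real.exp (-(s * x)) * rho x)) (Set.Ioi 0) := by
  have := continuous_rho
  refine integrableOn_mul_exp_half.mono' (by fun_prop) ?_
  filter_upwards [ae_restrict_mem measurableSet_Ioi] with x hx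
  have hx : 0 < x := hx
  rw [Real.norm_of_nonneg
    (mul_nonneg hx.le (mul_nonneg (Real.exp_pos _).le (rho_pos x).le))]
  gcongr
  exact exp_mul_rho_le hs hx.le

lemma integrableOn_rho : IntegrableOn rho (Set.Ioi 0) := by
  simpa using integrableOn_exp_mul_rho (s := 0) (by norm_num)

/-! ## The Laplace transform of the Dickman function -/

/-- The Laplace transform of `ρ`. -/
def rhoLaplace (s : ℝ) : ℝ := ∫ x in Set.Ioi 0, Real.exp (-(s * x)) * rho x

lemma hasDerivAt_rhoLaplace {s : ℝ} (hs : 0 ≤ s) :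
    HasDerivAt rhoLaplace (-∫ x in Set.Ioi 0, x * (Real.exp (-(s * x)) * rho x)) s := by
  have hc := continuous_rho
  have h := (hasDerivAt_integral_of_dominated_loc_of_deriv_le
    (μ := volume.restrict (Set.Ioi (0 : ℝ))) (x₀ := s) (s := Set.Ioi (s - 1 / 2))
    (F := fun s x => Real.exp (-(s * x)) * rho x)
    (F' := fun s x => -(x * (Real.exp (-(s * x)) * rho x)))
    (bound := fun x => x * Real.exp (3 - x / 2))
    (Ioi_mem_nhds (by linarith)) (Eventually.of_forall fun t => by fun_prop)
    (integrableOn_exp_mul_rho (by linarith)) (by fun_prop) ?_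
    integrableOn_mul_exp_half ?_).2
  · rwa [integral_neg] at h
  · filter_upwards [ae_restrict_mem measurableSet_Ioi] with x hx t ht
    have hx : 0 < x := hx
    have ht : s - 1 / 2 < t := ht
    rw [norm_neg, Real.norm_of_nonneg
      (mul_nonneg hx.le (mul_nonneg (Real.exp_pos _).le (rho_pos x).le))]
    gcongr
    exact exp_mul_rho_le (by linarith) hx.le
  · refine Eventually.of_forall fun x t _ => ?_
    have h1 : HasDerivAt (fun t : ℝ => -(t * x)) (-x) t := by
      simpa using ((hasDerivAt_id' t).mul_const x).fun_neg
    refine ((h1.exp).mul_const (rho x)).congr_deriv ?_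
    ring

/-- Integrate the derivative of `x e^{-sx} ρ(x)`. Beyond `1` the delay equation produces the term
`e^{-sx} ρ(x - 1)`, whose integral is `e^{-s}` times the transform; the boundary values at `1` from
the two ranges cancel. This is the differential equation of the transform. -/
lemma rhoLaplace_delay {s : ℝ} (hs : 0 ≤ s) :
    s * ∫ x in Set.Ioi 0, x * (Real.exp (-(s * x)) * rho x)
      = (1 - Real.exp (-s)) * rhoLaplace s := by
  have hc := continuous_rho
  have hi := integrableOn_exp_mul_rho (s := s) (by linarith)
  have hi' := integrableOn_mul_exp_mul_rho (s := s) (by linarith)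
  have hsub : Set.Ioi (1 : ℝ) ⊆ Set.Ioi 0 := Set.Ioi_subset_Ioi zero_le_one
  -- the contribution of `(0,1]`
  have hd1 : ∀ x : ℝ, HasDerivAt (fun x => x * Real.exp (-(s * x)))
      (Real.exp (-(s * x)) - s * (x * Real.exp (-(s * x)))) x := by
    intro x
    have h1 : HasDerivAt (fun x : ℝ => -(s * x)) (-s) x := by
      simpa using ((hasDerivAt_id' x).const_mul s).fun_neg
    refine ((hasDerivAt_id' x).fun_mul h1.exp).congr_deriv ?_
    ring
  have h01 : ∫ x in (0 : ℝ)..1, (Real.exp (-(s * x)) * rho x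
      - s * (x * (Real.exp (-(s * x)) * rho x))) = Real.exp (-s) := by
    rw [intervalIntegral.integral_congr
      (g := fun x => Real.exp (-(s * x)) - s * (x * Real.exp (-(s * x)))),
      intervalIntegral.integral_eq_sub_of_hasDerivAt (fun x _ => hd1 x)
        (Continuous.intervalIntegrable (by fun_prop) _ _)]
    · simp
    · intro x hx
      rw [Set.uIcc_of_le zero_le_one] at hx
      simp [rho_of_le_one hx.2]
  -- the contribution of `(1,∞)`
  have hshift : ∫ x in Set.Ioi (1 : ℝ), Real.exp (-(s * x)) * rho (x - 1)
      = Real.exp (-s) * rhoLaplace s := by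
    have h := (measurePreserving_sub_right volume (1 : ℝ)).setIntegral_preimage_emb
      (measurableEmbedding_subRight (1 : ℝ))
      (fun x => Real.exp (-s) * (Real.exp (-(s * x)) * rho x)) (Set.Ioi 0)
    rw [rhoLaplace, ← integral_const_mul, ← h]
    have : (fun x : ℝ => x - 1) ⁻¹' Set.Ioi 0 = Set.Ioi 1 := by
      ext x
      simp
    rw [this]
    refine setIntegral_congr_fun measurableSet_Ioi fun x _ => ?_
    rw [← mul_assoc, ← Real.exp_add]
    ring_nf
  have hishift : IntegrableOn (fun x => Real.exp (-(s * x)) * rho (x - 1)) (Set.Ioi 1) := by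
    have h := ((measurePreserving_sub_right volume (1 : ℝ)).integrableOn_comp_preimage
      (measurableEmbedding_subRight (1 : ℝ)) (s := Set.Ioi 0)).2 (hi.const_mul (Real.exp (-s)))
    have h2 : (fun x : ℝ => x - 1) ⁻¹' Set.Ioi 0 = Set.Ioi 1 := by
      ext x
      simp
    rw [h2] at h
    refine h.congr_fun (fun x _ => ?_) measurableSet_Ioi
    simp only [Function.comp]
    rw [← mul_assoc, ← Real.exp_add]
    ring_nf
  have h1inf : ∫ x in Set.Ioi (1 : ℝ), ((Real.exp (-(s * x)) * rho x
      - s * (x * (Real.exp (-(s * x)) * rho x))) - Real.exp (-(s * x)) * rho (x - 1))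
      = 0 - 1 * Real.exp (-(s * 1)) * rho 1 := by
    refine integral_Ioi_of_hasDerivAt_of_tendsto
      (f := fun x => x * Real.exp (-(s * x)) * rho x) (by fun_prop) (fun x hx => ?_)
      (((hi.mono_set hsub).sub ((hi'.mono_set hsub).const_mul s)).sub hishift) ?_
    · have hx : 1 < x := hx
      refine ((hd1 x).fun_mul (hasDerivAt_rho hx)).congr_deriv ?_
      have : x ≠ 0 := by positivity
      field_simp
      ring
    · have h0 : Tendsto (fun x : ℝ => Real.exp 3 * (x ^ 1 * Real.exp (-x))) atTop (𝓝 0) := by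
        simpa using (Real.tendsto_pow_mul_exp_neg_atTop_nhds_zero 1).const_mul (Real.exp 3)
      refine squeeze_zero' ?_ ?_ h0
      · filter_upwards [eventually_ge_atTop 0] with x hx
        have := (rho_pos x).le
        positivity
      · filter_upwards [eventually_ge_atTop 0] with x hx
        have h1 : Real.exp (-(s * x)) ≤ 1 := Real.exp_le_one_iff.2 (by nlinarith)
        have h2 := rho_le_exp x
        rw [sub_eq_add_neg, Real.exp_add] at h2
        calc x * Real.exp (-(s * x)) * rho x ≤ x * 1 * (Real.exp 3 * Real.exp (-x)) := by
              gcongr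
              exact (rho_pos x).le
          _ = _ := by ring
  rw [integral_sub (f := fun x => Real.exp (-(s * x)) * rho x
      - s * (x * (Real.exp (-(s * x)) * rho x)))
      ((hi.mono_set hsub).sub ((hi'.mono_set hsub).const_mul s)) hishift, hshift, rho_of_le_one le_rfl] at h1inf
  have htot : ∫ x in Set.Ioi (0 : ℝ), (Real.exp (-(s * x)) * rho x
      - s * (x * (Real.exp (-(s * x)) * rho x))) = Real.exp (-s) * rhoLaplace s := by
    have h := intervalIntegral.integral_interval_add_Ioi
      (f := fun x => Real.exp (-(s * x)) * rho x - s * (x * (Real.exp (-(s * x)) * rho x)))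
      (hi.sub (hi'.const_mul s)) ((hi.sub (hi'.const_mul s)).mono_set hsub)
    rw [← h, h01]
    have : Real.exp (-(s * 1)) = Real.exp (-s) := by rw [mul_one]
    linarith
  rw [integral_sub hi (hi'.const_mul s), integral_const_mul, ← rhoLaplace] at htot
  linarith

/-- The entire exponential integral `Ein`. -/
def einInt (s : ℝ) : ℝ := ∫ v in (0 : ℝ)..s, (1 - Real.exp (-v)) / v

lemma abs_ein_integrand_le {v : ℝ} (hv : 0 ≤ v) : |(1 - Real.exp (-v)) / v| ≤ 1 := by
  rcases hv.eq_or_lt with rfl | h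
  · simp
  have h1 := Real.add_one_le_exp (-v)
  have h2 : Real.exp (-v) ≤ 1 := Real.exp_le_one_iff.2 (by linarith)
  rw [abs_of_nonneg (div_nonneg (by linarith) hv), div_le_one h]
  linarith

lemma intervalIntegrable_ein {a b : ℝ} (ha : 0 ≤ a) (hb : 0 ≤ b) :
    IntervalIntegrable (fun v => (1 - Real.exp (-v)) / v) volume a b := by
  refine (intervalIntegrable_const (c := (1 : ℝ))).mono_fun
    (Measurable.aestronglyMeasurable (by fun_prop)) ?_
  filter_upwards [ae_restrict_mem measurableSet_uIoc] with v hv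
  rw [Real.norm_eq_abs, norm_one]
  exact abs_ein_integrand_le ((le_min ha hb).trans hv.1.le)

lemma hasDerivAt_einInt {s : ℝ} (hs : 0 < s) :
    HasDerivAt einInt ((1 - Real.exp (-s)) / s) s := by
  refine intervalIntegral.integral_hasDerivAt_right (intervalIntegrable_ein le_rfl hs.le) ?_ ?_
  · exact Measurable.stronglyMeasurable (by fun_prop) |>.stronglyMeasurableAtFilter
  · exact ContinuousAt.div (by fun_prop) continuousAt_id hs.ne'

/-- By `rhoLaplace_delay` the logarithmic derivative of the transform is `-(1 - e^{-s})/s`, opposite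
to that of `exp (einInt s)`; continuity down to `0`, where `einInt` vanishes, fixes the constant. -/
lemma rhoLaplace_mul_exp_einInt {s : ℝ} (hs : 0 < s) :
    rhoLaplace s * Real.exp (einInt s) = rhoLaplace 0 := by
  set f : ℝ → ℝ := fun t => rhoLaplace t * Real.exp (einInt t) with hf
  have hcE : ContinuousOn einInt (Set.Icc 0 s) := by
    have := intervalIntegral.continuousOn_primitive_interval
      (μ := volume) (f := fun v => (1 - Real.exp (-v)) / v) (a := 0) (b := s)
      ((intervalIntegrable_iff' ).1 (intervalIntegrable_ein le_rfl hs.le))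
    rwa [Set.uIcc_of_le hs.le] at this
  have hcont : ContinuousOn f (Set.Icc 0 s) :=
    ContinuousOn.mul (fun t ht => (hasDerivAt_rhoLaplace ht.1).continuousAt.continuousWithinAt)
      hcE.rexp
  have hd : ∀ t ∈ Set.Ioo 0 s, HasDerivAt f 0 t := by
    intro t ht
    refine ((hasDerivAt_rhoLaplace ht.1.le).fun_mul (hasDerivAt_einInt ht.1).exp).congr_deriv ?_
    have h := rhoLaplace_delay ht.1.le
    have : t ≠ 0 := ht.1.ne'
    have h2 : (∫ x in Set.Ioi 0, x * (Real.exp (-(t * x)) * rho x))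
        = (1 - Real.exp (-t)) * rhoLaplace t / t := by
      rw [eq_div_iff this, mul_comm]
      exact h
    rw [h2]
    ring
  obtain ⟨c, hc, hc'⟩ := exists_hasDerivAt_eq_slope f (fun _ => 0) hs hcont hd
  rw [eq_comm, div_eq_zero_iff] at hc'
  have h0 : f 0 = rhoLaplace 0 := by simp [hf, einInt]
  rcases hc' with h | h <;> simp only [← h0] <;> linarith

/-- Only the behaviour of `ρ` near `0` matters: `ρ = 1` on `(0,1]` gives the lower bound, and `ρ ≤
1` the upper one. -/
lemma tendsto_mul_rhoLaplace :
    Tendsto (fun n : ℕ => n * rhoLaplace n) atTop (𝓝 1) := by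
  have key : ∀ s : ℝ, 0 < s → 1 - Real.exp (-s) ≤ s * rhoLaplace s ∧ s * rhoLaplace s ≤ 1 := by
    intro s hs
    have hi := integrableOn_exp_mul_rho (s := s) (by linarith)
    have hexp : IntegrableOn (fun x => Real.exp (-(s * x))) (Set.Ioi 0) := by
      simpa using exp_neg_integrableOn_Ioi 0 hs
    have hval : ∫ x in Set.Ioi (0 : ℝ), Real.exp (-(s * x)) = 1 / s := by
      have := integral_exp_mul_Ioi (a := -s) (by linarith) 0
      simpa using this
    constructor
    · have h1 : ∫ x in (0 : ℝ)..1, Real.exp (-(s * x)) ≤ rhoLaplace s := by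
        rw [intervalIntegral.integral_of_le zero_le_one, rhoLaplace]
        calc ∫ x in Set.Ioc (0 : ℝ) 1, Real.exp (-(s * x))
            = ∫ x in Set.Ioc (0 : ℝ) 1, Real.exp (-(s * x)) * rho x :=
              setIntegral_congr_fun measurableSet_Ioc fun x hx => by
                simp [rho_of_le_one hx.2]
          _ ≤ _ := setIntegral_mono_set hi
              (Eventually.of_forall fun x => (mul_pos (Real.exp_pos _) (rho_pos x)).le)
              (Set.Ioc_subset_Ioi_self.eventuallyLE)
      have h2 : ∫ x in (0 : ℝ)..1, Real.exp (-(s * x)) = (1 - Real.exp (-s)) / s := by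
        rw [intervalIntegral.integral_eq_sub_of_hasDerivAt
          (f := fun x => -(Real.exp (-(s * x)) / s)) (fun x _ => ?_)
          (Continuous.intervalIntegrable (by fun_prop) _ _)]
        · simp
          ring
        · have h1 : HasDerivAt (fun x : ℝ => -(s * x)) (-s) x := by
            simpa using ((hasDerivAt_id' x).const_mul s).fun_neg
          refine (h1.exp.div_const s).fun_neg.congr_deriv ?_
          field_simp
      rw [h2, div_le_iff₀ hs] at h1
      linarith
    · have h1 : rhoLaplace s ≤ 1 / s := by
        rw [← hval]
        refine integral_mono hi hexp fun x => ?_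
        have := rho_le_one x
        have := Real.exp_pos (-(s * x))
        simp only
        nlinarith
      rw [le_div_iff₀ hs] at h1
      linarith
  have h1 : Tendsto (fun n : ℕ => 1 - Real.exp (-(n : ℝ))) atTop (𝓝 1) := by
    have := (Real.tendsto_exp_neg_atTop_nhds_zero.comp
      (tendsto_natCast_atTop_atTop (R := ℝ))).const_sub 1
    simpa using this
  refine tendsto_of_tendsto_of_tendsto_of_le_of_le' h1 tendsto_const_nhds ?_ ?_
  · filter_upwards [eventually_gt_atTop 0] with n hn using (key n (by exact_mod_cast hn)).1
  · filter_upwards [eventually_gt_atTop 0] with n hn using (key n (by exact_mod_cast hn)).2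

/-! ### The exponential integral and Euler's constant -/

lemma one_sub_pow_div_eq_sum {n : ℕ} (hn : 0 < n) {v : ℝ} (hv : v ≠ 0) :
    (1 - (1 - v / n) ^ n) / v = ∑ k ∈ Finset.range n, (1 - v / n) ^ k / n := by
  have hn' : (n : ℝ) ≠ 0 := by positivity
  have h := geom_sum_mul (1 - v / n) n
  rw [← Finset.sum_div, div_eq_div_iff hv hn']
  have h1 : ((1 - v / n) - 1) * n = -v := by
    field_simp
    ring
  linear_combination (-(∑ k ∈ Finset.range n, (1 - v / n) ^ k)) * h1 + (n : ℝ) * h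

/-- The integrand is a finite geometric sum whose terms integrate to `1/(k + 1)`. Replacing `(1 -
v/n)^n` by `e^{-v}` gives `einInt n`, which is how Euler's constant enters. -/
lemma harmonic_eq_integral {n : ℕ} (hn : 0 < n) :
    ∫ v in (0 : ℝ)..n, (1 - (1 - v / n) ^ n) / v = harmonic n := by
  have hn' : (n : ℝ) ≠ 0 := by positivity
  have h1 : ∫ v in (0 : ℝ)..n, (1 - (1 - v / n) ^ n) / v
      = ∫ v in (0 : ℝ)..n, ∑ k ∈ Finset.range n, (1 - v / n) ^ k / n := by
    refine intervalIntegral.integral_congr_ae ?_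
    filter_upwards with v hv
    rw [Set.uIoc_of_le (by positivity)] at hv
    exact one_sub_pow_div_eq_sum hn hv.1.ne'
  rw [h1, intervalIntegral.integral_finsetSum
    (fun k _ => Continuous.intervalIntegrable (by fun_prop) _ _), harmonic]
  push_cast
  refine Finset.sum_congr rfl fun k _ => ?_
  have hk : (k : ℝ) + 1 ≠ 0 := by positivity
  rw [intervalIntegral.integral_eq_sub_of_hasDerivAt
    (f := fun v => -((1 - v / n) ^ (k + 1) / (k + 1))) (fun v _ => ?_)
    (Continuous.intervalIntegrable (by fun_prop) _ _)]
  · simp [hn']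
  · have h2 : HasDerivAt (fun v : ℝ => 1 - v / n) (-(1 / n)) v := by
      simpa using ((hasDerivAt_id' v).div_const (n : ℝ)).const_sub 1
    refine ((h2.fun_pow (k + 1)).div_const ((k : ℝ) + 1)).fun_neg.congr_deriv ?_
    push_cast
    field_simp

/-- With `w = v/n`, the inequality `(1 + w) e^{-w} ≤ 1` gives `(1 - w²) e^{-w} ≤ 1 - w`; take `n`-th
powers and apply Bernoulli to `(1 - w²)^n`. The factor `e^{-v}` in the error keeps it integrable
uniformly in `n`. -/
lemma one_sub_div_pow_bounds {n : ℕ} {v : ℝ} (hn : 0 < n) (hv : 0 ≤ v) (hvn : v ≤ n) :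
    (1 - v / n) ^ n ≤ Real.exp (-v) ∧
      Real.exp (-v) - (1 - v / n) ^ n ≤ v ^ 2 * Real.exp (-v) / n := by
  have hn' : (0 : ℝ) < n := by positivity
  have hw0 : 0 ≤ v / n := by positivity
  have hw1 : v / n ≤ 1 := (div_le_one hn').2 hvn
  refine ⟨Real.one_sub_div_pow_le_exp_neg hvn, ?_⟩
  have h1 : Real.exp (-v) = Real.exp (-(v / n)) ^ n := by
    rw [← Real.exp_nat_mul]
    congr 1
    field_simp
  have h2 : (1 - (v / n) ^ 2) * Real.exp (-(v / n)) ≤ 1 - v / n := by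
    have h3 := Real.add_one_le_exp (v / n)
    have h4 : Real.exp (v / n) * Real.exp (-(v / n)) = 1 := by
      rw [← Real.exp_add]
      simp
    have h5 := Real.exp_pos (-(v / n))
    have h6 : (v / n + 1) * Real.exp (-(v / n)) ≤ 1 := by
      exact (mul_le_mul_of_nonneg_right h3 h5.le).trans h4.le
    nlinarith
  have h3 : 0 ≤ 1 - (v / n) ^ 2 := by nlinarith
  have h4 : (1 - v ^ 2 / n) * Real.exp (-v) ≤ (1 - v / n) ^ n := by
    calc (1 - v ^ 2 / n) * Real.exp (-v)
        ≤ (1 - (v / n) ^ 2) ^ n * Real.exp (-v) := by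
          gcongr
          have := one_add_mul_le_pow (a := -(v / n) ^ 2) (by nlinarith) n
          calc 1 - v ^ 2 / n = 1 + n * (-(v / n) ^ 2) := by
                field_simp
                ring
            _ ≤ _ := this
      _ = ((1 - (v / n) ^ 2) * Real.exp (-(v / n))) ^ n := by rw [mul_pow, ← h1]
      _ ≤ _ := by
        gcongr
  have : v ^ 2 * Real.exp (-v) / n = v ^ 2 / n * Real.exp (-v) := by ring
  rw [this]
  linarith

lemma abs_einInt_sub_harmonic_le {n : ℕ} (hn : 0 < n) :
    |einInt n - harmonic n| ≤ 1 / n := by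
  have hn' : (0 : ℝ) < n := by positivity
  have hint : IntervalIntegrable (fun v : ℝ => (1 - (1 - v / n) ^ n) / v) volume 0 n := by
    refine (Continuous.intervalIntegrable (μ := volume)
      (u := fun v : ℝ => ∑ k ∈ Finset.range n, (1 - v / n) ^ k / n) (by fun_prop) 0 n).congr ?_
    intro v hv
    rw [Set.uIoc_of_le hn'.le] at hv
    exact (one_sub_pow_div_eq_sum hn hv.1.ne').symm
  rw [← harmonic_eq_integral hn, einInt,
    ← intervalIntegral.integral_sub (intervalIntegrable_ein le_rfl hn'.le) hint]
  have hexp : IntervalIntegrable (fun v : ℝ => v * Real.exp (-v) / n) volume 0 n :=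
    Continuous.intervalIntegrable (by fun_prop) _ _
  calc |∫ v in (0 : ℝ)..n, ((1 - Real.exp (-v)) / v - (1 - (1 - v / n) ^ n) / v)|
      ≤ ∫ v in (0 : ℝ)..n, v * Real.exp (-v) / n := by
        rw [← Real.norm_eq_abs]
        refine intervalIntegral.norm_integral_le_of_norm_le hn'.le ?_ hexp
        filter_upwards with v hv
        obtain ⟨h1, h2⟩ := one_sub_div_pow_bounds hn hv.1.le hv.2
        have hv0 : 0 < v := hv.1
        rw [← sub_div, Real.norm_eq_abs, abs_div, abs_of_pos hv0, div_le_iff₀ hv0,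
          abs_sub_comm, abs_of_nonneg (by linarith)]
        calc _ = Real.exp (-v) - (1 - v / n) ^ n := by ring
          _ ≤ _ := h2
          _ = _ := by ring
    _ = (1 - (n + 1) * Real.exp (-(n : ℝ))) / n := by
        rw [intervalIntegral.integral_eq_sub_of_hasDerivAt
          (f := fun v => -((v + 1) * Real.exp (-v)) / n) (fun v _ => ?_) hexp]
        · simp
          ring
        · have h1 : HasDerivAt (fun x : ℝ => -x) (-1) v := (hasDerivAt_id' v).fun_neg
          refine ((((hasDerivAt_id' v).add_const (1 : ℝ)).fun_mul h1.exp).fun_neg.div_const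
            (n : ℝ)).congr_deriv ?_
          ring
    _ ≤ 1 / n := by
        gcongr
        have := Real.exp_pos (-(n : ℝ))
        nlinarith

lemma tendsto_einInt_sub_log :
    Tendsto (fun n : ℕ => einInt n - Real.log n) atTop (𝓝 Real.eulerMascheroniConstant) := by
  have h0 : Tendsto (fun n : ℕ => einInt n - harmonic n) atTop (𝓝 0) := by
    refine squeeze_zero_norm' ?_ tendsto_one_div_atTop_nhds_zero_nat
    filter_upwards [eventually_gt_atTop 0] with n hn using abs_einInt_sub_harmonic_le hn
  have := h0.add Real.tendsto_harmonic_sub_log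
  rw [zero_add] at this
  refine this.congr fun n => ?_
  ring

/-- The total mass of `ρ` on `(0,∞)` is `e^γ`. -/
theorem integral_rho_Ioi :
    ∫ x in Set.Ioi 0, rho x = Real.exp Real.eulerMascheroniConstant := by
  have h1 : Tendsto (fun n : ℕ => (n * rhoLaplace n) * Real.exp (einInt n - Real.log n)) atTop
      (𝓝 (1 * Real.exp Real.eulerMascheroniConstant)) :=
    tendsto_mul_rhoLaplace.mul tendsto_einInt_sub_log.rexp
  have h2 : Tendsto (fun n : ℕ => (n * rhoLaplace n) * Real.exp (einInt n - Real.log n)) atTop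
      (𝓝 (rhoLaplace 0)) := by
    refine tendsto_const_nhds.congr' ?_
    filter_upwards [eventually_gt_atTop 0] with n hn
    have hn' : (0 : ℝ) < n := by positivity
    rw [← rhoLaplace_mul_exp_einInt hn', Real.exp_sub, Real.exp_log hn']
    field_simp
  have h3 := tendsto_nhds_unique h2 h1
  simpa [rhoLaplace] using h3

/-! ## The Dickman distribution -/

/-- The tail `e^{-γ} ∫_x^∞ ρ` of the Dickman distribution. -/
def dickmanTail (x : ℝ) : ℝ :=
  Real.exp (-Real.eulerMascheroniConstant) * ∫ t in Set.Ioi x, rho t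

lemma exp_neg_mul_exp_eulerMascheroni :
    Real.exp (-Real.eulerMascheroniConstant) * Real.exp Real.eulerMascheroniConstant = 1 := by
  rw [← Real.exp_add]
  simp

lemma dickmanTail_zero : dickmanTail 0 = 1 := by
  rw [dickmanTail, integral_rho_Ioi, exp_neg_mul_exp_eulerMascheroni]

lemma dickmanTail_eq {x : ℝ} (hx : 0 ≤ x) :
    dickmanTail x = 1 - Real.exp (-Real.eulerMascheroniConstant) * ∫ t in (0 : ℝ)..x, rho t := by
  have h := intervalIntegral.integral_interval_add_Ioi integrableOn_rho
    (integrableOn_rho.mono_set (Set.Ioi_subset_Ioi hx))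
  rw [integral_rho_Ioi] at h
  rw [dickmanTail, ← exp_neg_mul_exp_eulerMascheroni, ← h]
  ring

lemma dickmanTail_nonneg (x : ℝ) : 0 ≤ dickmanTail x :=
  mul_nonneg (Real.exp_pos _).le (integral_nonneg fun t => (rho_pos t).le)

lemma tendsto_dickmanTail : Tendsto dickmanTail atTop (𝓝 0) := by
  have h := (intervalIntegral_tendsto_integral_Ioi 0 integrableOn_rho tendsto_id).const_mul
    (Real.exp (-Real.eulerMascheroniConstant)) |>.const_sub 1
  rw [integral_rho_Ioi, exp_neg_mul_exp_eulerMascheroni, sub_self] at h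
  refine h.congr' ?_
  filter_upwards [eventually_ge_atTop 0] with x hx
  rw [dickmanTail_eq hx, id]

lemma dickmanLaw_Ici (x : ℝ) :
    dickmanLaw (Set.Ici x) = ENNReal.ofReal (dickmanTail (max x 0)) := by
  have hset : (Set.Ici x ∩ Set.Ioi 0 : Set ℝ) =ᵐ[volume] (Set.Ioi (max x 0) : Set ℝ) := by
    have h : (Set.Ici x ∩ Set.Ioi 0 : Set ℝ) =ᵐ[volume] (Set.Ioi x ∩ Set.Ioi 0 : Set ℝ) :=
      Ioi_ae_eq_Ici.symm.inter (ae_eq_refl _)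
    rwa [Set.Ioi_inter_Ioi] at h
  rw [dickmanLaw, withDensity_apply _ measurableSet_Ici,
    Measure.restrict_restrict measurableSet_Ici, setLIntegral_congr hset, dickmanTail,
    ← integral_const_mul, ofReal_integral_eq_lintegral_ofReal]
  · exact (integrableOn_rho.mono_set (Set.Ioi_subset_Ioi (le_max_right x 0))).const_mul _
  · exact Eventually.of_forall fun t => (mul_pos (Real.exp_pos _) (rho_pos t)).le

instance isProbabilityMeasure_dickmanLaw : IsProbabilityMeasure dickmanLaw := by
  constructor
  have h : dickmanLaw Set.univ = dickmanLaw (Set.Ici 0) := by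
    simp only [dickmanLaw, withDensity_apply _ measurableSet_Ici,
      withDensity_apply _ MeasurableSet.univ, Measure.restrict_univ,
      Measure.restrict_restrict measurableSet_Ici]
    rw [Set.inter_eq_self_of_subset_right Set.Ioi_subset_Ici_self]
  rw [h, dickmanLaw_Ici]
  simp [dickmanTail_zero]

lemma dickmanLaw_real_Ici (x : ℝ) : dickmanLaw.real (Set.Ici x) = dickmanTail (max x 0) := by
  rw [measureReal_def, dickmanLaw_Ici, ENNReal.toReal_ofReal (dickmanTail_nonneg _)]

/-! ## Comparison of the tail with the Dickman function -/

lemma hasDerivAt_dickmanTail_sub_rho {s : ℝ} (hs : 1 < s) :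
    HasDerivAt (fun s => dickmanTail (s - 1) - rho s)
      (rho (s - 1) * (1 / s - Real.exp (-Real.eulerMascheroniConstant))) s := by
  have h1 := (hasDerivAt_primitive_rho (s - 1)).comp s ((hasDerivAt_id' s).sub_const 1)
  have h2 := ((h1.const_mul (Real.exp (-Real.eulerMascheroniConstant))).const_sub 1).fun_sub
    (hasDerivAt_rho hs)
  refine (h2.congr_deriv ?_).congr_of_eventuallyEq ?_
  · ring
  · filter_upwards [Ioi_mem_nhds hs] with y hy
    have hy : 1 < y := hy
    rw [dickmanTail_eq (by linarith)]
    rfl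

/-- The difference is `0` at `1`, strictly increases up to `e^γ`, strictly decreases afterwards, and
tends to `0` at infinity. -/
lemma rho_lt_dickmanTail {s : ℝ} (hs : 1 < s) : rho s < dickmanTail (s - 1) := by
  set d : ℝ → ℝ := fun s => dickmanTail (s - 1) - rho s with hd
  set E := Real.exp Real.eulerMascheroniConstant with hE
  have hE1 : 1 < E := by
    rw [hE, Real.one_lt_exp_iff]
    linarith [Real.one_half_lt_eulerMascheroniConstant]
  have hE' : Real.exp (-Real.eulerMascheroniConstant) = 1 / E := by
    rw [Real.exp_neg, one_div]
  have hcont : ContinuousOn d (Set.Ici 1) := by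
    have hcp : Continuous fun y => ∫ t in (0 : ℝ)..y, rho t :=
      continuous_iff_continuousAt.2 fun y => (hasDerivAt_primitive_rho y).continuousAt
    have hc := continuous_rho
    have : ContinuousOn (fun s => 1 - Real.exp (-Real.eulerMascheroniConstant) *
        (∫ t in (0 : ℝ)..(s - 1), rho t) - rho s) (Set.Ici 1) := by
      fun_prop
    refine this.congr fun y hy => ?_
    have hy : 1 ≤ y := hy
    simp only [hd]
    rw [dickmanTail_eq (by linarith)]
  have h1 : d 1 = 0 := by simp [hd, dickmanTail_zero, rho_of_le_one]
  have hmono : StrictMonoOn d (Set.Icc 1 E) := by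
    refine strictMonoOn_of_deriv_pos (convex_Icc 1 E) (hcont.mono Set.Icc_subset_Ici_self) ?_
    intro x hx
    rw [interior_Icc] at hx
    rw [(hasDerivAt_dickmanTail_sub_rho hx.1).deriv, hE']
    refine mul_pos (rho_pos _) (sub_pos.2 ?_)
    exact one_div_lt_one_div_of_lt (by linarith [hx.1]) hx.2
  have hanti : StrictAntiOn d (Set.Ici E) := by
    refine strictAntiOn_of_deriv_neg (convex_Ici E)
      (hcont.mono (Set.Ici_subset_Ici.2 hE1.le)) ?_
    intro x hx
    rw [interior_Ici] at hx
    have hx : E < x := hx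
    rw [(hasDerivAt_dickmanTail_sub_rho (hE1.trans hx)).deriv, hE']
    refine mul_neg_of_pos_of_neg (rho_pos _) (sub_neg.2 ?_)
    exact one_div_lt_one_div_of_lt (by linarith) hx
  have hlim : Tendsto d atTop (𝓝 0) := by
    have ha : Tendsto (fun s : ℝ => dickmanTail (s - 1)) atTop (𝓝 0) :=
      tendsto_dickmanTail.comp (tendsto_atTop_add_const_right _ (-1) tendsto_id)
    have hb : Tendsto rho atTop (𝓝 0) := by
      refine squeeze_zero (fun x => (rho_pos x).le) rho_le_exp ?_
      exact Real.tendsto_exp_atBot.comp (tendsto_atBot_add_const_left _ 3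
        tendsto_neg_atTop_atBot)
    simpa using ha.sub hb
  suffices 0 < d s by
    simp only [hd] at this
    linarith
  rcases le_total s E with h | h
  · rw [← h1]
    exact hmono ⟨le_rfl, hE1.le⟩ ⟨hs.le, h⟩ hs
  -- The limit only gives `d (s + 1) ≥ 0`; the extra unit step makes the inequality at `s` strict.
  · have h2 : d (s + 1) < d s := hanti h (by simp; linarith) (by linarith)
    refine lt_of_le_of_lt (le_of_tendsto hlim ?_) h2
    filter_upwards [eventually_ge_atTop (s + 1)] with y hy
    exact hanti.antitoneOn (by simp; linarith) (by simp; linarith) hy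

/-! ## Mertens' estimates -/

lemma log_factorial_eq_sum (n : ℕ) :
    Real.log (n.factorial) = ∑ p ∈ n.primesLE, (n.factorial.factorization p) * Real.log p := by
  rw [Real.log_nat_eq_sum_factorization]
  refine Finsupp.sum_of_support_subset _ (fun p hp => ?_) _ (by simp)
  rw [Nat.support_factorization, Nat.mem_primeFactors] at hp
  exact Nat.mem_primesLE.2 ⟨(hp.1.dvd_factorial).1 hp.2.1, hp.1⟩

/-- `∑_{p ≤ n} log p / p`. -/
def primeLogSum (n : ℕ) : ℝ := ∑ p ∈ n.primesLE, Real.log p / p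

/-- Compare `log n!` with `n log n` from above, and from below use that the exponent of `p` in `n!`
is at least `n/p - 1`. The total loss from the `-1` is `θ(n) ≤ n log 4` by Chebyshev. -/
lemma primeLogSum_le {n : ℕ} (hn : 0 < n) : primeLogSum n ≤ Real.log n + Real.log 4 := by
  have hn' : (0 : ℝ) < n := by positivity
  have h1 : n * primeLogSum n - Chebyshev.theta n ≤ Real.log (n.factorial) := by
    rw [log_factorial_eq_sum, Chebyshev.theta_eq_sum_primesLE_log, primeLogSum, Finset.mul_sum,
      ← Finset.sum_sub_distrib]
    refine Finset.sum_le_sum fun p hp => ?_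
    have hpp := Nat.prime_of_mem_primesLE hp
    have hp0 : (0 : ℝ) < p := by exact_mod_cast hpp.pos
    have h2 : n / p ≤ n.factorial.factorization p := by
      rw [Nat.factorization_factorial hpp (b := Nat.log p n + 2) (by omega)]
      have := Finset.single_le_sum (f := fun i => n / p ^ i) (s := Finset.Ico 1 (Nat.log p n + 2))
        (fun i _ => Nat.zero_le _) (Finset.mem_Ico.2 ⟨le_rfl, by omega⟩ : 1 ∈ _)
      simpa using this
    have h3 : (n : ℝ) / p - 1 ≤ n.factorial.factorization p := by
      have h4 : (n : ℝ) / p < (n / p : ℕ) + 1 := by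
        rw [div_lt_iff₀ hp0]
        have := Nat.lt_mul_div_succ n hpp.pos
        rw [mul_comm] at this
        exact_mod_cast this
      have h5 : ((n / p : ℕ) : ℝ) ≤ n.factorial.factorization p := by exact_mod_cast h2
      linarith
    have hlog : 0 ≤ Real.log p := Real.log_natCast_nonneg p
    calc (n : ℝ) * (Real.log p / p) - Real.log p = ((n : ℝ) / p - 1) * Real.log p := by
          field_simp
      _ ≤ _ := by gcongr
  have h2 := Chebyshev.theta_le_log4_mul_x hn'.le
  have h3 : Real.log n.factorial ≤ n * Real.log n := by
    rw [← Real.log_pow]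
    refine Real.log_le_log (by positivity) ?_
    exact_mod_cast Nat.factorial_le_pow n
  by_contra! h
  nlinarith

/-- The summand is `log p / (p(p - 1))`, summable since `log p ≤ 2 p^{1/2}`. It lets `log p / (p -
1)`, which accounts for all prime powers in `n!`, be traded for `log p / p`. -/
lemma exists_sum_log_div_le : ∃ K : ℝ, 0 ≤ K ∧ ∀ n : ℕ,
    ∑ p ∈ n.primesLE, (Real.log p / (p - 1) - Real.log p / p) ≤ K := by
  have hs : Summable fun n : ℕ => 4 * (1 / (n : ℝ) ^ (3 / 2 : ℝ)) :=
    (Real.summable_one_div_nat_rpow.2 (by norm_num)).mul_left 4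
  refine ⟨∑' n : ℕ, 4 * (1 / (n : ℝ) ^ (3 / 2 : ℝ)), tsum_nonneg fun n => by positivity,
    fun n => ?_⟩
  refine le_trans (Finset.sum_le_sum fun p hp => ?_)
    (hs.sum_le_tsum _ fun n _ => by positivity)
  have hpp := Nat.prime_of_mem_primesLE hp
  have hp2 : (2 : ℝ) ≤ p := by exact_mod_cast hpp.two_le
  have hp0 : (0 : ℝ) < p := by linarith
  have h1 : Real.log p ≤ 2 * (p : ℝ) ^ (1 / 2 : ℝ) := by
    have := Real.log_le_rpow_div hp0.le (ε := 1 / 2) (by norm_num)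
    linarith
  have h2 : (p : ℝ) ^ (2 : ℝ) = (p : ℝ) ^ (3 / 2 : ℝ) * (p : ℝ) ^ (1 / 2 : ℝ) := by
    rw [← Real.rpow_add hp0]
    norm_num
  rw [Real.rpow_two] at h2
  have h3 : Real.log p / (p - 1) - Real.log p / p = Real.log p / (p * (p - 1)) := by
    have : (p : ℝ) - 1 ≠ 0 := by linarith
    field_simp
    ring
  have h4 : 0 ≤ Real.log p := Real.log_natCast_nonneg p
  calc _ = Real.log p / (p * (p - 1)) := h3
    _ ≤ Real.log p / ((p : ℝ) ^ 2 / 2) := by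
      gcongr
      nlinarith
    _ ≤ (2 * (p : ℝ) ^ (1 / 2 : ℝ)) / ((p : ℝ) ^ 2 / 2) := by gcongr
    _ = _ := by
      rw [h2]
      have : (p : ℝ) ^ (1 / 2 : ℝ) ≠ 0 := by positivity
      field_simp
      norm_num

/-- The exponent of `p` in `n!` is at most `n/(p - 1)`, while Stirling gives `log n! ≥ n log n - n`;
the `-n` becomes the `+ 1` in the constant. -/
lemma exists_log_le_primeLogSum : ∃ K : ℝ, 0 ≤ K ∧ ∀ n : ℕ, 0 < n →
    Real.log n - K ≤ primeLogSum n := by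
  obtain ⟨K, hK0, hK⟩ := exists_sum_log_div_le
  refine ⟨K + 1, by linarith, fun n hn => ?_⟩
  have hn' : (0 : ℝ) < n := by positivity
  have h1 : Real.log n.factorial ≤ n * ∑ p ∈ n.primesLE, Real.log p / (p - 1) := by
    rw [log_factorial_eq_sum, Finset.mul_sum]
    refine Finset.sum_le_sum fun p hp => ?_
    have hpp := Nat.prime_of_mem_primesLE hp
    have hp1 : (1 : ℝ) < p := by exact_mod_cast hpp.one_lt
    have h2 := Nat.factorization_factorial_le_div_pred hpp n
    have h3 : (n.factorial.factorization p : ℝ) ≤ n / (p - 1) := by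
      calc (n.factorial.factorization p : ℝ) ≤ ((n / (p - 1) : ℕ) : ℝ) := by exact_mod_cast h2
        _ ≤ (n : ℝ) / ((p - 1 : ℕ) : ℝ) := Nat.cast_div_le
        _ = _ := by rw [Nat.cast_sub hpp.one_lt.le, Nat.cast_one]
    have hlog : 0 ≤ Real.log p := Real.log_natCast_nonneg p
    calc _ ≤ (n / (p - 1) : ℝ) * Real.log p := by gcongr
      _ = _ := by ring
  have h2 := Stirling.le_log_factorial_stirling hn.ne'
  have h3 : 0 ≤ Real.log n := Real.log_natCast_nonneg n
  have h4 : 0 ≤ Real.log (2 * Real.pi) := Real.log_nonneg (by linarith [Real.pi_gt_three])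
  have h5 := hK n
  rw [Finset.sum_sub_distrib] at h5
  change _ - primeLogSum n ≤ K at h5
  by_contra! h
  nlinarith

/-- Mertens' first theorem. -/
theorem exists_abs_primeLogSum_sub_log_le : ∃ c : ℝ, 0 < c ∧ ∀ t : ℝ, 1 ≤ t →
    |primeLogSum ⌊t⌋₊ - Real.log t| ≤ c := by
  obtain ⟨K, hK0, hK⟩ := exists_log_le_primeLogSum
  refine ⟨K + Real.log 4, by positivity, fun t ht => ?_⟩
  have hf : 0 < ⌊t⌋₊ := Nat.floor_pos.2 ht
  have hf' : (0 : ℝ) < ⌊t⌋₊ := by exact_mod_cast hf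
  have hf1 : (1 : ℝ) ≤ ⌊t⌋₊ := by exact_mod_cast hf
  have h1 := primeLogSum_le hf
  have h2 := hK _ hf
  have h3 : Real.log ⌊t⌋₊ ≤ Real.log t := Real.log_le_log hf' (Nat.floor_le (by linarith))
  -- The bound `t ≤ 2⌊t⌋` would do; `4` is used so that both sides of the estimate share the
  -- constant `log 4`.
  have h4 : Real.log t ≤ Real.log 4 + Real.log ⌊t⌋₊ := by
    rw [← Real.log_mul (by norm_num) hf'.ne']
    refine Real.log_le_log (by linarith) ?_
    have := Nat.lt_floor_add_one t
    linarith
  rw [abs_le]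
  constructor <;> linarith

lemma primeLogSum_eq_sum_Icc (n : ℕ) :
    primeLogSum n = ∑ k ∈ Finset.Icc 0 n, if k.Prime then Real.log k / k else 0 := by
  rw [primeLogSum, Nat.primesLE_eq_filter_Icc_zero, Finset.sum_filter]

/-- `∑_{y < p ≤ z} 1/p`. -/
def primeInvSum (y z : ℝ) : ℝ :=
  ∑ p ∈ (Finset.Ioc ⌊y⌋₊ ⌊z⌋₊).filter Nat.Prime, (1 : ℝ) / p

/-- Mertens' second theorem, in a form uniform over intervals. -/
theorem exists_abs_primeInvSum_sub_le : ∃ c : ℝ, 0 < c ∧ ∀ y z : ℝ, 2 ≤ y → y ≤ z →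
    |primeInvSum y z - Real.log (Real.log z / Real.log y)| ≤ c / Real.log y := by
  obtain ⟨c, hc0, hc⟩ := exists_abs_primeLogSum_sub_log_le
  -- The boundary terms of the Abel summation contribute `c/log z + c/log y` and the integral `c/log
  -- y - c/log z`.
  refine ⟨2 * c, by positivity, fun y z hy hyz => ?_⟩
  have hlog : ∀ t ∈ Set.Icc y z, 0 < Real.log t := fun t ht => Real.log_pos (by linarith [ht.1])
  have hpos : ∀ t ∈ Set.Icc y z, 0 < t := fun t ht => by linarith [ht.1]
  have hyI : y ∈ Set.Icc y z := ⟨le_rfl, hyz⟩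
  have hzI : z ∈ Set.Icc y z := ⟨hyz, le_rfl⟩
  have hd : ∀ t ∈ Set.Icc y z, HasDerivAt (fun t => (Real.log t)⁻¹)
      (-t⁻¹ / Real.log t ^ 2) t := fun t ht =>
    (Real.hasDerivAt_log (hpos t ht).ne').fun_inv (hlog t ht).ne'
  have hcont : ContinuousOn (fun t => -t⁻¹ / Real.log t ^ 2) (Set.Icc y z) := by
    intro t ht
    have h1 := (hpos t ht).ne'
    have h2 := (hlog t ht).ne'
    have : ContinuousAt (fun t => -t⁻¹ / Real.log t ^ 2) t := by
      fun_prop (disch := simp [h2])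
    exact this.continuousWithinAt
  have hderiv : Set.EqOn (deriv fun t => (Real.log t)⁻¹) (fun t => -t⁻¹ / Real.log t ^ 2)
      (Set.Icc y z) := fun t ht => (hd t ht).deriv
  have hint : IntegrableOn (deriv fun t => (Real.log t)⁻¹) (Set.Icc y z) :=
    (hcont.integrableOn_Icc).congr_fun hderiv.symm measurableSet_Icc
  have habel := sum_mul_eq_sub_sub_integral_mul
    (fun k : ℕ => if k.Prime then Real.log k / k else 0) (by linarith : 0 ≤ y) hyz
    (fun t ht => (hd t ht).differentiableAt) hint
  have hmulint := integrableOn_mul_sum_Icc (m := 0)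
    (fun k : ℕ => if k.Prime then Real.log k / k else 0) (by linarith : 0 ≤ y) hint
  simp only [← primeLogSum_eq_sum_Icc] at habel hmulint
  have hS : ∑ k ∈ Finset.Ioc ⌊y⌋₊ ⌊z⌋₊, (Real.log k)⁻¹ *
      (if k.Prime then Real.log k / k else 0) = primeInvSum y z := by
    rw [primeInvSum, Finset.sum_filter]
    refine Finset.sum_congr rfl fun k _ => ?_
    split_ifs with hk
    · have : Real.log k ≠ 0 := (Real.log_pos (by exact_mod_cast hk.one_lt)).ne'
      field_simp
    · simp
  rw [hS] at habel
  -- comparison integrals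
  have hprim : ∀ e : ℝ, ∫ t in Set.Ioc y z, (-t⁻¹ / Real.log t ^ 2) * (Real.log t + e)
      = -(Real.log (Real.log z / Real.log y)) + e * ((Real.log z)⁻¹ - (Real.log y)⁻¹) := by
    intro e
    rw [← intervalIntegral.integral_of_le hyz,
      intervalIntegral.integral_eq_sub_of_hasDerivAt
        (f := fun t => -(Real.log (Real.log t)) + e * (Real.log t)⁻¹)]
    · rw [Real.log_div (hlog z hzI).ne' (hlog y hyI).ne']
      ring
    · intro t ht
      rw [Set.uIcc_of_le hyz] at ht
      have h1 := ((Real.hasDerivAt_log (hpos t ht).ne').log (hlog t ht).ne').fun_neg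
      refine (h1.fun_add ((hd t ht).const_mul e)).congr_deriv ?_
      have := (hpos t ht).ne'
      have := (hlog t ht).ne'
      field_simp
      ring
    · refine ContinuousOn.intervalIntegrable ?_
      rw [Set.uIcc_of_le hyz]
      refine hcont.mul (ContinuousOn.add (fun t ht => ?_) continuousOn_const)
      exact (Real.continuousAt_log (hpos t ht).ne').continuousWithinAt
  have hII : ∀ e : ℝ, IntegrableOn (fun t => (-t⁻¹ / Real.log t ^ 2) * (Real.log t + e))
      (Set.Ioc y z) := by
    intro e
    refine (ContinuousOn.integrableOn_Icc ?_).mono_set Set.Ioc_subset_Icc_self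
    refine hcont.mul (ContinuousOn.add (fun t ht => ?_) continuousOn_const)
    exact (Real.continuousAt_log (hpos t ht).ne').continuousWithinAt
  have hmulint' := hmulint.mono_set (Set.Ioc_subset_Icc_self (a := y) (b := z))
  -- The derivative of `1/log` is nonpositive, so upper bounds for `primeLogSum` give lower bounds
  -- for the integral and conversely.
  have hsign : ∀ t ∈ Set.Ioc y z, -t⁻¹ / Real.log t ^ 2 ≤ 0 := fun t ht => by
    have := hpos t (Set.Ioc_subset_Icc_self ht)
    exact div_nonpos_of_nonpos_of_nonneg (by simp [this.le]) (sq_nonneg _)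
  have hup : ∫ t in Set.Ioc y z, (-t⁻¹ / Real.log t ^ 2) * (Real.log t + c) ≤
      ∫ t in Set.Ioc y z, deriv (fun t => (Real.log t)⁻¹) t * primeLogSum ⌊t⌋₊ := by
    refine setIntegral_mono_on (hII c) hmulint' measurableSet_Ioc fun t ht => ?_
    rw [hderiv (Set.Ioc_subset_Icc_self ht)]
    refine mul_le_mul_of_nonpos_left ?_ (hsign t ht)
    have := abs_le.1 (hc t (by linarith [ht.1]))
    linarith
  have hlo : ∫ t in Set.Ioc y z, deriv (fun t => (Real.log t)⁻¹) t * primeLogSum ⌊t⌋₊ ≤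
      ∫ t in Set.Ioc y z, (-t⁻¹ / Real.log t ^ 2) * (Real.log t + -c) := by
    refine setIntegral_mono_on hmulint' (hII (-c)) measurableSet_Ioc fun t ht => ?_
    rw [hderiv (Set.Ioc_subset_Icc_self ht)]
    refine mul_le_mul_of_nonpos_left ?_ (hsign t ht)
    have := abs_le.1 (hc t (by linarith [ht.1]))
    linarith
  rw [hprim] at hup hlo
  have hbd : ∀ t ∈ Set.Icc y z, 1 - c * (Real.log t)⁻¹ ≤ (Real.log t)⁻¹ * primeLogSum ⌊t⌋₊ ∧
      (Real.log t)⁻¹ * primeLogSum ⌊t⌋₊ ≤ 1 + c * (Real.log t)⁻¹ := by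
    intro t ht
    have h1 := abs_le.1 (hc t (by linarith [ht.1]))
    have h2 := hlog t ht
    have h3 : (Real.log t)⁻¹ * Real.log t = 1 := inv_mul_cancel₀ h2.ne'
    have h4 : 0 < (Real.log t)⁻¹ := inv_pos.2 h2
    constructor <;> nlinarith
  have hy1 := hbd y hyI
  have hz1 := hbd z hzI
  rw [abs_le, div_eq_mul_inv]
  constructor <;> linarith

/-! ## Smooth numbers and Buchstab's identity -/

lemma one_le_pPlus (n : ℕ) : 1 ≤ pPlus n := le_max_left _ _

lemma le_pPlus {p n : ℕ} (hp : p.Prime) (hn : n ≠ 0) (h : p ∣ n) : p ≤ pPlus n :=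
  le_trans (Finset.le_sup (f := id) (Nat.mem_primeFactors.2 ⟨hp, h, hn⟩)) (le_max_right _ _)

lemma pPlus_le {n m : ℕ} (hm : 1 ≤ m) (h : ∀ p, p.Prime → p ∣ n → p ≤ m) : pPlus n ≤ m :=
  max_le hm (Finset.sup_le fun p hp =>
    h p (Nat.prime_of_mem_primeFactors hp) (Nat.dvd_of_mem_primeFactors hp))

lemma pPlus_one : pPlus 1 = 1 := by simp [pPlus]

lemma pPlus_prime_and_dvd {n : ℕ} (hn : 2 ≤ n) : (pPlus n).Prime ∧ pPlus n ∣ n := by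
  have hne : n.primeFactors.Nonempty := Nat.nonempty_primeFactors.2 (by omega)
  obtain ⟨p, hp, hpe⟩ := Finset.exists_mem_eq_sup n.primeFactors hne id
  have hpp := Nat.prime_of_mem_primeFactors hp
  have : pPlus n = p := by
    rw [pPlus, hpe, id, max_eq_right hpp.one_lt.le]
  rw [this]
  exact ⟨hpp, Nat.dvd_of_mem_primeFactors hp⟩

lemma pPlus_le_self {n : ℕ} (hn : n ≠ 0) : pPlus n ≤ n :=
  pPlus_le (by omega) fun _ _ h => Nat.le_of_dvd (by omega) h

lemma pPlus_prime_mul {p m : ℕ} (hp : p.Prime) (hm : m ≠ 0) (h : pPlus m ≤ p) :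
    pPlus (p * m) = p := by
  refine le_antisymm (pPlus_le hp.one_lt.le fun q hq hd => ?_)
    (le_pPlus hp (mul_ne_zero hp.ne_zero hm) (dvd_mul_right p m))
  rcases (hq.dvd_mul).1 hd with h1 | h1
  · exact Nat.le_of_dvd hp.pos h1
  · exact (le_pPlus hq hm h1).trans h

lemma pPlus_le_of_dvd {m n : ℕ} (hn : n ≠ 0) (h : m ∣ n) : pPlus m ≤ pPlus n :=
  pPlus_le (one_le_pPlus n) fun _ hp hd => le_pPlus hp hn (hd.trans h)

/-- The number `Ψ(x, y)` of positive integers `n ≤ x` without prime divisors larger than `y`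
(for `y ≥ 1`). -/
def smoothCount (x y : ℝ) : ℕ :=
  ((Finset.Icc 1 ⌊x⌋₊).filter fun n => (pPlus n : ℝ) ≤ y).card

lemma smoothCount_le {x : ℝ} (hx : 0 ≤ x) (y : ℝ) : (smoothCount x y : ℝ) ≤ x := by
  refine le_trans ?_ (Nat.floor_le hx)
  have := Finset.card_filter_le (Finset.Icc 1 ⌊x⌋₊) fun n => (pPlus n : ℝ) ≤ y
  rw [Nat.card_Icc, Nat.add_sub_cancel] at this
  exact_mod_cast this

lemma smoothCount_mono_left (y : ℝ) : Monotone fun x => smoothCount x y := fun _ _ hab =>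
  Finset.card_le_card (Finset.filter_subset_filter _
    (Finset.Icc_subset_Icc_right (Nat.floor_le_floor hab)))

lemma smoothCount_of_le {x y : ℝ} (hx : 0 ≤ x) (hxy : x ≤ y) : smoothCount x y = ⌊x⌋₊ := by
  rw [smoothCount, Finset.filter_true_of_mem, Nat.card_Icc, Nat.add_sub_cancel]
  intro n hn
  rw [Finset.mem_Icc] at hn
  calc (pPlus n : ℝ) ≤ n := by exact_mod_cast pPlus_le_self (by omega)
    _ ≤ ⌊x⌋₊ := by exact_mod_cast hn.2
    _ ≤ x := Nat.floor_le hx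
    _ ≤ y := hxy

/-- Dividing by `p` is a bijection onto the `p`-smooth integers up to `x/p`: the cofactor may still
be divisible by `p`, but by no larger prime. -/
lemma card_pPlus_eq {p : ℕ} (hp : p.Prime) (x : ℝ) :
    ((Finset.Icc 1 ⌊x⌋₊).filter fun n => pPlus n = p).card = smoothCount (x / p) p := by
  rw [smoothCount, Nat.floor_div_natCast]
  symm
  refine Finset.card_bij (fun m _ => p * m) ?_ (fun _ _ _ _ h => Nat.eq_of_mul_eq_mul_left hp.pos h)
    ?_
  · intro m hm
    rw [Finset.mem_filter, Finset.mem_Icc, Nat.cast_le] at hm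
    rw [Finset.mem_filter, Finset.mem_Icc]
    refine ⟨⟨Nat.mul_pos hp.pos hm.1.1, ?_⟩, pPlus_prime_mul hp (by omega) hm.2⟩
    rw [mul_comm]
    exact (Nat.le_div_iff_mul_le hp.pos).1 hm.1.2
  · intro n hn
    rw [Finset.mem_filter, Finset.mem_Icc] at hn
    have hn2 : 2 ≤ n := by
      rcases hn.1.1.eq_or_lt with h | h
      · rw [← h, pPlus_one] at hn
        exact absurd hn.2 hp.one_lt.ne
      · exact h
    obtain ⟨m, rfl⟩ : p ∣ n := hn.2 ▸ (pPlus_prime_and_dvd hn2).2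
    have hm : m ≠ 0 := by
      rintro rfl
      simp at hn2
    refine ⟨m, ?_, rfl⟩
    rw [Finset.mem_filter, Finset.mem_Icc, Nat.cast_le]
    refine ⟨⟨by omega, (Nat.le_div_iff_mul_le hp.pos).2 (by rw [mul_comm]; exact hn.1.2)⟩, ?_⟩
    have := pPlus_le_of_dvd (m := m) (n := p * m) (by omega) (dvd_mul_left m p)
    omega

/-- Buchstab's identity. -/
lemma smoothCount_buchstab {x y : ℝ} (hy : 1 ≤ y) :
    (⌊x⌋₊ : ℝ) = smoothCount x y +
      ∑ p ∈ (Finset.Ioc ⌊y⌋₊ ⌊x⌋₊).filter Nat.Prime, (smoothCount (x / p) p : ℝ) := by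
  have h1 := Finset.card_filter_add_card_filter_not (s := Finset.Icc 1 ⌊x⌋₊)
    (fun n => (pPlus n : ℝ) ≤ y)
  have h2 : ((Finset.Icc 1 ⌊x⌋₊).filter fun n => ¬ (pPlus n : ℝ) ≤ y).card
      = ∑ p ∈ (Finset.Ioc ⌊y⌋₊ ⌊x⌋₊).filter Nat.Prime, smoothCount (x / p) p := by
    rw [Finset.card_eq_sum_card_fiberwise (f := pPlus)
      (t := (Finset.Ioc ⌊y⌋₊ ⌊x⌋₊).filter Nat.Prime)]
    · refine Finset.sum_congr rfl fun p hp => ?_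
      rw [Finset.mem_filter, Finset.mem_Ioc] at hp
      rw [← card_pPlus_eq hp.2, Finset.filter_filter]
      congr 1
      refine Finset.filter_congr fun n _ => ⟨fun h => h.2, fun h => ⟨?_, h⟩⟩
      rw [h, not_le, ← Nat.floor_lt (by linarith)]
      exact hp.1.1
    · intro n hn
      simp only [Finset.coe_filter, Finset.mem_Icc, Set.mem_ofPred_eq, not_le,
        Finset.mem_Ioc] at hn ⊢
      have hn2 : 2 ≤ n := by
        rcases hn.1.1.eq_or_lt with h | h
        · rw [← h, pPlus_one] at hn
          simp at hn
          linarith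
        · exact h
      refine ⟨⟨(Nat.floor_lt (by linarith)).2 hn.2, ?_⟩, (pPlus_prime_and_dvd hn2).1⟩
      exact (pPlus_le_self (by omega)).trans hn.1.2
  rw [h2, Nat.card_Icc, Nat.add_sub_cancel] at h1
  exact_mod_cast h1.symm

/-! ## Riemann sums over primes -/

/-- The derivative of `t ↦ ρ(t - 1)` away from `t = 2`. -/
def rhoShiftDeriv (t : ℝ) : ℝ := if t ≤ 2 then 0 else -(rho (t - 2) / (t - 1))

lemma hasDerivAt_rho_sub_one {t : ℝ} (ht : t ≠ 2) :
    HasDerivAt (fun t => rho (t - 1)) (rhoShiftDeriv t) t := by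
  rcases ht.lt_or_gt with h | h
  · rw [rhoShiftDeriv, if_pos h.le]
    refine (hasDerivAt_const t (1 : ℝ)).congr_of_eventuallyEq ?_
    filter_upwards [Iio_mem_nhds h] with s hs
    have hs : s < 2 := hs
    exact rho_of_le_one (by linarith)
  · rw [rhoShiftDeriv, if_neg (not_le.2 h)]
    have := (hasDerivAt_rho (x := t - 1) (by linarith)).comp_sub_const t 1
    rwa [show t - 2 = t - 1 - 1 by ring]

lemma abs_rhoShiftDeriv_le (t : ℝ) : |rhoShiftDeriv t| ≤ 1 := by
  rw [rhoShiftDeriv]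
  split_ifs with h
  · simp
  · have h1 := rho_le_one (t - 2)
    have h2 := rho_pos (t - 2)
    have h3 : 0 < t - 1 := by linarith
    rw [abs_neg, abs_of_nonneg (by positivity), div_le_one h3]
    linarith

lemma measurable_rhoShiftDeriv : Measurable rhoShiftDeriv := by
  have := continuous_rho.measurable
  refine Measurable.ite measurableSet_Iic measurable_const ?_
  fun_prop

lemma integrableOn_rhoShiftDeriv (a b : ℝ) : IntegrableOn rhoShiftDeriv (Set.Ioc a b) := by
  refine (integrableOn_const (C := (1 : ℝ)) (by simp) (by simp)).mono'
    measurable_rhoShiftDeriv.aestronglyMeasurable ?_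
  exact Eventually.of_forall fun t => abs_rhoShiftDeriv_le t

/-- This turns a sum of values `ρ(t_p - 1)/p` into an integral of sums of `1/p` alone, to which
Mertens' theorem applies. The kink at `t = 2` is a single point and harmless. -/
lemma rho_sub_one_eq {t : ℝ} (ht : 1 ≤ t) :
    rho (t - 1) = 1 + ∫ w in Set.Ioc 1 t, rhoShiftDeriv w := by
  have hc := continuous_rho
  have h := integral_eq_of_hasDerivAt_off_countable_of_le (fun t => rho (t - 1)) rhoShiftDeriv ht
    (Set.countable_singleton (2 : ℝ)) (by fun_prop)
    (fun x hx => hasDerivAt_rho_sub_one (by simpa using hx.2))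
    ((intervalIntegrable_iff_integrableOn_Ioc_of_le ht).2 (integrableOn_rhoShiftDeriv 1 t))
  rw [intervalIntegral.integral_of_le ht] at h
  rw [h, sub_self, rho_of_le_one zero_le_one]
  ring

lemma continuousOn_log_div {u : ℝ} (hu : 1 ≤ u) :
    ContinuousOn (fun t => Real.log (u / t)) (Set.Icc 1 u) := by
  have hpos : ∀ t ∈ Set.Icc 1 u, t ≠ 0 := fun t ht => by linarith [ht.1]
  refine ContinuousOn.log (continuousOn_const.div continuousOn_id hpos) fun t ht => ?_
  have := hpos t ht
  positivity

lemma intervalIntegrable_rhoShiftDeriv_mul_log {u : ℝ} (hu : 1 ≤ u) :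
    IntervalIntegrable (fun t => rhoShiftDeriv t * Real.log (u / t)) volume 1 u := by
  refine ((intervalIntegrable_iff_integrableOn_Ioc_of_le hu).2
    (integrableOn_rhoShiftDeriv 1 u)).mul_continuousOn ?_
  rw [Set.uIcc_of_le hu]
  exact continuousOn_log_div hu

/-- Integration by parts with `-log (u/t)` as primitive of `1/t`: it vanishes at `t = u`, and `ρ(0)
= 1` leaves `log u` from the endpoint `1`. -/
lemma integral_rho_sub_one_div {u : ℝ} (hu : 1 ≤ u) :
    ∫ t in (1 : ℝ)..u, rho (t - 1) / t
      = Real.log u + ∫ t in Set.Ioc 1 u, rhoShiftDeriv t * Real.log (u / t) := by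
  have hc := continuous_rho
  have hpos : ∀ t ∈ Set.Icc 1 u, t ≠ 0 := fun t ht => by linarith [ht.1]
  have hi1 := intervalIntegrable_rhoShiftDeriv_mul_log hu
  have hi2 : IntervalIntegrable (fun t => rho (t - 1) / t) volume 1 u := by
    refine ContinuousOn.intervalIntegrable ?_
    rw [Set.uIcc_of_le hu]
    exact ContinuousOn.div (by fun_prop) continuousOn_id hpos
  have h := integral_eq_of_hasDerivAt_off_countable_of_le
    (fun t => rho (t - 1) * Real.log (u / t))
    (fun t => rhoShiftDeriv t * Real.log (u / t) - rho (t - 1) / t) hu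
    (Set.countable_singleton (2 : ℝ)) (ContinuousOn.mul (by fun_prop) (continuousOn_log_div hu))
    (fun t ht => ?_) (hi1.sub hi2)
  · rw [intervalIntegral.integral_sub hi1 hi2, div_self (by linarith), Real.log_one, sub_self,
      rho_of_le_one zero_le_one, div_one, intervalIntegral.integral_of_le hu] at h
    linarith
  · have h0 : t ≠ 0 := hpos t ⟨ht.1.1.le, ht.1.2.le⟩
    have h1 : HasDerivAt (fun t => Real.log (u / t)) (-(1 / t)) t := by
      have h2 : HasDerivAt (fun t => u / t) (-u / t ^ 2) t := by
        simpa using (hasDerivAt_const t u).fun_div (hasDerivAt_id' t) h0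
      have hu0 : u ≠ 0 := by linarith
      refine (h2.log (by positivity)).congr_deriv ?_
      field_simp
    refine ((hasDerivAt_rho_sub_one (by simpa using ht.2)).fun_mul h1).congr_deriv ?_
    ring

/-- Uniform convergence of the sums `∑_{y < p ≤ x} ρ(log x / log p - 1) / p`. -/
theorem exists_abs_sum_rho_sub_integral_le : ∃ c : ℝ, 0 < c ∧ ∀ y x : ℝ, 2 ≤ y → y ≤ x →
    |∑ p ∈ (Finset.Ioc ⌊y⌋₊ ⌊x⌋₊).filter Nat.Prime,
        (1 : ℝ) / p * rho (Real.log x / Real.log p - 1)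
      - ∫ t in (1 : ℝ)..(Real.log x / Real.log y), rho (t - 1) / t|
      ≤ c / Real.log y * (Real.log x / Real.log y) := by
  obtain ⟨c, hc0, hc⟩ := exists_abs_primeInvSum_sub_le
  refine ⟨c, hc0, fun y x hy hyx => ?_⟩
  set u := Real.log x / Real.log y with hu
  set T := (Finset.Ioc ⌊y⌋₊ ⌊x⌋₊).filter Nat.Prime with hT
  have hly : 0 < Real.log y := Real.log_pos (by linarith)
  have hlx : 0 < Real.log x := Real.log_pos (by linarith)
  have hx0 : 0 < x := by linarith
  have hu1 : 1 ≤ u := (one_le_div hly).2 (Real.log_le_log (by linarith) hyx)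
  have hmem : ∀ p ∈ T, p.Prime ∧ y < p ∧ (p : ℝ) ≤ x := fun p hp => by
    rw [hT, Finset.mem_filter, Finset.mem_Ioc] at hp
    exact ⟨hp.2, (Nat.floor_lt (by linarith)).1 hp.1.1, (Nat.le_floor_iff hx0.le).1 hp.1.2⟩
  have hlp : ∀ p ∈ T, 0 < Real.log p ∧ 1 ≤ Real.log x / Real.log p ∧
      Real.log x / Real.log p ≤ u := fun p hp => by
    obtain ⟨hpp, hyp, hpx⟩ := hmem p hp
    have h1 : Real.log y ≤ Real.log p := Real.log_le_log (by linarith) hyp.le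
    have h2 : Real.log p ≤ Real.log x := Real.log_le_log (by linarith) hpx
    have h3 : 0 < Real.log p := by linarith
    exact ⟨h3, (one_le_div h3).2 h2, div_le_div_of_nonneg_left hlx.le hly h1⟩
  -- After exchanging sum and integral, `B w` collects the primes with `log x / log p ≥ w`, that is
  -- `y < p ≤ x^{1/w}`. Mertens' theorem compares it with `log (u/w)`, uniformly in `w`.
  set B : ℝ → ℝ := fun w => ∑ p ∈ T, (1 : ℝ) / p *
    (Set.Iic (Real.log x / Real.log p)).indicator 1 w with hB
  have hBeq : ∀ w ∈ Set.Ioc 1 u, B w = primeInvSum y (x ^ (1 / w)) := by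
    intro w hw
    have hw0 : 0 < w := by linarith [hw.1]
    simp only [hB, primeInvSum, Set.indicator_apply, Set.mem_Iic, Pi.one_apply, mul_ite, mul_one,
      mul_zero]
    rw [← Finset.sum_filter]
    refine Finset.sum_congr ?_ fun _ _ => rfl
    ext p
    have hfl : ⌊x ^ (1 / w)⌋₊ ≤ ⌊x⌋₊ := by
      refine Nat.floor_le_floor ?_
      refine Real.rpow_le_self_of_one_le (by linarith) ?_
      rw [div_le_one hw0]
      exact hw.1.le
    have key : p.Prime → (w ≤ Real.log x / Real.log p ↔ p ≤ ⌊x ^ (1 / w)⌋₊) := by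
      intro hpp
      have hp0 : (0 : ℝ) < p := by exact_mod_cast hpp.pos
      have hlp : 0 < Real.log p := Real.log_pos (by exact_mod_cast hpp.one_lt)
      rw [Nat.le_floor_iff (by positivity), ← Real.log_le_log_iff hp0 (by positivity),
        Real.log_rpow hx0, le_div_iff₀ hlp, one_div_mul_eq_div, le_div_iff₀ hw0, mul_comm]
    simp only [hT, Finset.mem_filter, Finset.mem_Ioc]
    constructor
    · rintro ⟨⟨⟨h1, h2⟩, h3⟩, h4⟩
      exact ⟨⟨h1, (key h3).1 h4⟩, h3⟩
    · rintro ⟨⟨h1, h2⟩, h3⟩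
      exact ⟨⟨⟨h1, h2.trans hfl⟩, h3⟩, (key h3).2 h2⟩
  have hBerr : ∀ w ∈ Set.Ioc 1 u, |B w - Real.log (u / w)| ≤ c / Real.log y := by
    intro w hw
    have hw0 : 0 < w := by linarith [hw.1]
    have hyw : y ≤ x ^ (1 / w) := by
      rw [← Real.log_le_log_iff (by linarith) (by positivity), Real.log_rpow hx0,
        one_div_mul_eq_div, le_div_iff₀ hw0, mul_comm]
      have := hw.2
      rwa [hu, le_div_iff₀ hly] at this
    have h := hc y (x ^ (1 / w)) hy hyw
    rw [Real.log_rpow hx0] at h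
    rw [hBeq w hw]
    convert h using 4
    rw [hu]
    field_simp
  have hind : ∀ p ∈ T, ∫ w in Set.Ioc 1 (Real.log x / Real.log p), rhoShiftDeriv w =
      ∫ w in Set.Ioc 1 u, (Set.Iic (Real.log x / Real.log p)).indicator 1 w * rhoShiftDeriv w := by
    intro p hp
    have h1 : ∀ w, (Set.Iic (Real.log x / Real.log p)).indicator 1 w * rhoShiftDeriv w =
        (Set.Iic (Real.log x / Real.log p)).indicator rhoShiftDeriv w := fun w => by
      by_cases h : w ∈ Set.Iic (Real.log x / Real.log p) <;> simp [h]
    simp only [h1]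
    rw [setIntegral_indicator measurableSet_Iic, Set.Ioc_inter_Iic, min_eq_right (hlp p hp).2.2]
  have hindint : ∀ p ∈ T, IntegrableOn (fun w => (1 : ℝ) / p *
      ((Set.Iic (Real.log x / Real.log p)).indicator 1 w * rhoShiftDeriv w)) (Set.Ioc 1 u) := by
    intro p _
    refine Integrable.const_mul ?_ _
    have h1 : (fun w => (Set.Iic (Real.log x / Real.log p)).indicator 1 w * rhoShiftDeriv w) =
        (Set.Iic (Real.log x / Real.log p)).indicator rhoShiftDeriv := by
      ext w
      by_cases h : w ∈ Set.Iic (Real.log x / Real.log p) <;> simp [h]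
    rw [h1]
    exact (integrableOn_rhoShiftDeriv 1 u).indicator measurableSet_Iic
  have hBrho : ∀ w, B w * rhoShiftDeriv w = ∑ p ∈ T, (1 : ℝ) / p *
      ((Set.Iic (Real.log x / Real.log p)).indicator 1 w * rhoShiftDeriv w) := fun w => by
    simp only [hB, Finset.sum_mul, mul_assoc]
  have hSint : IntegrableOn (fun w => B w * rhoShiftDeriv w) (Set.Ioc 1 u) := by
    simp only [hBrho]
    exact integrable_finsetSum _ hindint
  have hS : ∑ p ∈ T, (1 : ℝ) / p * rho (Real.log x / Real.log p - 1)
      = primeInvSum y x + ∫ w in Set.Ioc 1 u, B w * rhoShiftDeriv w := by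
    simp only [hBrho]
    rw [integral_finsetSum _ hindint, primeInvSum, ← Finset.sum_add_distrib]
    refine Finset.sum_congr rfl fun p hp => ?_
    rw [rho_sub_one_eq (hlp p hp).2.1, hind p hp, integral_const_mul]
    ring
  have hLint : IntegrableOn (fun t => rhoShiftDeriv t * Real.log (u / t)) (Set.Ioc 1 u) :=
    (intervalIntegrable_iff_integrableOn_Ioc_of_le hu1).1
      (intervalIntegrable_rhoShiftDeriv_mul_log hu1)
  rw [hS, integral_rho_sub_one_div hu1]
  have hdiff : primeInvSum y x + (∫ w in Set.Ioc 1 u, B w * rhoShiftDeriv w) -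
      (Real.log u + ∫ t in Set.Ioc 1 u, rhoShiftDeriv t * Real.log (u / t)) =
      (primeInvSum y x - Real.log u) +
        ∫ w in Set.Ioc 1 u, (B w * rhoShiftDeriv w - rhoShiftDeriv w * Real.log (u / w)) := by
    rw [integral_sub hSint hLint]
    ring
  have h1 := hc y x hy hyx
  have h2 : ‖∫ w in Set.Ioc 1 u, (B w * rhoShiftDeriv w - rhoShiftDeriv w * Real.log (u / w))‖
      ≤ c / Real.log y * volume.real (Set.Ioc 1 u) := by
    refine norm_setIntegral_le_of_norm_le_const (by simp) fun w hw => ?_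
    have h3 : B w * rhoShiftDeriv w - rhoShiftDeriv w * Real.log (u / w) =
        (B w - Real.log (u / w)) * rhoShiftDeriv w := by ring
    rw [h3, Real.norm_eq_abs, abs_mul]
    calc _ ≤ c / Real.log y * 1 :=
          mul_le_mul (hBerr w hw) (abs_rhoShiftDeriv_le w) (abs_nonneg _) (by positivity)
      _ = _ := mul_one _
  rw [Real.volume_real_Ioc_of_le hu1, Real.norm_eq_abs] at h2
  rw [hdiff]
  calc _ ≤ _ := abs_add_le _ _
    -- One Mertens error comes from the constant `1` in `ρ(t - 1) = 1 + ∫`, the rest from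
    -- integrating over an interval of length `u - 1`.
    _ ≤ c / Real.log y + c / Real.log y * (u - 1) := add_le_add h1 h2
    _ = _ := by ring

/-! ## Dickman's theorem -/

/-- Absorbs the additive error `1` that each prime in Buchstab's identity contributes. -/
lemma eventually_primeCounting_le_mul {ε : ℝ} (hε : 0 < ε) :
    ∀ᶠ x : ℝ in atTop, (Nat.primeCounting ⌊x⌋₊ : ℝ) ≤ ε * x := by
  filter_upwards [Chebyshev.eventually_primeCounting_le one_pos, eventually_gt_atTop 1,
    Real.tendsto_log_atTop.eventually_ge_atTop ((Real.log 4 + 1) / ε)] with x h1 h2 h3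
  refine h1.trans ?_
  have hl : 0 < Real.log x := Real.log_pos h2
  rw [div_le_iff₀ hε] at h3
  rw [div_le_iff₀ hl]
  nlinarith

lemma abs_smoothCount_sub_le_one {x y : ℝ} (hx : 1 ≤ x) (hxy : x ≤ y) :
    |(smoothCount x y : ℝ) - x * rho (Real.log x / Real.log y)| ≤ 1 := by
  have hr : Real.log x / Real.log y ≤ 1 :=
    div_le_one_of_le₀ (Real.log_le_log (by linarith) hxy) (Real.log_nonneg (by linarith))
  rw [smoothCount_of_le (by linarith) hxy, rho_of_le_one hr, mul_one, abs_le]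
  have h1 := Nat.floor_le (by linarith : 0 ≤ x)
  have h2 := Nat.lt_floor_add_one x
  constructor <;> linarith

lemma rho_eq_one_sub_integral {x : ℝ} (hx : 1 ≤ x) :
    rho x = 1 - ∫ t in (1 : ℝ)..x, rho (t - 1) / t := by
  obtain ⟨n, hn⟩ := exists_nat_ge x
  rw [rho_eq (n := n + 1) (by push_cast; linarith), rhoIter, max_eq_right hx]
  congr 1
  refine intervalIntegral.integral_congr fun t ht => ?_
  rw [Set.uIcc_of_le hx] at ht
  rw [rho_eq (n := n) (by linarith [ht.2])]

/-- Dickman's theorem, uniformly for `1 ≤ x ≤ y ^ (n + 1)`. -/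
theorem exists_abs_smoothCount_sub_le (n : ℕ) : ∀ ε : ℝ, 0 < ε → ∃ Y : ℝ, 2 ≤ Y ∧
    ∀ y : ℝ, Y ≤ y → ∀ x : ℝ, 1 ≤ x → x ≤ y ^ (n + 1) →
      |(smoothCount x y : ℝ) - x * rho (Real.log x / Real.log y)| ≤ ε * x + 1 := by
  induction n with
  | zero =>
    intro ε hε
    refine ⟨2, le_rfl, fun y _ x hx hxy => ?_⟩
    refine (abs_smoothCount_sub_le_one hx (by simpa using hxy)).trans ?_
    have : 0 < ε * x := by positivity
    linarith
  | succ n ih =>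
    intro ε hε
    obtain ⟨c, hc0, hc⟩ := exists_abs_primeInvSum_sub_le
    obtain ⟨c', hc0', hc'⟩ := exists_abs_sum_rho_sub_integral_le
    -- `K` bounds `∑ 1/p` over `y < p ≤ x` for all admissible `x`, since `log x / log y ≤ n + 2`.
    set K : ℝ := Real.log (n + 2) + c / Real.log 2 with hK
    have hl2 : 0 < Real.log 2 := Real.log_pos (by norm_num)
    have hK0 : 0 < K := by
      have : 0 ≤ Real.log (n + 2) := Real.log_nonneg (by linarith [n.cast_nonneg (α := ℝ)])
      positivity
    -- Error budget: `ε/4` each from the induction hypothesis summed against `1/p`, from the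
    -- additive errors `1`, and from replacing the sum over primes by the integral. Rounding `x`
    -- down costs the final `1`.
    obtain ⟨Y, hY2, hY⟩ := ih (ε / (4 * K)) (by positivity)
    have hev : ∀ᶠ y : ℝ in atTop, Y ≤ y ∧
        (∀ x, y ≤ x → (Nat.primeCounting ⌊x⌋₊ : ℝ) ≤ ε / 4 * x) ∧
        c' / Real.log y * (n + 2) ≤ ε / 4 := by
      have h3 : Tendsto (fun y => c' / Real.log y * (n + 2 : ℝ)) atTop (𝓝 0) := by
        simpa using (Real.tendsto_log_atTop.const_div_atTop c').mul_const ((n : ℝ) + 2)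
      exact (eventually_ge_atTop Y).and
        ((eventually_forall_ge_atTop.2 (eventually_primeCounting_le_mul (by positivity))).and
          (h3.eventually_le_const (by positivity)))
    obtain ⟨Y', hY'⟩ := eventually_atTop.1 hev
    refine ⟨max 2 Y', le_max_left _ _, fun y hy x hx hxy => ?_⟩
    have hy2 : 2 ≤ y := (le_max_left _ _).trans hy
    obtain ⟨hYy, hpi, hsmall⟩ := hY' y ((le_max_right _ _).trans hy)
    have hx0 : 0 < x := by linarith
    rcases le_total x y with hle | hyx
    · refine (abs_smoothCount_sub_le_one hx hle).trans ?_
      have : 0 < ε * x := by positivity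
      linarith
    have hly : 0 < Real.log y := Real.log_pos (by linarith)
    have hlx : 0 < Real.log x := Real.log_pos (by linarith)
    set u := Real.log x / Real.log y with hu
    have hu1 : 1 ≤ u := (one_le_div hly).2 (Real.log_le_log (by linarith) hyx)
    have hun : u ≤ n + 2 := by
      rw [hu, div_le_iff₀ hly]
      have := Real.log_le_log hx0 hxy
      rw [Real.log_pow] at this
      push_cast at this
      linarith
    set T := (Finset.Ioc ⌊y⌋₊ ⌊x⌋₊).filter Nat.Prime with hT
    have hcard : (T.card : ℝ) ≤ ε / 4 * x := by
      refine le_trans ?_ (hpi x hyx)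
      rw [← Nat.primesLE_card_eq_primeCounting]
      refine Nat.cast_le.2 (Finset.card_le_card fun p hp => ?_)
      rw [hT, Finset.mem_filter, Finset.mem_Ioc] at hp
      exact Nat.mem_primesLE.2 ⟨hp.1.2, hp.2⟩
    have hbuch := smoothCount_buchstab (x := x) (y := y) (by linarith)
    have hrho := rho_eq_one_sub_integral hu1
    have hR := hc' y x hy2 hyx
    have hB : primeInvSum y x ≤ K := by
      have h1 := (abs_le.1 (hc y x hy2 hyx)).2
      have h2 : Real.log u ≤ Real.log (n + 2) := Real.log_le_log (by linarith) hun
      have h3 : c / Real.log y ≤ c / Real.log 2 :=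
        div_le_div_of_nonneg_left hc0.le hl2 (Real.log_le_log (by norm_num) hy2)
      rw [hK]
      linarith
    have hterm : ∀ p ∈ T, |(smoothCount (x / p) p : ℝ) -
        x * ((1 : ℝ) / p * rho (Real.log x / Real.log p - 1))| ≤
        ε / (4 * K) * x * ((1 : ℝ) / p) + 1 := by
      intro p hp
      rw [hT, Finset.mem_filter, Finset.mem_Ioc] at hp
      have hyp : y < p := (Nat.floor_lt (by linarith)).1 hp.1.1
      have hpx : (p : ℝ) ≤ x := (Nat.le_floor_iff hx0.le).1 hp.1.2
      have hp0 : (0 : ℝ) < p := by linarith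
      have hlp : 0 < Real.log p := Real.log_pos (by linarith)
      -- The induction hypothesis is used with `p` in place of `y`: from `p > y` and `x ≤ y^{n+2}`
      -- follows `x/p ≤ p^{n+1}`.
      have h1 := hY p (hYy.trans hyp.le) (x / p) ((one_le_div hp0).2 hpx) (by
        rw [div_le_iff₀ hp0, ← pow_succ]
        exact hxy.trans (pow_le_pow_left₀ (by linarith) hyp.le _))
      rw [Real.log_div hx0.ne' hp0.ne', sub_div, div_self hlp.ne'] at h1
      convert h1 using 2
      · ring_nf
      · ring
    have hsum : |∑ p ∈ T, (smoothCount (x / p) p : ℝ) -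
        x * ∑ p ∈ T, (1 : ℝ) / p * rho (Real.log x / Real.log p - 1)| ≤
        ε / (4 * K) * x * primeInvSum y x + T.card := by
      rw [Finset.mul_sum, ← Finset.sum_sub_distrib, primeInvSum, Finset.mul_sum]
      refine (Finset.abs_sum_le_sum_abs _ _).trans ((Finset.sum_le_sum hterm).trans ?_)
      rw [Finset.sum_add_distrib]
      simp [hT]
    have hKx : ε / (4 * K) * x * primeInvSum y x ≤ ε / 4 * x := by
      calc _ ≤ ε / (4 * K) * x * K := by gcongr
        _ = _ := by field_simp
    have hR' : |x * ∑ p ∈ T, (1 : ℝ) / p * rho (Real.log x / Real.log p - 1) -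
        x * ∫ t in (1 : ℝ)..u, rho (t - 1) / t| ≤ ε / 4 * x := by
      rw [← mul_sub, abs_mul, abs_of_pos hx0, mul_comm x]
      gcongr
      refine hR.trans (le_trans ?_ hsmall)
      gcongr
    have hf1 := Nat.floor_le hx0.le
    have hf2 := Nat.lt_floor_add_one x
    rw [hrho]
    rw [abs_le] at hsum hR' ⊢
    have hεx : 0 < ε * x := by positivity
    constructor <;> nlinarith [hsum.1, hsum.2, hR'.1, hR'.2]

/-- Dickman's theorem: `Ψ(y ^ u, y) ∼ ρ(u) y ^ u` as `y → ∞`. -/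
theorem tendsto_smoothCount {u : ℝ} (hu : 0 < u) :
    Tendsto (fun y : ℝ => (smoothCount (y ^ u) y : ℝ) / y ^ u) atTop (𝓝 (rho u)) := by
  rw [Metric.tendsto_atTop]
  intro ε hε
  obtain ⟨n, hn⟩ := exists_nat_ge u
  obtain ⟨Y, hY2, hY⟩ := exists_abs_smoothCount_sub_le n (ε / 2) (by positivity)
  have hev : ∀ᶠ y : ℝ in atTop, 2 / ε < y ^ u := (tendsto_rpow_atTop hu).eventually_gt_atTop _
  obtain ⟨Y', hY'⟩ := eventually_atTop.1 hev
  refine ⟨max Y Y', fun y hy => ?_⟩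
  have hyY : Y ≤ y := (le_max_left _ _).trans hy
  have h2 := hY' y ((le_max_right _ _).trans hy)
  have hy1 : 1 ≤ y := by linarith
  have hpos : 0 < y ^ u := Real.rpow_pos_of_pos (by linarith) u
  have h1 := hY y hyY (y ^ u) (Real.one_le_rpow hy1 hu.le) (by
    rw [← Real.rpow_natCast]
    exact Real.rpow_le_rpow_of_exponent_le hy1 (by push_cast; linarith))
  rw [Real.log_rpow (by linarith), mul_div_cancel_right₀ _
    (Real.log_pos (by linarith : 1 < y)).ne'] at h1
  rw [Real.dist_eq]
  have h3 : (smoothCount (y ^ u) y : ℝ) / y ^ u - rho u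
      = ((smoothCount (y ^ u) y : ℝ) - y ^ u * rho u) / y ^ u := by
    field_simp
  rw [h3, abs_div, abs_of_pos hpos, div_lt_iff₀ hpos]
  rw [div_lt_iff₀ hε] at h2
  linarith

lemma tendsto_smoothCount_natCast {s : ℝ} (hs : 0 < s) :
    Tendsto (fun N : ℕ => (smoothCount N ((N : ℝ) ^ (1 / s)) : ℝ) / N) atTop (𝓝 (rho s)) := by
  have h1 : Tendsto (fun N : ℕ => (N : ℝ) ^ (1 / s)) atTop atTop :=
    (tendsto_rpow_atTop (by positivity)).comp tendsto_natCast_atTop_atTop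
  refine ((tendsto_smoothCount hs).comp h1).congr fun N => ?_
  have : ((N : ℝ) ^ (1 / s)) ^ s = N := by
    rw [← Real.rpow_mul N.cast_nonneg, one_div_mul_cancel hs.ne', Real.rpow_one]
  simp only [Function.comp, this]

lemma ncard_smoothSet_le {s : ℝ} (hs : 1 ≤ s) (N : ℕ) :
    ((smoothSet s ∩ Set.Icc 1 N).ncard : ℝ) ≤ smoothCount N ((N : ℝ) ^ (1 / s)) := by
  rw [smoothCount, Nat.floor_natCast, ← Set.ncard_coe_finset]
  refine Nat.cast_le.2 (Set.ncard_le_ncard ?_ (Finset.finite_toSet _))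
  rintro n ⟨hn, hnN⟩
  simp only [Finset.coe_filter, Finset.mem_Icc, Set.mem_ofPred_eq]
  refine ⟨hnN, hn.2.trans ?_⟩
  have : (n : ℝ) ≤ N := by exact_mod_cast hnN.2
  gcongr

/-- If `n > N^{s/s'}`, then `N^{1/s'} ≤ n^{1/s}`, so the smoothness bound relative to `N` implies
the one relative to `n`. The remaining `n` number at most `N^{s/s'} = o(N)`; continuity of `ρ` then
permits `s' ↓ s`. -/
lemma smoothCount_le_ncard_smoothSet_add {s s' : ℝ} (hs : 1 ≤ s) (hs' : s < s') (N : ℕ) :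
    (smoothCount N ((N : ℝ) ^ (1 / s')) : ℝ) ≤
      (smoothSet s ∩ Set.Icc 1 N).ncard + (N : ℝ) ^ (s / s') := by
  have hs0 : 0 < s := by linarith
  have hs0' : 0 < s' := by linarith
  have hfin : (smoothSet s ∩ Set.Icc 1 N).Finite := (Set.finite_Icc 1 N).inter_of_right _
  have h1 : smoothCount N ((N : ℝ) ^ (1 / s')) ≤
      ((smoothSet s ∩ Set.Icc 1 N) ∪ (Finset.Icc 1 ⌊(N : ℝ) ^ (s / s')⌋₊ : Set ℕ)).ncard := by
    rw [smoothCount, Nat.floor_natCast, ← Set.ncard_coe_finset]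
    refine Set.ncard_le_ncard ?_ (hfin.union (Finset.finite_toSet _))
    intro n hn
    simp only [Finset.coe_filter, Finset.mem_Icc, Set.mem_ofPred_eq] at hn
    by_cases h : (n : ℝ) ≤ (N : ℝ) ^ (s / s')
    · right
      rw [Finset.coe_Icc]
      exact ⟨hn.1.1, Nat.le_floor h⟩
    · left
      refine ⟨⟨hn.1.1, hn.2.trans ?_⟩, hn.1⟩
      have h2 : (N : ℝ) ^ (1 / s') = ((N : ℝ) ^ (s / s')) ^ (1 / s) := by
        rw [← Real.rpow_mul N.cast_nonneg]
        congr 1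
        field_simp
      rw [h2]
      exact Real.rpow_le_rpow (by positivity) (not_le.1 h).le (by positivity)
  have h2 := h1.trans (Set.ncard_union_le _ _)
  rw [Set.ncard_coe_finset, Nat.card_Icc, Nat.add_sub_cancel] at h2
  have h3 : (⌊(N : ℝ) ^ (s / s')⌋₊ : ℝ) ≤ (N : ℝ) ^ (s / s') := Nat.floor_le (by positivity)
  have h4 : (smoothCount N ((N : ℝ) ^ (1 / s')) : ℝ) ≤
      (smoothSet s ∩ Set.Icc 1 N).ncard + (⌊(N : ℝ) ^ (s / s')⌋₊ : ℝ) := by exact_mod_cast h2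
  linarith

/-- The natural density of `{n : p⁺(n) ≤ n^{1/s}}` is `ρ(s)`. -/
theorem hasNatDensity_smoothSet {s : ℝ} (hs : 1 ≤ s) : HasNatDensity (smoothSet s) (rho s) := by
  rw [HasNatDensity, Metric.tendsto_atTop]
  intro ε hε
  have hc : ∀ᶠ s' in 𝓝[>] s, rho s - ε / 3 < rho s' := by
    have := (continuous_rho.tendsto s).eventually_const_lt (by linarith : rho s - ε / 3 < rho s)
    exact this.filter_mono nhdsWithin_le_nhds
  obtain ⟨s', hs'1, hs'2⟩ := (hc.and self_mem_nhdsWithin).exists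
  have hs'2 : s < s' := hs'2
  have hs0 : 0 < s := by linarith
  have hs0' : 0 < s' := by linarith
  have h1 := (tendsto_smoothCount_natCast hs0).eventually_lt_const
    (by linarith : rho s < rho s + ε)
  have h2 := (tendsto_smoothCount_natCast hs0').eventually_const_lt
    (by linarith : rho s' - ε / 3 < rho s')
  have h3 : ∀ᶠ N : ℕ in atTop, (N : ℝ) ^ (s / s' - 1) < ε / 3 := by
    have h := (tendsto_rpow_neg_atTop (y := 1 - s / s')
      (sub_pos.2 ((div_lt_one hs0').2 hs'2))).comp (tendsto_natCast_atTop_atTop (R := ℝ))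
    rw [show -(1 - s / s') = s / s' - 1 by ring] at h
    exact h.eventually_lt_const (by positivity)
  obtain ⟨M, hM⟩ := eventually_atTop.1 (h1.and (h2.and (h3.and (eventually_gt_atTop 0))))
  refine ⟨M, fun N hN => ?_⟩
  obtain ⟨h1, h2, h3, h4⟩ := hM N hN
  have hN0 : (0 : ℝ) < N := by exact_mod_cast h4
  have h5 := ncard_smoothSet_le hs N
  have h6 := smoothCount_le_ncard_smoothSet_add hs hs'2 N
  rw [Real.rpow_sub hN0, Real.rpow_one, div_lt_iff₀ hN0] at h3
  rw [div_lt_iff₀ hN0] at h1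
  rw [lt_div_iff₀ hN0] at h2
  rw [Real.dist_eq, abs_lt, lt_sub_iff_add_lt, sub_lt_iff_lt_add, lt_div_iff₀ hN0,
    div_lt_iff₀ hN0]
  constructor <;> nlinarith

/-! ## Logarithmic sums over the sets `Ω_N` -/

/-- The primes `2 = q_0 < q_1 < ⋯`. -/
def q (j : ℕ) : ℕ := Nat.nth Nat.Prime j

lemma q_prime (j : ℕ) : (q j).Prime := Nat.prime_nth_prime j

lemma q_strictMono : StrictMono q := Nat.nth_strictMono Nat.infinite_setOfPred_prime

lemma tendsto_q : Tendsto q atTop atTop := q_strictMono.tendsto_atTop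

lemma tendsto_q_cast : Tendsto (fun j => (q j : ℝ)) atTop atTop :=
  tendsto_natCast_atTop_atTop.comp tendsto_q

lemma log_q_pos (j : ℕ) : 0 < Real.log (q j) :=
  Real.log_pos (by exact_mod_cast (q_prime j).one_lt)

lemma tendsto_log_q : Tendsto (fun j => Real.log (q j)) atTop atTop :=
  Real.tendsto_log_atTop.comp tendsto_q_cast

lemma exists_q_eq {p : ℕ} (hp : p.Prime) : ∃ j, q j = p :=
  ⟨Nat.count Nat.Prime p, Nat.nth_count hp⟩

lemma mem_Omega {N n : ℕ} : n ∈ Omega N ↔ 0 < n ∧ ∀ j, N ≤ j → ¬ q j ∣ n := Iff.rfl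

/-- The enumeration `q` starts at index `0`, so the largest prime allowed in `Omega (N + 1)` is `q
N`. This shift recurs throughout. -/
lemma mem_Omega_succ_iff {N n : ℕ} : n ∈ Omega (N + 1) ↔ 0 < n ∧ pPlus n ≤ q N := by
  rw [mem_Omega]
  refine and_congr_right fun hn => ⟨fun h => pPlus_le (q_prime N).one_lt.le fun p hp hd => ?_,
    fun h j hj hd => ?_⟩
  · obtain ⟨j, rfl⟩ := exists_q_eq hp
    by_contra! hlt
    exact h j (q_strictMono.lt_iff_lt.1 hlt) hd
  · have := (le_pPlus (q_prime j) hn.ne' hd).trans h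
    have h2 := q_strictMono.le_iff_le.1 this
    omega

lemma mul_mem_Omega_iff {N a b : ℕ} : a * b ∈ Omega N ↔ a ∈ Omega N ∧ b ∈ Omega N := by
  simp only [mem_Omega, (q_prime _).dvd_mul, not_or]
  constructor
  · rintro ⟨h0, h⟩
    exact ⟨⟨Nat.pos_of_mul_pos_right h0, fun j hj => (h j hj).1⟩,
      ⟨Nat.pos_of_mul_pos_left h0, fun j hj => (h j hj).2⟩⟩
  · rintro ⟨⟨ha, ha'⟩, hb, hb'⟩
    exact ⟨Nat.mul_pos ha hb, fun j hj => ⟨ha' j hj, hb' j hj⟩⟩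

lemma pow_mem_Omega_iff {N b k : ℕ} (hk : k ≠ 0) : b ^ k ∈ Omega N ↔ b ∈ Omega N := by
  simp only [mem_Omega, Nat.pow_pos_iff, hk, or_false]
  refine and_congr_right fun _ => forall_congr' fun j =>
    ⟨fun h hj hd => h hj (dvd_pow hd hk),
      fun h hj hd => h hj ((q_prime j).dvd_of_dvd_pow hd)⟩

lemma Omega_zero : Omega 0 = {1} := by
  ext n
  rw [mem_Omega, Set.mem_singleton_iff]
  constructor
  · rintro ⟨-, h⟩
    by_contra hn
    obtain ⟨p, hp, hd⟩ := Nat.exists_prime_and_dvd hn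
    obtain ⟨j, rfl⟩ := exists_q_eq hp
    exact h j (Nat.zero_le j) hd
  · rintro rfl
    exact one_mem_Omega 0

lemma Omega_mono {N M : ℕ} (h : N ≤ M) : Omega N ⊆ Omega M := fun _ hn =>
  ⟨hn.1, fun j hj => hn.2 j (h.trans hj)⟩

lemma q_mem_Omega (N : ℕ) : q N ∈ Omega (N + 1) :=
  mem_Omega_succ_iff.2 ⟨(q_prime N).pos, pPlus_le (q_prime N).one_lt.le fun _ _ hd =>
    Nat.le_of_dvd (q_prime N).pos hd⟩

lemma mem_Omega_succ_and_dvd_iff {N n : ℕ} :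
    n ∈ Omega (N + 1) ∧ ¬ q N ∣ n ↔ n ∈ Omega N := by
  simp only [mem_Omega]
  constructor
  · rintro ⟨⟨h0, h⟩, h'⟩
    refine ⟨h0, fun j hj => ?_⟩
    rcases hj.eq_or_lt with rfl | hj
    · exact h'
    · exact h j hj
  · rintro ⟨h0, h⟩
    exact ⟨⟨h0, fun j hj => h j (by omega)⟩, h N le_rfl⟩

/-- The sum `∑_{n ∈ Ω_N} f(n) / n`. -/
def logSum (N : ℕ) (f : ℕ → ℝ≥0∞) : ℝ≥0∞ :=
  ∑' n, (Omega N).indicator (fun n => (n : ℝ≥0∞)⁻¹ * f n) n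

/-- The sum `∑_{n ∈ A ∩ Ω_N} 1 / n`. -/
def logMass (N : ℕ) (A : Set ℕ) : ℝ≥0∞ := logSum N (A.indicator 1)

lemma logSum_mono {N : ℕ} {f g : ℕ → ℝ≥0∞} (h : ∀ n ∈ Omega N, f n ≤ g n) :
    logSum N f ≤ logSum N g := by
  refine ENNReal.tsum_le_tsum fun n => ?_
  by_cases hn : n ∈ Omega N
  · simp only [Set.indicator_of_mem hn]
    gcongr
    exact h n hn
  · simp [hn]

lemma logSum_add (N : ℕ) (f g : ℕ → ℝ≥0∞) :
    logSum N (fun n => f n + g n) = logSum N f + logSum N g := by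
  rw [logSum, logSum, logSum, ← ENNReal.tsum_add]
  refine tsum_congr fun n => ?_
  by_cases hn : n ∈ Omega N
  · simp [hn, mul_add]
  · simp [hn]

lemma logSum_const_mul (N : ℕ) (c : ℝ≥0∞) (f : ℕ → ℝ≥0∞) :
    logSum N (fun n => c * f n) = c * logSum N f := by
  rw [logSum, logSum, ← ENNReal.tsum_mul_left]
  refine tsum_congr fun n => ?_
  by_cases hn : n ∈ Omega N
  · simp only [Set.indicator_of_mem hn]
    ring
  · simp [hn]

lemma logMass_mono {N : ℕ} {A B : Set ℕ} (h : ∀ n ∈ Omega N, n ∈ A → n ∈ B) :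
    logMass N A ≤ logMass N B :=
  logSum_mono fun n hn => by
    by_cases hA : n ∈ A
    · simp [hA, h n hn hA]
    · simp [hA]

lemma logMass_congr {N : ℕ} {A B : Set ℕ} (h : ∀ n ∈ Omega N, n ∈ A ↔ n ∈ B) :
    logMass N A = logMass N B :=
  le_antisymm (logMass_mono fun n hn => (h n hn).1) (logMass_mono fun n hn => (h n hn).2)

lemma logMass_union_le (N : ℕ) (A B : Set ℕ) :
    logMass N (A ∪ B) ≤ logMass N A + logMass N B := by
  rw [logMass, logMass, logMass, ← logSum_add]
  refine logSum_mono fun n _ => ?_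
  by_cases hA : n ∈ A <;> by_cases hB : n ∈ B <;> simp [hA, hB]

lemma logMass_add_compl (N : ℕ) (A : Set ℕ) :
    logMass N A + logMass N Aᶜ = logMass N Set.univ := by
  rw [logMass, logMass, logMass, ← logSum_add]
  congr 1
  ext n
  by_cases hA : n ∈ A <;> simp [hA]

lemma logMass_univ (N : ℕ) : logMass N Set.univ = C N := by
  rw [logMass, logSum, C, ← tsum_subtype (Omega N)]
  simp

lemma P_apply (N : ℕ) (A : Set ℕ) : P N A = (C N)⁻¹ * logMass N A := by
  rw [P, Measure.sum_apply _ MeasurableSet.of_discrete, logMass, logSum,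
    ← tsum_subtype (Omega N) (fun n => (n : ℝ≥0∞)⁻¹ * A.indicator 1 n), ← ENNReal.tsum_mul_left]
  refine tsum_congr fun n => ?_
  simp only [Measure.smul_apply, smul_eq_mul, Measure.dirac_apply' _ MeasurableSet.of_discrete]
  rw [mul_assoc]

/-- Splitting off the multiples of the largest prime. -/
lemma logSum_succ (N : ℕ) (f : ℕ → ℝ≥0∞) :
    logSum (N + 1) f = logSum N f + (q N : ℝ≥0∞)⁻¹ * logSum (N + 1) fun m => f (q N * m) := by
  have hq0 : (q N : ℝ≥0∞) ≠ 0 := by exact_mod_cast (q_prime N).ne_zero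
  have hinj : Function.Injective fun m => q N * m := fun a b h =>
    Nat.eq_of_mul_eq_mul_left (q_prime N).pos h
  set F : ℕ → ℝ≥0∞ := (Omega (N + 1) ∩ {n | q N ∣ n}).indicator fun n => (n : ℝ≥0∞)⁻¹ * f n
    with hF
  have h1 : logSum (N + 1) f = logSum N f + ∑' n, F n := by
    rw [logSum, logSum, ← ENNReal.tsum_add]
    refine tsum_congr fun n => ?_
    have hiff := mem_Omega_succ_and_dvd_iff (N := N) (n := n)
    by_cases hn : n ∈ Omega (N + 1) <;> by_cases hd : q N ∣ n <;>
      simp only [hn, hd, true_and, false_and, not_true, not_false_iff, false_iff, true_iff] at hiff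
      <;> simp [hF, hn, hd, hiff]
  have h2 : ∑' n, F n = ∑' m, F (q N * m) := by
    refine (hinj.tsum_eq fun n hn => ?_).symm
    have : n ∈ Omega (N + 1) ∩ {n | q N ∣ n} := by
      by_contra h
      exact hn (Set.indicator_of_notMem h _)
    obtain ⟨m, hm⟩ := this.2
    exact ⟨m, hm.symm⟩
  rw [h1, h2]
  congr 1
  rw [logSum, ← ENNReal.tsum_mul_left]
  refine tsum_congr fun m => ?_
  have hmem : q N * m ∈ Omega (N + 1) ∩ {n | q N ∣ n} ↔ m ∈ Omega (N + 1) := by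
    rw [Set.mem_inter_iff, mul_mem_Omega_iff]
    simp [q_mem_Omega]
  by_cases hm : m ∈ Omega (N + 1)
  · rw [hF, Set.indicator_of_mem (hmem.2 hm), Set.indicator_of_mem hm]
    push_cast
    rw [ENNReal.mul_inv (Or.inl hq0) (Or.inl (ENNReal.natCast_ne_top _)), mul_assoc]
  · rw [hF, Set.indicator_of_notMem (fun h => hm (hmem.1 h)), Set.indicator_of_notMem hm, mul_zero]

lemma logMass_succ (N : ℕ) (A : Set ℕ) :
    logMass (N + 1) A = logMass N A + (q N : ℝ≥0∞)⁻¹ * logMass (N + 1) {m | q N * m ∈ A} := by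
  rw [logMass, logSum_succ]
  rfl

lemma logMass_ne_top (N : ℕ) (A : Set ℕ) : logMass N A ≠ ∞ := by
  refine ne_top_of_le_ne_top (C_ne_top N) ?_
  rw [← logMass_univ]
  exact logMass_mono fun _ _ _ => Set.mem_univ _

/-- `C_N` as a real number. -/
def cReal (N : ℕ) : ℝ := (C N).toReal

/-- `∑_{n ∈ A ∩ Ω_N} 1 / n` as a real number. -/
def mass (N : ℕ) (A : Set ℕ) : ℝ := (logMass N A).toReal

lemma cReal_pos (N : ℕ) : 0 < cReal N := ENNReal.toReal_pos (C_ne_zero N) (C_ne_top N)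

lemma mass_univ (N : ℕ) : mass N Set.univ = cReal N := by rw [mass, logMass_univ, cReal]

lemma mass_mono {N : ℕ} {A B : Set ℕ} (h : ∀ n ∈ Omega N, n ∈ A → n ∈ B) :
    mass N A ≤ mass N B :=
  ENNReal.toReal_mono (logMass_ne_top _ _) (logMass_mono h)

lemma mass_congr {N : ℕ} {A B : Set ℕ} (h : ∀ n ∈ Omega N, n ∈ A ↔ n ∈ B) :
    mass N A = mass N B := by rw [mass, mass, logMass_congr h]

lemma mass_union_le (N : ℕ) (A B : Set ℕ) : mass N (A ∪ B) ≤ mass N A + mass N B := by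
  rw [mass, mass, mass, ← ENNReal.toReal_add (logMass_ne_top _ _) (logMass_ne_top _ _)]
  exact ENNReal.toReal_mono (ENNReal.add_ne_top.2 ⟨logMass_ne_top _ _, logMass_ne_top _ _⟩)
    (logMass_union_le N A B)

lemma mass_add_compl (N : ℕ) (A : Set ℕ) : mass N A + mass N Aᶜ = cReal N := by
  rw [mass, mass, ← ENNReal.toReal_add (logMass_ne_top _ _) (logMass_ne_top _ _),
    logMass_add_compl, logMass_univ, cReal]

lemma P_real (N : ℕ) (A : Set ℕ) : (P N).real A = mass N A / cReal N := by
  rw [measureReal_def, P_apply, ENNReal.toReal_mul, ENNReal.toReal_inv, mass, cReal,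
    div_eq_inv_mul]

lemma mass_succ (N : ℕ) (A : Set ℕ) :
    mass (N + 1) A = mass N A + mass (N + 1) {m | q N * m ∈ A} / q N := by
  rw [mass, logMass_succ, ENNReal.toReal_add (logMass_ne_top _ _)
    (ENNReal.mul_ne_top (by simp [(q_prime N).ne_zero]) (logMass_ne_top _ _)),
    ENNReal.toReal_mul, ENNReal.toReal_inv, ENNReal.toReal_natCast, mass, mass, div_eq_inv_mul]

/-- One Euler factor: `C_N = C_{N+1} (1 - 1/q_N)`, written as the mass of the integers whose largest
prime divisor is `q N`. -/
lemma cReal_succ (N : ℕ) : cReal (N + 1) - cReal N = cReal (N + 1) / q N := by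
  have := mass_succ N Set.univ
  rw [mass_univ, mass_univ] at this
  have h : mass (N + 1) {m | q N * m ∈ (Set.univ : Set ℕ)} = cReal (N + 1) := by
    rw [← mass_univ]
    rfl
  rw [h] at this
  linarith

lemma mass_zero (A : Set ℕ) : mass 0 A = A.indicator 1 1 := by
  rw [mass, logMass, logSum, Omega_zero, tsum_eq_single 1]
  · by_cases h : 1 ∈ A <;> simp [h]
  · intro n hn
    simp [hn]

/-- Decomposition of a logarithmic sum according to the largest prime divisor. -/
lemma mass_eq_sum (N : ℕ) (A : Set ℕ) :
    mass N A = A.indicator 1 1 +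
      ∑ j ∈ Finset.range N, (cReal (j + 1) - cReal j) *
        (mass (j + 1) {m | q j * m ∈ A} / cReal (j + 1)) := by
  induction N with
  | zero => simp [mass_zero]
  | succ N ih =>
    rw [Finset.sum_range_succ, ← add_assoc, ← ih, mass_succ, cReal_succ]
    have := (cReal_pos (N + 1)).ne'
    have h2 : (q N : ℝ) ≠ 0 := by exact_mod_cast (q_prime N).ne_zero
    field_simp

/-! ## Logarithmic sums over smooth numbers -/

/-- The sum of `1 / n` over the positive integers `n ≤ x` without prime divisors larger
than `y`. -/
def smoothInvSum (x y : ℝ) : ℝ :=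
  ∑ n ∈ (Finset.Icc 1 ⌊x⌋₊).filter (fun n => (pPlus n : ℝ) ≤ y), (1 : ℝ) / n

lemma mass_le_eq_smoothInvSum (N : ℕ) {x : ℝ} (hx : 0 ≤ x) :
    mass (N + 1) {m | (m : ℝ) ≤ x} = smoothInvSum x (q N) := by
  have hmem : ∀ n, n ∈ (Finset.Icc 1 ⌊x⌋₊).filter (fun n => (pPlus n : ℝ) ≤ q N) ↔
      n ∈ Omega (N + 1) ∧ (n : ℝ) ≤ x := fun n => by
    rw [Finset.mem_filter, Finset.mem_Icc, mem_Omega_succ_iff, Nat.le_floor_iff hx, Nat.cast_le]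
    constructor
    · rintro ⟨⟨h1, h2⟩, h3⟩
      exact ⟨⟨h1, h3⟩, h2⟩
    · rintro ⟨⟨h1, h3⟩, h2⟩
      exact ⟨⟨h1, h2⟩, h3⟩
  rw [mass, logMass, logSum, tsum_eq_sum
    (s := (Finset.Icc 1 ⌊x⌋₊).filter (fun n => (pPlus n : ℝ) ≤ q N)), ENNReal.toReal_sum,
    smoothInvSum]
  · refine Finset.sum_congr rfl fun n hn => ?_
    obtain ⟨h1, h2⟩ := (hmem n).1 hn
    simp [h1, h2]
  · intro n hn
    obtain ⟨h1, h2⟩ := (hmem n).1 hn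
    have : n ≠ 0 := h1.1.ne'
    simp [h1, h2, this]
  · intro n hn
    rw [hmem, not_and] at hn
    by_cases h1 : n ∈ Omega (N + 1)
    · simp [h1, hn h1]
    · simp [h1]

/-- Partial summation for a single term, in the exponent variable `u`. Summed over smooth `m`, the
indicators count those with `m ≤ y^u`, so that `Ψ(y^u, y)/y^u` appears under the integral. -/
lemma one_div_eq_add_integral {y x : ℝ} (hy : 1 < y) {m : ℕ} (hm : 1 ≤ m)
    (hmx : (m : ℝ) ≤ y ^ x) :
    (1 : ℝ) / m = y ^ (-x) + Real.log y *
      ∫ u in Set.Ioc 0 x, (Set.Ici (Real.log m / Real.log y)).indicator (fun u => y ^ (-u)) u := by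
  have hy0 : 0 < y := by linarith
  have hly : 0 < Real.log y := Real.log_pos hy
  have hm0 : (0 : ℝ) < m := by exact_mod_cast hm
  set a := Real.log m / Real.log y with ha
  have ha0 : 0 ≤ a := div_nonneg (Real.log_natCast_nonneg m) hly.le
  have hax : a ≤ x := by
    rw [ha, div_le_iff₀ hly, ← Real.log_rpow hy0]
    exact Real.log_le_log hm0 hmx
  have hya : y ^ (-a) = 1 / m := by
    rw [Real.rpow_def_of_pos hy0, ha, show Real.log y * -(Real.log m / Real.log y) = -Real.log m by
      field_simp, Real.exp_neg, Real.exp_log hm0, one_div]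
  have hset : (Set.Ioc 0 x ∩ Set.Ici a : Set ℝ) =ᵐ[volume] Set.Ioc a x := by
    have h : (Set.Ioc 0 x ∩ Set.Ici a : Set ℝ) =ᵐ[volume] (Set.Ioc 0 x ∩ Set.Ioi a : Set ℝ) :=
      (ae_eq_refl _).inter Ioi_ae_eq_Ici.symm
    rwa [Set.Ioc_inter_Ioi, max_eq_right ha0] at h
  rw [setIntegral_indicator measurableSet_Ici, setIntegral_congr_set hset,
    ← intervalIntegral.integral_of_le hax,
    intervalIntegral.integral_eq_sub_of_hasDerivAt (f := fun u => -(y ^ (-u) / Real.log y))]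
  · rw [← hya]
    field_simp
    ring
  · intro u _
    have h1 := ((hasDerivAt_id' u).fun_neg.const_rpow hy0).div_const (Real.log y)
    refine h1.fun_neg.congr_deriv ?_
    field_simp
  · refine Continuous.intervalIntegrable ?_ _ _
    exact Continuous.rpow continuous_const continuous_neg fun _ => Or.inl hy0.ne'

lemma smoothInvSum_eq {y : ℝ} (hy : 1 < y) (x : ℝ) :
    smoothInvSum (y ^ x) y = smoothCount (y ^ x) y / y ^ x +
      Real.log y * ∫ u in Set.Ioc 0 x, (smoothCount (y ^ u) y : ℝ) / y ^ u := by
  have hy0 : 0 < y := by linarith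
  have hly : 0 < Real.log y := Real.log_pos hy
  set T := (Finset.Icc 1 ⌊y ^ x⌋₊).filter (fun n => (pPlus n : ℝ) ≤ y) with hT
  have hmem : ∀ n ∈ T, 1 ≤ n ∧ (n : ℝ) ≤ y ^ x := fun n hn => by
    rw [hT, Finset.mem_filter, Finset.mem_Icc, Nat.le_floor_iff (by positivity)] at hn
    exact hn.1
  have hcont : Continuous fun u : ℝ => y ^ (-u) :=
    Continuous.rpow continuous_const continuous_neg fun _ => Or.inl hy0.ne'
  have hint : ∀ n ∈ T, IntegrableOn
      ((Set.Ici (Real.log n / Real.log y)).indicator fun u => y ^ (-u)) (Set.Ioc 0 x) :=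
    fun n _ => (hcont.integrableOn_Ioc).indicator measurableSet_Ici
  have hcount : ∫ u in Set.Ioc 0 x, (smoothCount (y ^ u) y : ℝ) / y ^ u =
      ∫ u in Set.Ioc 0 x, ∑ n ∈ T,
        (Set.Ici (Real.log n / Real.log y)).indicator (fun u => y ^ (-u)) u := by
    refine setIntegral_congr_fun measurableSet_Ioc fun u hu => ?_
    have hfl : ⌊y ^ u⌋₊ ≤ ⌊y ^ x⌋₊ :=
      Nat.floor_le_floor (Real.rpow_le_rpow_of_exponent_le hy.le hu.2)
    have hfilter : (Finset.Icc 1 ⌊y ^ u⌋₊).filter (fun n => (pPlus n : ℝ) ≤ y) =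
        T.filter fun n : ℕ => u ∈ Set.Ici (Real.log n / Real.log y) := by
      ext n
      simp only [hT, Finset.mem_filter, Finset.mem_Icc, Set.mem_Ici]
      have key : 1 ≤ n → (n ≤ ⌊y ^ u⌋₊ ↔ Real.log n / Real.log y ≤ u) := fun hn => by
        have hn0 : (0 : ℝ) < n := by exact_mod_cast hn
        rw [Nat.le_floor_iff (by positivity), div_le_iff₀ hly, ← Real.log_rpow hy0,
          Real.log_le_log_iff hn0 (by positivity)]
      constructor
      · rintro ⟨⟨h1, h2⟩, h3⟩
        exact ⟨⟨⟨h1, h2.trans hfl⟩, h3⟩, (key h1).1 h2⟩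
      · rintro ⟨⟨⟨h1, h2⟩, h3⟩, h4⟩
        exact ⟨⟨h1, (key h1).2 h4⟩, h3⟩
    simp only [Set.indicator_apply]
    rw [← Finset.sum_filter, Finset.sum_const, smoothCount, hfilter, Real.rpow_neg hy0.le,
      nsmul_eq_mul, div_eq_mul_inv]
  rw [hcount, integral_finsetSum _ hint, smoothInvSum, smoothCount,
    Finset.sum_congr rfl fun n hn => one_div_eq_add_integral hy (hmem n hn).1 (hmem n hn).2,
    Finset.sum_add_distrib, Finset.sum_const, ← Finset.mul_sum, Real.rpow_neg hy0.le,
    nsmul_eq_mul, div_eq_mul_inv]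

lemma smoothCount_div_le_one {y : ℝ} (hy : 0 < y) (u : ℝ) :
    (smoothCount (y ^ u) y : ℝ) / y ^ u ≤ 1 := by
  have h : 0 < y ^ u := Real.rpow_pos_of_pos hy u
  rw [div_le_one h]
  exact smoothCount_le h.le y

/-- The boundary term is at most `1` and disappears after division by `log y`. The integral
converges by dominated convergence, because `Ψ(y^u, y)/y^u ≤ 1` and Dickman's theorem holds
pointwise. -/
theorem tendsto_smoothInvSum_div_log {x : ℝ} (hx : 0 ≤ x) :
    Tendsto (fun y : ℝ => smoothInvSum (y ^ x) y / Real.log y) atTop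
      (𝓝 (∫ u in (0 : ℝ)..x, rho u)) := by
  have h1 : Tendsto (fun y : ℝ => (smoothCount (y ^ x) y : ℝ) / y ^ x / Real.log y) atTop
      (𝓝 0) := by
    refine squeeze_zero' ?_ ?_ Real.tendsto_log_atTop.inv_tendsto_atTop
    · filter_upwards [eventually_gt_atTop 1] with y hy
      have := Real.log_pos hy
      have : 0 < y := by linarith
      positivity
    · filter_upwards [eventually_gt_atTop 1] with y hy
      have := Real.log_pos hy
      rw [Pi.inv_apply, ← one_div]
      gcongr
      exact smoothCount_div_le_one (by linarith) x
  have h2 : Tendsto (fun y : ℝ => ∫ u in Set.Ioc 0 x, (smoothCount (y ^ u) y : ℝ) / y ^ u) atTop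
      (𝓝 (∫ u in Set.Ioc 0 x, rho u)) := by
    refine tendsto_integral_filter_of_dominated_convergence (fun _ => 1) ?_ ?_
      (integrable_const 1) ?_
    · filter_upwards [eventually_gt_atTop 1] with y hy
      have hy0 : 0 < y := by linarith
      have hmono : Monotone fun u : ℝ => smoothCount (y ^ u) y := fun a b hab =>
        smoothCount_mono_left y (Real.rpow_le_rpow_of_exponent_le hy.le hab)
      have hc : Continuous fun u : ℝ => y ^ u :=
        Continuous.rpow continuous_const continuous_id fun _ => Or.inl hy0.ne'
      have hm : Measurable fun u : ℝ => (smoothCount (y ^ u) y : ℝ) :=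
        (measurable_of_countable (fun n : ℕ => (n : ℝ))).comp hmono.measurable
      exact (hm.div hc.measurable).aestronglyMeasurable
    · filter_upwards [eventually_gt_atTop 1] with y hy
      have hy0 : 0 < y := by linarith
      refine Eventually.of_forall fun u => ?_
      have : 0 < y ^ u := Real.rpow_pos_of_pos hy0 u
      rw [Real.norm_of_nonneg (by positivity)]
      exact smoothCount_div_le_one hy0 u
    · filter_upwards [ae_restrict_mem measurableSet_Ioc] with u hu using tendsto_smoothCount hu.1
  rw [intervalIntegral.integral_of_le hx]
  have h3 := h1.add h2
  rw [zero_add] at h3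
  refine h3.congr' ?_
  filter_upwards [eventually_gt_atTop 1] with y hy
  have := Real.log_pos hy
  rw [smoothInvSum_eq hy x]
  field_simp

/-! ## Tightness -/

lemma primesLE_q (N : ℕ) : (q N).primesLE = (Finset.range (N + 1)).image q := by
  ext p
  rw [Nat.mem_primesLE, Finset.mem_image]
  constructor
  · rintro ⟨h1, h2⟩
    obtain ⟨j, rfl⟩ := exists_q_eq h2
    exact ⟨j, Finset.mem_range.2 (Nat.lt_succ_of_le (q_strictMono.le_iff_le.1 h1)), rfl⟩
  · rintro ⟨j, hj, rfl⟩
    exact ⟨q_strictMono.monotone (Nat.lt_succ_iff.1 (Finset.mem_range.1 hj)), q_prime j⟩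

lemma exists_sum_log_q_le : ∃ K : ℝ, 0 < K ∧ ∀ N : ℕ,
    ∑ j ∈ Finset.range (N + 1), Real.log (q j) / (q j - 1) ≤ K * Real.log (q N) := by
  obtain ⟨K, hK0, hK⟩ := exists_sum_log_div_le
  have hl2 : 0 < Real.log 2 := Real.log_pos (by norm_num)
  refine ⟨1 + (Real.log 4 + K) / Real.log 2, by positivity, fun N => ?_⟩
  have h1 := hK (q N)
  have h2 := primeLogSum_le (q_prime N).pos
  rw [Finset.sum_sub_distrib] at h1
  change _ - primeLogSum (q N) ≤ K at h1
  rw [primesLE_q, Finset.sum_image fun a _ b _ h => q_strictMono.injective h] at h1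
  have h3 : Real.log 2 ≤ Real.log (q N) :=
    Real.log_le_log (by norm_num) (by exact_mod_cast (q_prime N).two_le)
  have h4 : Real.log 4 + K ≤ (Real.log 4 + K) / Real.log 2 * Real.log (q N) := by
    rw [div_mul_eq_mul_div, le_div_iff₀ hl2]
    gcongr
  linarith

/-- The truncated first logarithmic moment of `P_N`, multiplied by `C_N`. -/
lemma logSum_min_log_le (N : ℕ) {B : ℝ} (hB : 0 ≤ B) :
    logSum N (fun n => ENNReal.ofReal (min (Real.log n) B)) ≤
      ENNReal.ofReal (cReal N * ∑ j ∈ Finset.range N, Real.log (q j) / (q j - 1)) := by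
  induction N with
  | zero =>
    rw [logSum, Omega_zero, tsum_eq_single 1 (fun n hn => by simp [hn])]
    simp
  | succ N ih =>
    set φ : ℕ → ℝ≥0∞ := fun n => ENNReal.ofReal (min (Real.log n) B) with hφ
    -- The truncation at `B` is there for this a priori finiteness: the moment occurs on both sides
    -- of the recursion and must be subtracted.
    have hfin : ∀ M, logSum M φ ≠ ∞ := fun M => by
      have h1 : logSum M φ ≤ logSum M fun _ => ENNReal.ofReal B * 1 := logSum_mono fun n _ => by
        rw [mul_one]
        exact ENNReal.ofReal_le_ofReal (min_le_right _ _)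
      refine ne_top_of_le_ne_top ?_ h1
      rw [logSum_const_mul]
      refine ENNReal.mul_ne_top ENNReal.ofReal_ne_top ?_
      have : logSum M (fun _ => 1) = logMass M Set.univ := by
        rw [logMass]
        congr 1
        ext n
        simp
      rw [this]
      exact logMass_ne_top _ _
    have hq1 : (1 : ℝ) < q N := by exact_mod_cast (q_prime N).one_lt
    have hlq := log_q_pos N
    have hstep : logSum (N + 1) (fun m => φ (q N * m)) ≤
        ENNReal.ofReal (Real.log (q N)) * C (N + 1) + logSum (N + 1) φ := by
      have h1 : ENNReal.ofReal (Real.log (q N)) * C (N + 1) =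
          logSum (N + 1) fun _ => ENNReal.ofReal (Real.log (q N)) * 1 := by
        rw [logSum_const_mul, ← logMass_univ, logMass]
        congr 2
        ext n
        simp
      rw [h1, ← logSum_add]
      refine logSum_mono fun m hm => ?_
      have hm0 : (m : ℝ) ≠ 0 := by exact_mod_cast hm.1.ne'
      have hlm := Real.log_natCast_nonneg m
      rw [mul_one, hφ, ← ENNReal.ofReal_add hlq.le (le_min hlm hB)]
      refine ENNReal.ofReal_le_ofReal ?_
      push_cast
      rw [Real.log_mul (by positivity) hm0]
      rcases le_total (Real.log m) B with h | h
      · rw [min_eq_left h]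
        exact min_le_left _ _
      · rw [min_eq_right h]
        exact (min_le_right _ _).trans (by linarith)
    have hrec : (logSum (N + 1) φ).toReal ≤ (logSum N φ).toReal +
        (Real.log (q N) * cReal (N + 1) + (logSum (N + 1) φ).toReal) / q N := by
      have h1 := logSum_succ N φ
      have h2 : logSum (N + 1) φ ≤ logSum N φ + (q N : ℝ≥0∞)⁻¹ *
          (ENNReal.ofReal (Real.log (q N)) * C (N + 1) + logSum (N + 1) φ) := by
        calc _ = _ := h1
          _ ≤ _ := by gcongr
      have h3 : ENNReal.ofReal (Real.log (q N)) * C (N + 1) ≠ ∞ :=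
        ENNReal.mul_ne_top ENNReal.ofReal_ne_top (C_ne_top _)
      have h4 : (q N : ℝ≥0∞)⁻¹ *
          (ENNReal.ofReal (Real.log (q N)) * C (N + 1) + logSum (N + 1) φ) ≠ ∞ :=
        ENNReal.mul_ne_top (by simp [(q_prime N).ne_zero]) (ENNReal.add_ne_top.2 ⟨h3, hfin _⟩)
      have h5 := ENNReal.toReal_mono (ENNReal.add_ne_top.2 ⟨hfin N, h4⟩) h2
      rwa [ENNReal.toReal_add (hfin N) h4, ENNReal.toReal_mul, ENNReal.toReal_add h3 (hfin _),
        ENNReal.toReal_mul, ENNReal.toReal_ofReal hlq.le, ENNReal.toReal_inv,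
        ENNReal.toReal_natCast, ← cReal, ← div_eq_inv_mul] at h5
    have hsum0 : ∀ M, 0 ≤ ∑ j ∈ Finset.range M, Real.log (q j) / ((q j : ℝ) - 1) := fun M =>
      Finset.sum_nonneg fun j _ => div_nonneg (log_q_pos j).le
        (sub_nonneg.2 (by exact_mod_cast (q_prime j).one_lt.le))
    have ih' : (logSum N φ).toReal ≤
        cReal N * ∑ j ∈ Finset.range N, Real.log (q j) / (q j - 1) := by
      have := ENNReal.toReal_mono ENNReal.ofReal_ne_top ih
      rwa [ENNReal.toReal_ofReal (mul_nonneg (cReal_pos N).le (hsum0 N))] at this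
    rw [← ENNReal.ofReal_toReal (hfin (N + 1))]
    refine ENNReal.ofReal_le_ofReal ?_
    rw [Finset.sum_range_succ]
    have hc := cReal_succ N
    set S := ∑ j ∈ Finset.range N, Real.log (q j) / ((q j : ℝ) - 1)
    set l := (logSum (N + 1) φ).toReal
    have hq0 : (0 : ℝ) < q N := by linarith
    have hq2 : (q N : ℝ) - 1 ≠ 0 := by linarith
    have hcN : cReal N = cReal (N + 1) * (1 - 1 / q N) := by
      have : cReal (N + 1) / q N = cReal (N + 1) * (1 / q N) := by ring
      linarith
    -- Solve for the moment, which returns with weight `1/q_N`; the Euler factor relating `C_N` to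
    -- `C_{N+1}` is the same `1 - 1/q_N` and cancels.
    have h1 : l * (1 - 1 / q N) ≤
        cReal (N + 1) * (S + Real.log (q N) / (q N - 1)) * (1 - 1 / q N) := by
      calc l * (1 - 1 / q N) = l - l / q N := by ring
        _ ≤ (logSum N φ).toReal + Real.log (q N) * cReal (N + 1) / q N := by
          have : (Real.log (q N) * cReal (N + 1) + l) / q N
            = Real.log (q N) * cReal (N + 1) / q N + l / q N := by ring
          linarith
        _ ≤ cReal N * S + Real.log (q N) * cReal (N + 1) / q N := by linarith
        _ = _ := by
          rw [hcN]
          field_simp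
    have h2 : 0 < 1 - 1 / (q N : ℝ) := by
      rw [sub_pos, div_lt_one hq0]
      exact hq1
    exact le_of_mul_le_mul_right h1 h2

/-- Uniform tightness of `log m / log p_N` under `P_N`. -/
lemma exists_mass_tail_le : ∃ K : ℝ, 0 < K ∧ ∀ N : ℕ, ∀ x : ℝ, 0 < x →
    mass (N + 1) {m | x * Real.log (q N) ≤ Real.log m} ≤ cReal (N + 1) * K / x := by
  obtain ⟨K, hK0, hK⟩ := exists_sum_log_q_le
  refine ⟨K, hK0, fun N x hx => ?_⟩
  have hlq := log_q_pos N
  set B := x * Real.log (q N) with hB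
  have hB0 : 0 < B := by positivity
  -- Markov's inequality; truncating the logarithm exactly at the threshold `B` loses nothing.
  have h1 : ENNReal.ofReal B * logMass (N + 1) {m | B ≤ Real.log m} ≤
      logSum (N + 1) fun n => ENNReal.ofReal (min (Real.log n) B) := by
    rw [logMass, ← logSum_const_mul]
    refine logSum_mono fun n _ => ?_
    by_cases h : B ≤ Real.log n
    · simp [h]
    · simp [h]
  have h2 := h1.trans (logSum_min_log_le (N + 1) hB0.le)
  have h3 := ENNReal.toReal_mono ENNReal.ofReal_ne_top h2
  have hsum0 : 0 ≤ ∑ j ∈ Finset.range (N + 1), Real.log (q j) / ((q j : ℝ) - 1) :=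
    Finset.sum_nonneg fun j _ => div_nonneg (log_q_pos j).le
      (sub_nonneg.2 (by exact_mod_cast (q_prime j).one_lt.le))
  rw [ENNReal.toReal_mul, ENNReal.toReal_ofReal hB0.le,
    ENNReal.toReal_ofReal (mul_nonneg (cReal_pos _).le hsum0), ← mass] at h3
  have h4 : B * mass (N + 1) {m | B ≤ Real.log m} ≤
      cReal (N + 1) * (K * Real.log (q N)) :=
    h3.trans (mul_le_mul_of_nonneg_left (hK N) (cReal_pos _).le)
  rw [le_div_iff₀ hx]
  have h5 : mass (N + 1) {m | B ≤ Real.log m} * x * Real.log (q N) ≤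
      cReal (N + 1) * K * Real.log (q N) := by
    rw [hB] at h4 ⊢
    linarith
  exact le_of_mul_le_mul_right h5 hlq

/-! ## The limit law of `log m / log p_N` -/

lemma tendsto_mass_le_div_log {x : ℝ} (hx : 0 ≤ x) :
    Tendsto (fun N => mass (N + 1) {m | (m : ℝ) ≤ (q N : ℝ) ^ x} / Real.log (q N)) atTop
      (𝓝 (∫ u in (0 : ℝ)..x, rho u)) := by
  refine ((tendsto_smoothInvSum_div_log hx).comp tendsto_q_cast).congr fun N => ?_
  rw [Function.comp, mass_le_eq_smoothInvSum N (by positivity)]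

/-- Mertens' third theorem: `C_N ∼ e^γ log p_N`. -/
theorem tendsto_cReal_div_log : Tendsto (fun N => cReal (N + 1) / Real.log (q N)) atTop
    (𝓝 (Real.exp Real.eulerMascheroniConstant)) := by
  obtain ⟨K, hK0, hK⟩ := exists_mass_tail_le
  set E := Real.exp Real.eulerMascheroniConstant with hE
  have hE0 : 0 < E := Real.exp_pos _
  have hI : Tendsto (fun x : ℝ => ∫ u in (0 : ℝ)..x, rho u) atTop (𝓝 E) := by
    have := intervalIntegral_tendsto_integral_Ioi 0 integrableOn_rho tendsto_id
    rwa [integral_rho_Ioi] at this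
  have hlow : ∀ (N : ℕ) (x : ℝ), mass (N + 1) {m | (m : ℝ) ≤ (q N : ℝ) ^ x} / Real.log (q N) ≤
      cReal (N + 1) / Real.log (q N) := fun N x => by
    have := log_q_pos N
    rw [← mass_univ]
    gcongr
    exact mass_mono fun _ _ _ => Set.mem_univ _
  -- By tightness, at most a share `K/x` of the mass `C_{N+1}` lies beyond `q_N^x`, uniformly in
  -- `N`. Hence the limits `N → ∞` and `x → ∞` can be combined.
  have hup : ∀ (N : ℕ) (x : ℝ), 0 < x → cReal (N + 1) / Real.log (q N) * (1 - K / x) ≤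
      mass (N + 1) {m | (m : ℝ) ≤ (q N : ℝ) ^ x} / Real.log (q N) := fun N x hx => by
    have hl := log_q_pos N
    have hq0 : (0 : ℝ) < q N := by exact_mod_cast (q_prime N).pos
    rw [div_mul_eq_mul_div]
    gcongr
    have h1 := mass_add_compl (N + 1) {m | (m : ℝ) ≤ (q N : ℝ) ^ x}
    have h2 : mass (N + 1) {m | (m : ℝ) ≤ (q N : ℝ) ^ x}ᶜ ≤
        mass (N + 1) {m | x * Real.log (q N) ≤ Real.log m} := mass_mono fun m hm h => by
      have hm0 : (0 : ℝ) < m := by exact_mod_cast hm.1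
      have h : ¬ (m : ℝ) ≤ (q N : ℝ) ^ x := h
      change x * Real.log (q N) ≤ Real.log m
      rw [← Real.log_rpow hq0]
      exact Real.log_le_log (by positivity) (not_le.1 h).le
    have h3 := hK N x hx
    have h4 : cReal (N + 1) * (1 - K / x) = cReal (N + 1) - cReal (N + 1) * K / x := by ring
    linarith
  rw [tendsto_order]
  constructor
  · intro a ha
    obtain ⟨x, hx1, hx2⟩ := ((hI.eventually_const_lt ha).and (eventually_ge_atTop 0)).exists
    filter_upwards [(tendsto_mass_le_div_log hx2).eventually_const_lt hx1] with N hN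
    exact hN.trans_le (hlow N x)
  · intro a ha
    have h1 : Tendsto (fun x : ℝ => (∫ u in (0 : ℝ)..x, rho u) / (1 - K / x)) atTop (𝓝 E) := by
      have h2 : Tendsto (fun x : ℝ => 1 - K / x) atTop (𝓝 1) := by
        simpa using (tendsto_const_nhds (x := K)).div_atTop tendsto_id |>.const_sub 1
      have h3 := hI.div h2 one_ne_zero
      rw [div_one] at h3
      exact h3
    obtain ⟨x, hx1, hx2⟩ := ((h1.eventually_lt_const ha).and (eventually_gt_atTop K)).exists
    have hx0 : 0 < x := hK0.trans hx2
    have hpos : 0 < 1 - K / x := by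
      rw [sub_pos, div_lt_one hx0]
      exact hx2
    rw [div_lt_iff₀ hpos] at hx1
    filter_upwards [(tendsto_mass_le_div_log hx0.le).eventually_lt_const hx1] with N hN
    exact lt_of_mul_lt_mul_right ((hup N x hx0).trans_lt hN) hpos.le

lemma tendsto_cReal : Tendsto cReal atTop atTop := by
  have h : Tendsto (fun N => cReal (N + 1)) atTop atTop := by
    refine (tendsto_cReal_div_log.pos_mul_atTop (Real.exp_pos _) tendsto_log_q).congr fun N => ?_
    have := (log_q_pos N).ne'
    field_simp
  exact (tendsto_add_atTop_iff_nat 1).1 h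

lemma mass_singleton_le (N : ℕ) (m : ℕ) : mass N {m} ≤ 1 := by
  rw [mass, logMass, logSum, tsum_eq_single m (fun n hn => by
    by_cases h : n ∈ Omega N <;> simp [h, hn])]
  by_cases h : m ∈ Omega N
  · have : 1 ≤ m := h.1
    simp only [h, Set.indicator_of_mem, Set.mem_singleton_iff, Pi.one_apply, mul_one,
      ENNReal.toReal_inv, ENNReal.toReal_natCast]
    exact inv_le_one_of_one_le₀ (by exact_mod_cast this)
  · simp [h]

/-- Under `P_N`, `log m / log p_N` converges in law to the Dickman distribution. -/
theorem tendsto_mass_log_ge (x : ℝ) :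
    Tendsto (fun N => mass (N + 1) {m | x * Real.log (q N) ≤ Real.log m} / cReal (N + 1)) atTop
      (𝓝 (dickmanTail (max x 0))) := by
  rcases lt_or_ge x 0 with hx | hx
  · rw [max_eq_right hx.le, dickmanTail_zero]
    refine tendsto_const_nhds.congr fun N => ?_
    have : mass (N + 1) {m | x * Real.log (q N) ≤ Real.log m} = cReal (N + 1) := by
      rw [← mass_univ]
      refine mass_congr fun m _ => ⟨fun _ => Set.mem_univ _, fun _ => ?_⟩
      have h1 := log_q_pos N
      have h2 := Real.log_natCast_nonneg m
      change x * Real.log (q N) ≤ Real.log m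
      nlinarith
    rw [this, div_self (cReal_pos _).ne']
  rw [max_eq_left hx]
  have hle : Tendsto (fun N => mass (N + 1) {m | (m : ℝ) ≤ (q N : ℝ) ^ x} / cReal (N + 1)) atTop
      (𝓝 (1 - dickmanTail x)) := by
    rw [dickmanTail_eq hx, sub_sub_cancel, Real.exp_neg, ← div_eq_inv_mul]
    refine ((tendsto_mass_le_div_log hx).div tendsto_cReal_div_log (Real.exp_pos _).ne').congr
      fun N => ?_
    have := (log_q_pos N).ne'
    have := (cReal_pos (N + 1)).ne'
    simp only [Pi.div_apply]
    field_simp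
  have hinv : Tendsto (fun N => 1 / cReal (N + 1)) atTop (𝓝 0) :=
    (tendsto_const_nhds (x := (1 : ℝ))).div_atTop
      ((tendsto_add_atTop_iff_nat 1).2 tendsto_cReal)
  have hlow := hle.const_sub 1
  have hup := hlow.add hinv
  rw [sub_sub_cancel] at hlow
  rw [sub_sub_cancel, add_zero] at hup
  refine tendsto_of_tendsto_of_tendsto_of_le_of_le hlow hup (fun N => ?_) (fun N => ?_)
  · have hc := cReal_pos (N + 1)
    have hq0 : (0 : ℝ) < q N := by exact_mod_cast (q_prime N).pos
    have h1 := mass_add_compl (N + 1) {m | (m : ℝ) ≤ (q N : ℝ) ^ x}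
    have h2 : mass (N + 1) {m | (m : ℝ) ≤ (q N : ℝ) ^ x}ᶜ ≤
        mass (N + 1) {m | x * Real.log (q N) ≤ Real.log m} := mass_mono fun m hm h => by
      have h : ¬ (m : ℝ) ≤ (q N : ℝ) ^ x := h
      change x * Real.log (q N) ≤ Real.log m
      rw [← Real.log_rpow hq0]
      exact Real.log_le_log (by positivity) (not_le.1 h).le
    rw [le_div_iff₀ hc, sub_mul, div_mul_cancel₀ _ hc.ne']
    linarith
  · have hc := cReal_pos (N + 1)
    have hq0 : (0 : ℝ) < q N := by exact_mod_cast (q_prime N).pos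
    have h1 := mass_add_compl (N + 1) {m | (m : ℝ) ≤ (q N : ℝ) ^ x}
    -- The events `m ≥ q_N^x` and `m > q_N^x` differ by at most one integer, whose mass is at most
    -- `1` and thus negligible against `C_{N+1}`.
    have h2 : mass (N + 1) {m | x * Real.log (q N) ≤ Real.log m} ≤
        mass (N + 1) ({m | (m : ℝ) ≤ (q N : ℝ) ^ x}ᶜ ∪ {⌊(q N : ℝ) ^ x⌋₊}) :=
      mass_mono fun m hm h => by
        have hm0 : (0 : ℝ) < m := by exact_mod_cast hm.1
        have h : x * Real.log (q N) ≤ Real.log m := h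
        rw [← Real.log_rpow hq0, Real.log_le_log_iff (by positivity) hm0] at h
        rcases h.eq_or_lt with h | h
        · right
          rw [Set.mem_singleton_iff, h, Nat.floor_natCast]
        · left
          exact not_le.2 h
    have h3 := h2.trans (mass_union_le _ _ _)
    have h4 := mass_singleton_le (N + 1) ⌊(q N : ℝ) ^ x⌋₊
    rw [div_le_iff₀ hc, add_mul, sub_mul, div_mul_cancel₀ _ hc.ne', div_mul_cancel₀ _ hc.ne']
    linarith

/-! ## Conditioning on the `k`-free integers -/

/-- Take the largest `b` with `b^k ∣ n`: a `k`-th prime power `p^k` left in the cofactor would make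
`p b` a larger candidate. -/
lemma exists_eq_kfree_mul_pow {k n : ℕ} (hk : k ≠ 0) (hn : 0 < n) :
    ∃ b, 0 < b ∧ ∃ a ∈ S k, a * b ^ k = n := by
  set b := Nat.findGreatest (fun b => b ^ k ∣ n) n with hb
  have h1 : b ^ k ∣ n := Nat.findGreatest_spec (P := fun b => b ^ k ∣ n) (m := 1) hn (by simp)
  have hb0 : 0 < b := Nat.le_findGreatest (P := fun b => b ^ k ∣ n) hn (by simp)
  obtain ⟨a, ha⟩ := h1
  have ha0 : 0 < a := by
    rcases Nat.eq_zero_or_pos a with rfl | h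
    · simp at ha
      omega
    · exact h
  refine ⟨b, hb0, a, ⟨ha0, fun p hp hd => ?_⟩, by rw [ha, mul_comm]⟩
  have h2 : (p * b) ^ k ∣ n := by
    rw [mul_pow, ha, mul_comm]
    exact mul_dvd_mul_left _ hd
  have h3 : p * b ≤ n := (Nat.le_self_pow hk _).trans (Nat.le_of_dvd hn h2)
  have h4 := Nat.le_findGreatest (P := fun b => b ^ k ∣ n) h3 h2
  rw [← hb] at h4
  have := hp.two_le
  nlinarith

lemma kfree_factorization_lt {k a p : ℕ} (ha : a ∈ S k) (hp : p.Prime) :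
    a.factorization p < k := by
  by_contra! h
  exact ha.2 p hp ((hp.pow_dvd_iff_le_factorization ha.1.ne').2 h)

/-- Prime exponents of `a` are below `k`, so the exponents of `b` are recovered from those of `a
b^k` by integer division by `k`. -/
lemma kfree_mul_pow_injective {k a b a' b' : ℕ} (ha : a ∈ S k) (ha' : a' ∈ S k) (hb : 0 < b)
    (hb' : 0 < b') (h : a * b ^ k = a' * b' ^ k) : a = a' ∧ b = b' := by
  have key : ∀ {a b : ℕ}, a ∈ S k → 0 < b → ∀ p, p.Prime →
      (a * b ^ k).factorization p / k = b.factorization p := by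
    intro a b ha hb p hp
    have hlt := kfree_factorization_lt ha hp
    rw [Nat.factorization_mul ha.1.ne' (pow_ne_zero _ hb.ne'), Nat.factorization_pow]
    simp only [Finsupp.add_apply, Finsupp.smul_apply, smul_eq_mul]
    rw [Nat.add_mul_div_left _ _ (by omega), Nat.div_eq_of_lt hlt, zero_add]
  have hbb : b = b' := by
    refine Nat.eq_of_factorization_eq hb.ne' hb'.ne' fun p => ?_
    by_cases hp : p.Prime
    · rw [← key ha hb p hp, h, key ha' hb' p hp]
    · simp [Nat.factorization_eq_zero_of_not_prime _ hp]
  subst hbb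
  exact ⟨Nat.eq_of_mul_eq_mul_right (pow_pos hb k) h, rfl⟩

/-- Every positive integer is uniquely a `k`-free integer times a `k`-th power. -/
lemma logSum_eq_tsum_kfree {k : ℕ} (hk : k ≠ 0) (N : ℕ) (f : ℕ → ℝ≥0∞) :
    logSum N f = ∑' b, (Omega N).indicator (fun b => (b : ℝ≥0∞)⁻¹ ^ k *
      logSum N ((S k).indicator fun a => f (a * b ^ k))) b := by
  set F : ℕ → ℝ≥0∞ := (Omega N).indicator fun n => (n : ℝ≥0∞)⁻¹ * f n with hF
  have hinj : Function.Injective fun c : {b : ℕ // 0 < b} × S k => (c.2 : ℕ) * (c.1 : ℕ) ^ k := by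
    rintro ⟨⟨b, hb⟩, ⟨a, ha⟩⟩ ⟨⟨b', hb'⟩, ⟨a', ha'⟩⟩ h
    obtain ⟨h1, h2⟩ := kfree_mul_pow_injective ha ha' hb hb' h
    simp [h1, h2]
  have h1 : logSum N f = ∑' c : {b : ℕ // 0 < b} × S k, F ((c.2 : ℕ) * (c.1 : ℕ) ^ k) := by
    refine (hinj.tsum_eq fun n hn => ?_).symm
    have hn' : n ∈ Omega N := by
      by_contra h
      exact hn (Set.indicator_of_notMem h _)
    obtain ⟨b, hb, a, ha, hab⟩ := exists_eq_kfree_mul_pow hk hn'.1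
    exact ⟨⟨⟨b, hb⟩, ⟨a, ha⟩⟩, hab⟩
  rw [h1, ENNReal.tsum_prod (f := fun (b : {b : ℕ // 0 < b}) (a : S k) =>
    F ((a : ℕ) * (b : ℕ) ^ k))]
  refine (tsum_subtype {b : ℕ | 0 < b} fun b => ∑' a : S k, F ((a : ℕ) * b ^ k)).trans ?_
  refine tsum_congr fun b => ?_
  by_cases hb : b ∈ Omega N
  · have hb0 : b ∈ {b : ℕ | 0 < b} := hb.1
    rw [Set.indicator_of_mem hb0, Set.indicator_of_mem hb, logSum, ← ENNReal.tsum_mul_left,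
      tsum_subtype (S k) fun a => F (a * b ^ k)]
    refine tsum_congr fun a => ?_
    by_cases haS : a ∈ S k
    · rw [Set.indicator_of_mem haS]
      have hmem : a * b ^ k ∈ Omega N ↔ a ∈ Omega N := by
        rw [mul_mem_Omega_iff, pow_mem_Omega_iff hk]
        exact and_iff_left hb
      by_cases ha : a ∈ Omega N
      · rw [hF, Set.indicator_of_mem (hmem.2 ha), Set.indicator_of_mem ha,
          Set.indicator_of_mem haS]
        have ha0 : (a : ℝ≥0∞) ≠ 0 := by exact_mod_cast ha.1.ne'
        push_cast
        rw [ENNReal.mul_inv (Or.inl ha0) (Or.inl (ENNReal.natCast_ne_top _)), ENNReal.inv_pow]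
        ring
      · rw [hF, Set.indicator_of_notMem (fun h => ha (hmem.1 h)), Set.indicator_of_notMem ha,
          mul_zero]
    · rw [Set.indicator_of_notMem haS]
      by_cases ha : a ∈ Omega N <;> simp [ha, haS]
  · rw [Set.indicator_of_notMem hb]
    refine Set.indicator_apply_eq_zero.2 fun _ => ENNReal.tsum_eq_zero.2 fun a => ?_
    refine Set.indicator_of_notMem (fun h => hb ?_) _
    rw [mul_mem_Omega_iff, pow_mem_Omega_iff hk] at h
    exact h.2

lemma logMass_eq_tsum_kfree {k : ℕ} (hk : k ≠ 0) (N : ℕ) (A : Set ℕ) :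
    logMass N A = ∑' b, (Omega N).indicator (fun b => (b : ℝ≥0∞)⁻¹ ^ k *
      logMass N (S k ∩ {a | a * b ^ k ∈ A})) b := by
  rw [logMass, logSum_eq_tsum_kfree hk]
  refine tsum_congr fun b => ?_
  by_cases hb : b ∈ Omega N
  · rw [Set.indicator_of_mem hb, Set.indicator_of_mem hb, logMass]
    congr 2
    ext a
    by_cases ha : a ∈ S k <;> by_cases hab : a * b ^ k ∈ A <;> simp [ha, hab]
  · rw [Set.indicator_of_notMem hb, Set.indicator_of_notMem hb]

/-- The sum `∑_{b ∈ Ω_N} b^{-k}`. -/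
def powSum (k N : ℕ) : ℝ≥0∞ := ∑' b, (Omega N).indicator (fun b => (b : ℝ≥0∞)⁻¹ ^ k) b

/-- The summand of `∑_{b ≥ 1} b^{-k}`. -/
def powTerm (k b : ℕ) : ℝ≥0∞ := {b : ℕ | 0 < b}.indicator (fun b => (b : ℝ≥0∞)⁻¹ ^ k) b

lemma indicator_Omega_le_powTerm (k N b : ℕ) :
    (Omega N).indicator (fun b => (b : ℝ≥0∞)⁻¹ ^ k) b ≤ powTerm k b :=
  Set.indicator_le_indicator_of_subset (fun _ h => h.1) (fun _ => zero_le) b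

lemma tsum_powTerm_ne_top {k : ℕ} (hk : 2 ≤ k) : ∑' b, powTerm k b ≠ ∞ := by
  have h := (Real.summable_nat_pow_inv (p := k)).2 (by omega)
  refine ne_top_of_le_ne_top h.tsum_ofReal_ne_top (ENNReal.tsum_le_tsum fun b => ?_)
  by_cases hb : 0 < b
  · have hb' : (0 : ℝ) < b := by exact_mod_cast hb
    rw [powTerm, Set.indicator_of_mem (show b ∈ {b : ℕ | 0 < b} from hb),
      ENNReal.ofReal_inv_of_pos (by positivity), ENNReal.ofReal_pow hb'.le,
      ENNReal.ofReal_natCast, ENNReal.inv_pow]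
  · rw [powTerm, Set.indicator_of_notMem (show b ∉ {b : ℕ | 0 < b} from hb)]
    exact zero_le

lemma powSum_ne_top {k : ℕ} (hk : 2 ≤ k) (N : ℕ) : powSum k N ≠ ∞ :=
  ne_top_of_le_ne_top (tsum_powTerm_ne_top hk)
    (ENNReal.tsum_le_tsum fun b => indicator_Omega_le_powTerm k N b)

lemma one_le_powSum (k N : ℕ) : 1 ≤ powSum k N := by
  refine le_trans ?_ (ENNReal.le_tsum 1)
  simp [one_mem_Omega]

/-- `∑_{b ∈ Ω_N} b^{-k}` converges to a limit that is at least `1`. -/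
lemma exists_tendsto_powSum {k : ℕ} (hk : 2 ≤ k) :
    ∃ z : ℝ, 1 ≤ z ∧ Tendsto (fun N => (powSum k N).toReal) atTop (𝓝 z) := by
  have hmono : Monotone fun N => (powSum k N).toReal := fun N M h =>
    ENNReal.toReal_mono (powSum_ne_top hk M) (ENNReal.tsum_le_tsum fun b =>
      Set.indicator_le_indicator_of_subset (Omega_mono h) (fun _ => zero_le) b)
  have hbdd : BddAbove (Set.range fun N => (powSum k N).toReal) := by
    refine ⟨(∑' b, powTerm k b).toReal, ?_⟩
    rintro _ ⟨N, rfl⟩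
    exact ENNReal.toReal_mono (tsum_powTerm_ne_top hk)
      (ENNReal.tsum_le_tsum fun b => indicator_Omega_le_powTerm k N b)
  refine ⟨_, ?_, tendsto_atTop_ciSup hmono hbdd⟩
  refine le_trans ?_ (le_ciSup hbdd 0)
  have := ENNReal.toReal_mono (powSum_ne_top hk 0) (one_le_powSum k 0)
  simpa using this

lemma cReal_eq_powSum_mul {k : ℕ} (hk : k ≠ 0) (N : ℕ) :
    cReal N = (powSum k N).toReal * mass N (S k) := by
  rw [← mass_univ, mass, logMass_eq_tsum_kfree hk, mass, ← ENNReal.toReal_mul, powSum,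
    ← ENNReal.tsum_mul_right]
  congr 1
  refine tsum_congr fun b => ?_
  by_cases hb : b ∈ Omega N
  · rw [Set.indicator_of_mem hb, Set.indicator_of_mem hb]
    congr 2
    ext a
    simp
  · rw [Set.indicator_of_notMem hb, Set.indicator_of_notMem hb, zero_mul]

/-- Multiplying a `k`-free `a` by `b^k` can only increase its logarithm, so every `b ∈ Omega N`
contributes at least `b^{-k}` times the `k`-free mass. -/
lemma powSum_mul_mass_le {k : ℕ} (hk : k ≠ 0) (N : ℕ) (B : ℝ) :
    (powSum k N).toReal * mass N (S k ∩ {m | B ≤ Real.log m}) ≤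
      mass N {m | B ≤ Real.log m} := by
  rw [mass, mass, ← ENNReal.toReal_mul]
  refine ENNReal.toReal_mono (logMass_ne_top _ _) ?_
  rw [logMass_eq_tsum_kfree hk N {m | B ≤ Real.log m}, powSum, ← ENNReal.tsum_mul_right]
  refine ENNReal.tsum_le_tsum fun b => ?_
  by_cases hb : b ∈ Omega N
  · rw [Set.indicator_of_mem hb, Set.indicator_of_mem hb]
    gcongr
    refine logMass_mono fun a ha h => ⟨h.1, ?_⟩
    have h2 : B ≤ Real.log a := h.2
    change B ≤ Real.log ((a * b ^ k : ℕ) : ℝ)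
    refine h2.trans (Real.log_le_log (by exact_mod_cast ha.1) ?_)
    exact_mod_cast Nat.le_mul_of_pos_right a (pow_pos hb.1 k)
  · rw [Set.indicator_of_notMem hb, zero_mul]
    exact zero_le

/-- A converse with a margin: for `b ∈ s` the factor `b^k` shifts the logarithm by at most `B' - B`,
and all other `b` together contribute at most a tail of `∑ b^{-k}` times `C_N`. -/
lemma mass_le_powSum_mul_add {k : ℕ} (hk : 2 ≤ k) (N : ℕ) (B B' : ℝ) (s : Finset ℕ)
    (hs : ∀ b ∈ s, k * Real.log b ≤ B' - B) :
    mass N {m | B' ≤ Real.log m} ≤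
      (powSum k N).toReal * mass N (S k ∩ {m | B ≤ Real.log m}) +
        (∑' b : {b // b ∉ s}, powTerm k b).toReal * cReal N := by
  have htail : ∑' b : {b // b ∉ s}, powTerm k b ≠ ∞ :=
    ne_top_of_le_ne_top (tsum_powTerm_ne_top hk)
      (ENNReal.tsum_comp_le_tsum_of_injective Subtype.val_injective _)
  have htail_eq : ∑' b : {b // b ∉ s}, powTerm k b = ∑' b, {b | b ∉ s}.indicator (powTerm k) b :=
    tsum_subtype {b | b ∉ s} (powTerm k)
  rw [mass, mass, cReal, ← ENNReal.toReal_mul, ← ENNReal.toReal_mul, ← ENNReal.toReal_add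
    (ENNReal.mul_ne_top (powSum_ne_top hk N) (logMass_ne_top _ _))
    (ENNReal.mul_ne_top htail (C_ne_top N))]
  refine ENNReal.toReal_mono (ENNReal.add_ne_top.2
    ⟨ENNReal.mul_ne_top (powSum_ne_top hk N) (logMass_ne_top _ _),
      ENNReal.mul_ne_top htail (C_ne_top N)⟩) ?_
  rw [logMass_eq_tsum_kfree (by omega : k ≠ 0) N {m | B' ≤ Real.log m}, powSum,
    htail_eq, ← ENNReal.tsum_mul_right, ← ENNReal.tsum_mul_right,
    ← ENNReal.tsum_add]
  refine ENNReal.tsum_le_tsum fun b => ?_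
  by_cases hb : b ∈ Omega N
  · by_cases hbs : b ∈ s
    · refine le_trans ?_ le_self_add
      rw [Set.indicator_of_mem hb, Set.indicator_of_mem hb]
      gcongr
      refine logMass_mono fun a ha h => ⟨h.1, ?_⟩
      have h2 : B' ≤ Real.log ((a * b ^ k : ℕ) : ℝ) := h.2
      have ha0 : (a : ℝ) ≠ 0 := by exact_mod_cast ha.1.ne'
      have hb0 : (b : ℝ) ≠ 0 := by exact_mod_cast hb.1.ne'
      push_cast at h2
      rw [Real.log_mul ha0 (pow_ne_zero _ hb0), Real.log_pow] at h2
      change B ≤ Real.log a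
      linarith [hs b hbs]
    · refine le_trans ?_ le_add_self
      rw [Set.indicator_of_mem (show b ∈ {b | b ∉ s} from hbs), ← logMass_univ]
      have h1 := indicator_Omega_le_powTerm k N b
      rw [Set.indicator_of_mem hb] at h1 ⊢
      exact mul_le_mul' h1 (logMass_mono fun _ _ _ => Set.mem_univ _)
  · rw [Set.indicator_of_notMem hb]
    exact zero_le

lemma continuous_dickmanTail_max : Continuous fun x => dickmanTail (max x 0) := by
  have hcp : Continuous fun y => ∫ t in (0 : ℝ)..y, rho t :=
    continuous_iff_continuousAt.2 fun y => (hasDerivAt_primitive_rho y).continuousAt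
  have h : (fun x => dickmanTail (max x 0)) = fun x =>
      1 - Real.exp (-Real.eulerMascheroniConstant) * ∫ t in (0 : ℝ)..(max x 0), rho t :=
    funext fun x => dickmanTail_eq (le_max_right x 0)
  rw [h]
  fun_prop

/-- For the lower bound, raise the threshold from `x` to `x'`: the gap `(x' - x) log q_N` eventually
exceeds `k log b` on any finite set of `b`. Continuity of the limiting tail makes the cost of moving
to `x'` arbitrarily small. -/
lemma tendsto_powSum_mul_mass_kfree {k : ℕ} (hk : 2 ≤ k) (x : ℝ) :
    Tendsto (fun N => (powSum k (N + 1)).toReal *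
      mass (N + 1) (S k ∩ {m | x * Real.log (q N) ≤ Real.log m}) / cReal (N + 1)) atTop
      (𝓝 (dickmanTail (max x 0))) := by
  rw [tendsto_order]
  constructor
  · intro a ha
    have hev : ∀ᶠ x' in 𝓝[>] x, (a + dickmanTail (max x 0)) / 2 < dickmanTail (max x' 0) :=
      ((continuous_dickmanTail_max.tendsto x).eventually_const_lt (by linarith)).filter_mono
        nhdsWithin_le_nhds
    obtain ⟨x', hx'1, hx'2⟩ := (hev.and self_mem_nhdsWithin).exists
    have hx'2 : x < x' := hx'2
    set δ := (dickmanTail (max x 0) - a) / 2 with hδ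
    have hδ0 : 0 < δ := by
      rw [hδ]
      linarith
    obtain ⟨s, hs⟩ := ((ENNReal.tendsto_tsum_compl_atTop_zero
      (tsum_powTerm_ne_top hk)).eventually_lt_const
        (ENNReal.ofReal_pos.2 hδ0)).exists
    have hs' : (∑' b : {b // b ∉ s}, powTerm k b).toReal ≤ δ :=
      ENNReal.toReal_le_of_le_ofReal hδ0.le hs.le
    have hlog : ∀ᶠ N in atTop, ∀ b ∈ s, k * Real.log b ≤ (x' - x) * Real.log (q N) := by
      refine (Finset.eventually_all s).2 fun b _ => ?_
      exact (tendsto_log_q.const_mul_atTop (sub_pos.2 hx'2)).eventually_ge_atTop _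
    filter_upwards [hlog, (tendsto_mass_log_ge x').eventually_const_lt hx'1] with N hN hN'
    have hc := cReal_pos (N + 1)
    have h1 := mass_le_powSum_mul_add hk (N + 1) (x * Real.log (q N)) (x' * Real.log (q N)) s
      fun b hb => (hN b hb).trans (by linarith)
    rw [lt_div_iff₀ hc] at hN' ⊢
    have h2 : (∑' b : {b // b ∉ s}, powTerm k b).toReal * cReal (N + 1) ≤ δ * cReal (N + 1) := by
      gcongr
    have h3 : δ * cReal (N + 1) = (a + dickmanTail (max x 0)) / 2 * cReal (N + 1) -
        a * cReal (N + 1) := by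
      rw [hδ]
      ring
    linarith
  · intro a ha
    filter_upwards [(tendsto_mass_log_ge x).eventually_lt_const ha] with N hN
    refine lt_of_le_of_lt ?_ hN
    have := cReal_pos (N + 1)
    gcongr
    exact powSum_mul_mass_le (by omega) (N + 1) _

/-! ## Log-independent densities -/

/-- Weighted Cesàro averaging: the weights are nonnegative with divergent partial sums `C_N - C_0`,
so any initial segment of `m` is forgotten. -/
lemma tendsto_sum_increments_div {m : ℕ → ℝ} {d : ℝ} (hm : Tendsto m atTop (𝓝 d)) :
    Tendsto (fun N => (∑ j ∈ Finset.range N, (cReal (j + 1) - cReal j) * m j) / cReal N) atTop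
      (𝓝 d) := by
  have hw : ∀ j, 0 ≤ cReal (j + 1) - cReal j := fun j => by
    rw [cReal_succ]
    exact div_nonneg (cReal_pos _).le (Nat.cast_nonneg _)
  have hsum : ∀ N, ∑ j ∈ Finset.range N, (cReal (j + 1) - cReal j) = cReal N - cReal 0 :=
    fun N => Finset.sum_range_sub cReal N
  have hdiv : Tendsto (fun N => ∑ j ∈ Finset.range N, (cReal (j + 1) - cReal j)) atTop atTop := by
    simp only [hsum]
    exact tendsto_atTop_add_const_right _ _ tendsto_cReal
  have he : (fun j => (cReal (j + 1) - cReal j) * (m j - d)) =o[atTop]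
      fun j => cReal (j + 1) - cReal j := by
    have h1 : (fun j => m j - d) =o[atTop] fun _ => (1 : ℝ) := by
      rw [Asymptotics.isLittleO_one_iff]
      simpa using hm.sub_const d
    simpa using (Asymptotics.isBigO_refl (fun j => cReal (j + 1) - cReal j) atTop).mul_isLittleO h1
  have h1 := (he.sum_range hw hdiv).tendsto_div_nhds_zero
  simp only [hsum] at h1
  have h0 : Tendsto (fun N => cReal 0 / cReal N) atTop (𝓝 0) :=
    tendsto_const_nhds.div_atTop tendsto_cReal
  have h2 : Tendsto (fun N => (cReal N - cReal 0) / cReal N) atTop (𝓝 1) := by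
    have h3 := h0.const_sub 1
    rw [sub_zero] at h3
    refine h3.congr fun N => ?_
    rw [sub_div, div_self (cReal_pos N).ne']
  have h4 := (h1.mul h2).add (h2.const_mul d)
  rw [zero_mul, zero_add, mul_one] at h4
  refine h4.congr' ?_
  filter_upwards [tendsto_cReal.eventually_gt_atTop (cReal 0)] with N hN
  have hc := (cReal_pos N).ne'
  have hc' : cReal N - cReal 0 ≠ 0 := (sub_pos.2 hN).ne'
  have h5 : ∑ j ∈ Finset.range N, (cReal (j + 1) - cReal j) * m j =
      ∑ j ∈ Finset.range N, (cReal (j + 1) - cReal j) * (m j - d) + (cReal N - cReal 0) * d := by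
    rw [← hsum, Finset.sum_mul, ← Finset.sum_add_distrib]
    refine Finset.sum_congr rfl fun j _ => ?_
    ring
  rw [h5]
  field_simp

/-- A limit for the conditional laws given the largest prime divisor gives a limit under `P_N`. -/
lemma tendsto_P_real {A : Set ℕ} {d : ℝ}
    (h : Tendsto (fun j => mass (j + 1) {m | q j * m ∈ A} / cReal (j + 1)) atTop (𝓝 d)) :
    Tendsto (fun N => (P N).real A) atTop (𝓝 d) := by
  have h0 : Tendsto (fun N => A.indicator 1 1 / cReal N) atTop (𝓝 0) :=
    tendsto_const_nhds.div_atTop tendsto_cReal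
  have h1 := h0.add (tendsto_sum_increments_div h)
  rw [zero_add] at h1
  refine h1.congr fun N => ?_
  rw [P_real, mass_eq_sum N A, add_div]

/-- The sets `A` that contain `n` with `p⁺(n) = p` exactly if `log (n / p) ≥ x log p`. -/
def IsLogTail (x : ℝ) (A : Set ℕ) : Prop :=
  ∀ j, ∀ m ∈ Omega (j + 1), q j * m ∈ A ↔ x * Real.log (q j) ≤ Real.log m

lemma IsLogTail.tendsto_P {x : ℝ} {A : Set ℕ} (hA : IsLogTail x A) :
    Tendsto (fun N => (P N).real A) atTop (𝓝 (dickmanTail (max x 0))) :=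
  tendsto_P_real ((tendsto_mass_log_ge x).congr fun N => by
    rw [mass_congr (A := {m | x * Real.log (q N) ≤ Real.log m}) (B := {m | q N * m ∈ A})
      fun m hm => (hA N m hm).symm])

lemma mass_dvd_q (j : ℕ) : mass (j + 1) {m | q j ∣ m} = cReal (j + 1) / q j := by
  rw [mass_succ]
  have h1 : mass j {m | q j ∣ m} = 0 := by
    rw [mass_congr (A := {m | q j ∣ m}) (B := ∅) fun m hm =>
      iff_of_false (hm.2 j le_rfl) (Set.notMem_empty m)]
    simp [mass, logMass, logSum]
  rw [h1, zero_add, ← mass_univ]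
  congr 2
  ext m
  simp

lemma q_mul_mem_S {k j m : ℕ} (hk : 2 ≤ k) (hm : m ∈ S k) (hd : ¬ q j ∣ m) : q j * m ∈ S k := by
  refine ⟨Nat.mul_pos (q_prime j).pos hm.1, fun p hp hpk => ?_⟩
  rcases eq_or_ne p (q j) with rfl | hne
  · obtain ⟨k, rfl⟩ : ∃ l, k = l + 2 := ⟨k - 2, by omega⟩
    rw [pow_succ', Nat.mul_dvd_mul_iff_left (q_prime j).pos] at hpk
    exact hd ((dvd_pow_self _ (by omega)).trans hpk)
  · have hcop : Nat.Coprime (p ^ k) (q j) :=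
      Nat.Coprime.pow_left _ ((Nat.coprime_primes hp (q_prime j)).2 hne)
    exact hm.2 p hp (hcop.dvd_of_dvd_mul_left hpk)

/-- If `q j * m` is `k`-free then so is `m`; the converse can fail only when `q j ∣ m`, an event of
probability `1/q_j → 0`. So the `k`-free condition may be imposed on `m` instead. -/
lemma IsLogTail.tendsto_P_inter_S {x z : ℝ} {A : Set ℕ} (hA : IsLogTail x A) {k : ℕ}
    (hk : 2 ≤ k) (hz : 1 ≤ z) (hzk : Tendsto (fun N => (powSum k N).toReal) atTop (𝓝 z)) :
    Tendsto (fun N => (P N).real (A ∩ S k)) atTop (𝓝 (dickmanTail (max x 0) / z)) := by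
  have hup : Tendsto (fun N => mass (N + 1) (S k ∩ {m | x * Real.log (q N) ≤ Real.log m}) /
      cReal (N + 1)) atTop (𝓝 (dickmanTail (max x 0) / z)) := by
    refine ((tendsto_powSum_mul_mass_kfree hk x).div
      ((tendsto_add_atTop_iff_nat 1).2 hzk) (by linarith)).congr fun N => ?_
    have h1 : (1 : ℝ) ≤ (powSum k (N + 1)).toReal := by
      have := ENNReal.toReal_mono (powSum_ne_top hk (N + 1)) (one_le_powSum k (N + 1))
      simpa using this
    have h2 : (powSum k (N + 1)).toReal ≠ 0 := by linarith
    simp only [Pi.div_apply]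
    field_simp
  have hlow := hup.sub tendsto_q_cast.inv_tendsto_atTop
  rw [sub_zero] at hlow
  refine tendsto_P_real (tendsto_of_tendsto_of_tendsto_of_le_of_le hlow hup
    (fun j => ?_) fun j => ?_)
  · have hc := cReal_pos (j + 1)
    have h1 : mass (j + 1) (S k ∩ {m | x * Real.log (q j) ≤ Real.log m}) ≤
        mass (j + 1) ({m | q j * m ∈ A ∩ S k} ∪ {m | q j ∣ m}) := mass_mono fun m hm h => by
      by_cases hd : q j ∣ m
      · exact Or.inr hd
      · exact Or.inl ⟨(hA j m hm).2 h.2, q_mul_mem_S hk h.1 hd⟩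
    have h2 := h1.trans (mass_union_le _ _ _)
    rw [mass_dvd_q] at h2
    simp only [Pi.inv_apply]
    rw [le_div_iff₀ hc, sub_mul, div_mul_cancel₀ _ hc.ne', ← div_eq_inv_mul]
    linarith
  · have hc := cReal_pos (j + 1)
    gcongr
    refine mass_mono fun m hm h => ⟨⟨hm.1, fun p hp hd => ?_⟩, (hA j m hm).1 h.1⟩
    exact h.2.2 p hp (hd.mul_left _)

lemma tendsto_P_S {z : ℝ} {k : ℕ} (hk : 2 ≤ k) (hz : 1 ≤ z)
    (hzk : Tendsto (fun N => (powSum k N).toReal) atTop (𝓝 z)) :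
    Tendsto (fun N => (P N).real (S k)) atTop (𝓝 (1 / z)) := by
  refine ((tendsto_const_nhds (x := (1 : ℝ))).div hzk (by linarith)).congr fun N => ?_
  have h := cReal_eq_powSum_mul (by omega : k ≠ 0) N
  have hc := cReal_pos N
  rw [P_real]
  have h1 : (powSum k N).toReal ≠ 0 := fun h1 => by
    rw [h1, zero_mul] at h
    exact hc.ne' h
  have h2 : mass N (S k) ≠ 0 := fun h2 => by
    rw [h2, mul_zero] at h
    exact hc.ne' h
  simp only [Pi.div_apply]
  rw [h]
  field_simp

lemma log_q_mul {j m : ℕ} (hm : m ∈ Omega (j + 1)) :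
    Real.log ((q j * m : ℕ) : ℝ) = Real.log (q j) + Real.log m := by
  have h1 : (q j : ℝ) ≠ 0 := by exact_mod_cast (q_prime j).ne_zero
  have h2 : (m : ℝ) ≠ 0 := by exact_mod_cast hm.1.ne'
  push_cast
  exact Real.log_mul h1 h2

lemma pPlus_q_mul {j m : ℕ} (hm : m ∈ Omega (j + 1)) : pPlus (q j * m) = q j :=
  pPlus_prime_mul (q_prime j) hm.1.ne' (mem_Omega_succ_iff.1 hm).2

lemma isLogTail_logRatio (s : ℝ) : IsLogTail (s - 1) {n | s ≤ logRatio n} := by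
  intro j m hm
  change s ≤ logRatio (q j * m) ↔ _
  rw [logRatio, pPlus_q_mul hm, log_q_mul hm, le_div_iff₀ (log_q_pos j), sub_mul, one_mul,
    sub_le_iff_le_add']

lemma isLogTail_logRatioSet (s : ℝ) : IsLogTail (s - 1) (logRatioSet s) := fun j m hm =>
  ⟨fun h => (isLogTail_logRatio s j m hm).1 h.2,
    fun h => ⟨Nat.mul_pos (q_prime j).pos hm.1, (isLogTail_logRatio s j m hm).2 h⟩⟩

/-- For `s > 0`, `smoothSet s` and `logRatioSet s` differ only at `n = 1`: by the conventions there,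
`1` lies in the former and not in the latter. `IsLogTail` does not see this, as `q j * m > 1`. -/
lemma isLogTail_smoothSet {s : ℝ} (hs : 0 < s) : IsLogTail (s - 1) (smoothSet s) := by
  intro j m hm
  have hpos : 0 < q j * m := Nat.mul_pos (q_prime j).pos hm.1
  have hpos' : (0 : ℝ) < ((q j * m : ℕ) : ℝ) := by exact_mod_cast hpos
  have hq0 : (0 : ℝ) < q j := by exact_mod_cast (q_prime j).pos
  have h1 : q j * m ∈ smoothSet s ↔ (q j : ℝ) ≤ ((q j * m : ℕ) : ℝ) ^ (1 / s) := by
    refine ⟨fun h => ?_, fun h => ⟨hpos, by rwa [pPlus_q_mul hm]⟩⟩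
    have h2 := h.2
    rwa [pPlus_q_mul hm] at h2
  rw [h1, ← Real.log_le_log_iff hq0 (by positivity), Real.log_rpow hpos', log_q_mul hm,
    one_div_mul_eq_div, le_div_iff₀ hs, sub_mul, one_mul, sub_le_iff_le_add', mul_comm]

lemma P_real_inter_Omega (N : ℕ) (A : Set ℕ) : (P N).real (A ∩ Omega N) = (P N).real A := by
  rw [P_real, P_real, mass_congr (A := A ∩ Omega N) (B := A) fun n hn => and_iff_left hn]

lemma IsLogTail.hasLogIndepDensity {s : ℝ} (hs : 1 ≤ s) {A : Set ℕ} (hA : IsLogTail (s - 1) A) :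
    HasLogIndepDensity A (dickmanTail (s - 1)) := by
  have h := hA.tendsto_P
  rw [max_eq_left (by linarith)] at h
  exact h.congr fun N => (P_real_inter_Omega N A).symm

lemma IsLogTail.hasCondLogIndepDensity {s : ℝ} (hs : 1 ≤ s) {k : ℕ} (hk : 2 ≤ k) {A : Set ℕ}
    (hA : IsLogTail (s - 1) A) :
    HasCondLogIndepDensity A (S k) (dickmanTail (s - 1)) := by
  obtain ⟨z, hz, hzk⟩ := exists_tendsto_powSum hk
  have hz0 : z ≠ 0 := by linarith
  have h := hA.tendsto_P_inter_S hk hz hzk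
  rw [max_eq_left (by linarith)] at h
  refine ⟨_, _, h.congr fun N => (P_real_inter_Omega N _).symm,
    (tendsto_P_S hk hz hzk).congr fun N => (P_real_inter_Omega N _).symm,
    by positivity, ?_⟩
  field_simp

lemma tendsto_Pk_logRatio {k : ℕ} (hk : 2 ≤ k) (s : ℝ) :
    Tendsto (fun N => (Pk k N).real {n | s ≤ logRatio n}) atTop
      (𝓝 (dickmanTail (max (s - 1) 0))) := by
  obtain ⟨z, hz, hzk⟩ := exists_tendsto_powSum hk
  have hz0 : z ≠ 0 := by linarith
  have h := ((isLogTail_logRatio s).tendsto_P_inter_S hk hz hzk).div (tendsto_P_S hk hz hzk)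
    (by positivity)
  have hlim : dickmanTail (max (s - 1) 0) / z / (1 / z) = dickmanTail (max (s - 1) 0) := by
    field_simp
  rw [hlim] at h
  refine h.congr fun N => ?_
  rw [Pk, measureReal_def, cond_apply MeasurableSet.of_discrete, ENNReal.toReal_mul,
    ENNReal.toReal_inv, Set.inter_comm, ← div_eq_inv_mul]
  rfl

/-! ## Weak convergence -/

/-- Convergence in law on `ℝ` from convergence of the masses of all half-lines `[s, ∞)`. -/
lemma tendsto_probabilityMeasure_of_tendsto_Ici {μ : ℕ → ProbabilityMeasure ℝ}
    {ν : ProbabilityMeasure ℝ}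
    (h : ∀ s : ℝ, Tendsto (fun N => (μ N : Measure ℝ).real (Set.Ici s)) atTop
      (𝓝 ((ν : Measure ℝ).real (Set.Ici s)))) : Tendsto μ atTop (𝓝 ν) := by
  -- Half-open intervals `[a, b)` are differences of the given half-lines, form a π-system apart
  -- from empty intersections, and contain a neighbourhood of each point inside any open set.
  refine IsPiSystem.tendsto_probabilityMeasure_of_tendsto_of_mem
    (S := {t | ∃ a b : ℝ, a < b ∧ t = Set.Ico a b}) ?_ ?_ ?_ ?_
  · rintro _ ⟨a, b, -, rfl⟩ _ ⟨a', b', -, rfl⟩ hne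
    rw [Set.Ico_inter_Ico] at hne ⊢
    exact ⟨_, _, Set.nonempty_Ico.1 hne, rfl⟩
  · rintro _ ⟨a, b, -, rfl⟩
    exact measurableSet_Ico
  · intro u hu x hx
    obtain ⟨ε, hε, hball⟩ := Metric.isOpen_iff.1 hu x hx
    refine ⟨Set.Ico (x - ε / 2) (x + ε / 2), ⟨_, _, by linarith, rfl⟩,
      Ico_mem_nhds (by linarith) (by linarith), fun y hy => hball ?_⟩
    rw [Metric.mem_ball, Real.dist_eq, abs_lt]
    constructor <;> linarith [hy.1, hy.2]
  · rintro _ ⟨a, b, hab, rfl⟩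
    have key : ∀ κ : ProbabilityMeasure ℝ, (κ : Measure ℝ).real (Set.Ico a b) =
        (κ : Measure ℝ).real (Set.Ici a) - (κ : Measure ℝ).real (Set.Ici b) := fun κ => by
      rw [← Set.Ici_sdiff_Ici, measureReal_sdiff (Set.Ici_subset_Ici.2 hab.le) measurableSet_Ici]
    rw [← NNReal.tendsto_coe]
    have h1 := (h a).sub (h b)
    rw [← key] at h1
    refine h1.congr fun N => ?_
    rw [← key]
    rfl

lemma tendstoInDistribution_logRatio {Ω' : Type*} [MeasurableSpace Ω'] {Q : Measure Ω'}
    [IsProbabilityMeasure Q] {D : Ω' → ℝ} (hD : HasLaw D dickmanLaw Q) (μ : ℕ → Measure ℕ)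
    [∀ N, IsProbabilityMeasure (μ N)]
    (h : ∀ s : ℝ, Tendsto (fun N => (μ N).real {n | s ≤ logRatio n}) atTop
      (𝓝 (dickmanTail (max (s - 1) 0)))) :
    TendstoInDistribution (fun _ : ℕ => logRatio) atTop (fun ω => D ω + 1) μ Q where
  forall_aemeasurable _ := (measurable_of_countable _).aemeasurable
  aemeasurable_limit := hD.aemeasurable.add_const 1
  tendsto := by
    refine tendsto_probabilityMeasure_of_tendsto_Ici fun s => ?_
    have hlim : (Q.map fun ω => D ω + 1).real (Set.Ici s) = dickmanTail (max (s - 1) 0) := by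
      rw [← dickmanLaw_real_Ici, ← hD.map_eq,
        map_measureReal_apply_of_aemeasurable (hD.aemeasurable.add_const 1) measurableSet_Ici,
        map_measureReal_apply_of_aemeasurable hD.aemeasurable measurableSet_Ici]
      congr 1
      ext ω
      simp
    have hmap : ∀ N, ((μ N).map logRatio).real (Set.Ici s) = (μ N).real {n | s ≤ logRatio n} :=
      fun N => map_measureReal_apply (measurable_of_countable _) measurableSet_Ici
    simp only [ProbabilityMeasure.coe_mk, hlim, hmap]
    exact h s

end DickmanPN

end

/-! ### Assembly of the theorem -/

theorem mainTheorem2 :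
    -- the Dickman distribution is a probability distribution, and `ρ` is integrable on `(0,∞)`
    IsProbabilityMeasure DickmanPN.dickmanLaw ∧
    IntegrableOn DickmanPN.rho (Set.Ioi 0) ∧
    -- under `P_N` and under `P_N^{(k)}`, `log n / log p⁺(n)` converges weakly to `D + 1`,
    -- for every random variable `D` with the Dickman distribution
    (∀ (Ω' : Type*) [MeasurableSpace Ω'] (Q : Measure Ω') [IsProbabilityMeasure Q] (D : Ω' → ℝ),
      HasLaw D DickmanPN.dickmanLaw Q →
        TendstoInDistribution (fun _ : ℕ => DickmanPN.logRatio) atTop (fun ω => D ω + 1)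
          DickmanPN.P Q ∧
        ∀ (k : ℕ) (hk : 2 ≤ k),
          haveI := DickmanPN.isProbabilityMeasure_Pk hk
          TendstoInDistribution (fun _ : ℕ => DickmanPN.logRatio) atTop (fun ω => D ω + 1)
            (DickmanPN.Pk k) Q) ∧
    -- the log-indep densities of the `n^{1/s}`-smooth numbers
    (∀ s : ℝ, 1 ≤ s →
      DickmanPN.HasLogIndepDensity (DickmanPN.smoothSet s)
        (Real.exp (-Real.eulerMascheroniConstant) * ∫ x in Set.Ioi (s - 1), DickmanPN.rho x) ∧
      DickmanPN.HasLogIndepDensity (DickmanPN.logRatioSet s)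
        (Real.exp (-Real.eulerMascheroniConstant) * ∫ x in Set.Ioi (s - 1), DickmanPN.rho x)) ∧
    -- the same densities conditioned on the `k`-free integers
    (∀ (s : ℝ) (k : ℕ), 1 ≤ s → 2 ≤ k →
      DickmanPN.HasCondLogIndepDensity (DickmanPN.smoothSet s) (DickmanPN.S k)
        (Real.exp (-Real.eulerMascheroniConstant) * ∫ x in Set.Ioi (s - 1), DickmanPN.rho x) ∧
      DickmanPN.HasCondLogIndepDensity (DickmanPN.logRatioSet s) (DickmanPN.S k)
        (Real.exp (-Real.eulerMascheroniConstant) * ∫ x in Set.Ioi (s - 1), DickmanPN.rho x)) ∧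
    -- the natural density of the `n^{1/s}`-smooth numbers is `ρ(s)`, a different value if `s > 1`
    (∀ s : ℝ, 1 ≤ s → DickmanPN.HasNatDensity (DickmanPN.smoothSet s) (DickmanPN.rho s)) ∧
    (∀ s : ℝ, 1 < s →
      Real.exp (-Real.eulerMascheroniConstant) * (∫ x in Set.Ioi (s - 1), DickmanPN.rho x) ≠
        DickmanPN.rho s) := by
  refine ⟨DickmanPN.isProbabilityMeasure_dickmanLaw, DickmanPN.integrableOn_rho, ?_, ?_, ?_,
    fun s hs => DickmanPN.hasNatDensity_smoothSet hs,
    fun s hs => (DickmanPN.rho_lt_dickmanTail hs).ne'⟩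
  · intro Ω' _ Q _ D hD
    refine ⟨DickmanPN.tendstoInDistribution_logRatio hD _ fun s =>
      (DickmanPN.isLogTail_logRatio s).tendsto_P, fun k hk => ?_⟩
    have := DickmanPN.isProbabilityMeasure_Pk hk
    exact DickmanPN.tendstoInDistribution_logRatio hD _ (DickmanPN.tendsto_Pk_logRatio hk)
  · exact fun s hs =>
      ⟨(DickmanPN.isLogTail_smoothSet (by linarith)).hasLogIndepDensity hs,
        (DickmanPN.isLogTail_logRatioSet s).hasLogIndepDensity hs⟩
  · exact fun s k hs hk =>
      ⟨(DickmanPN.isLogTail_smoothSet (by linarith)).hasCondLogIndepDensity hs hk,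
        (DickmanPN.isLogTail_logRatioSet s).hasCondLogIndepDensity hs hk⟩
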